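/- Let $\Lambda,\Omega$ be finite subsets of $\mathbb{C}$ (for instance the exponents of formal monodromy and the Stokes values of a given linear differential system of single level one), and let $\mathbb{Z}\Lambda,\mathbb{Z}\Omega\subset\mathbb{C}$ be the additive groups they generate. Let $\widetilde{\mathcal H}=\widetilde{\mathcal H}_{\mathbb{Z}\Lambda,\mathbb{Z}\Omega}$ be the set of all formal meromorphic series $\widetilde f\in\mathbb{C}((x))$ that solve some linear differential equation $Dy=0$ with convergent meromorphic coefficients at $x=0$, of single level $0$ or $1$, with exponents of formal monodromy in $\mathbb{Z}\Lambda$ and Stokes values in $\mathbb{Z}\Omega$. That is, the companion system of $Dy=0$ has a formal fundamental solution $F(x)\,x^L e^{Q(1/x)}$ with $F$ an invertible matrix over $\mathbb{C}((x))$, $L=\bigoplus_j(\lambda_jI_{n_j}+J_{n_j})$ in Jordan form ($J_{n_j}$ the nilpotent Jordan block of size $n_j$), $Q(1/x)=\bigoplus_j(-a_j/x)I_{n_j}$, all $\lambda_j\in\mathbb{Z}\Lambda$ and all $a_j\in\mathbb{Z}\Omega$. Let $\mathcal B:\mathbb{C}((x))\to\mathbb{C}[\delta^{(k)},k\in\mathbb{N}]\oplus\mathbb{C}[[\xi]]$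 be the formal Borel transform, $\mathcal B(x^{-k})=\delta^{(k)}$ for $k\ge0$ and $\mathcal B(x^{n+1})=\xi^{n}/n!$ for $n\ge0$. The target carries the convolution product: $\delta^{(k)}*v=\partial_\xi^k v$ (with $\partial_\xi\varphi=\varphi'+\varphi(0)\delta$), and $\varphi*\psi=\int_0^\xi\varphi(\xi-t)\psi(t)\,dt$ for $\varphi,\psi\in\mathbb{C}[[\xi]]$. Then: 1. $\widetilde{\mathcal H}$ is a differential subalgebra of $(\mathbb{C}((x)),d/dx)$: it is a $\mathbb{C}$-subalgebra, stable under $d/dx$. 2. Consequently its counterpart $\widehat{\mathcal H}=\mathcal B(\widetilde{\mathcal H})$ in the Borel plane is a convolution algebra (a unital $\mathbb{C}$-subalgebra for $*$, isomorphic to $\widetilde{\mathcal H}$ through $\mathcal B$). Multiplication by $\xi$ maps $\widehat{\mathcal H}$ into itself and is a derivation of it, the counterpart of $x^2\,d/dx$; the counterpart of $d/dx$ is $v\mapsto\partial_\xi^2(\xi v)$. 3. The elements of $\widehat{\mathcal H}$ have singularities at finitely many points of $\mathbb{Z}\Omega$ only, and these are simple-moderate up to multiple poles. Precisely, let $\varphi\in\mathbb{C}[[\xi]]$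 be the regular part of an element of $\widehat{\mathcal H}$. There are a finite set $S\subset\mathbb{Z}\Omega$ containing $0$ and an $m\in\mathbb{N}$ such that $\varphi$ converges near $0$, can be continued analytically along every path issuing from $0$ and avoiding $S$ afterwards, and the following holds. Let $\omega\in S$, let $D$ be an open disc centred at $\omega$ that contains no other point of $S$, and let $\gamma$ be such a path ending at a point of $D$. Then, near the end point of $\gamma$, the continuation of $\varphi$ along $\gamma$ is a finite sum $$\sum_{\mu,p} h_{\mu,p}(\zeta)\,\zeta^{\mu-m}\,(\ln\zeta)^p,\qquad \zeta=\xi-\omega,\quad 0\le\operatorname{Re}\mu<1,\quad p\in\mathbb{N},$$ with each $h_{\mu,p}$ holomorphic for $\omega+\zeta\in D$. (The case $m=1$ is the case of simple-moderate singularities.) -/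

import Mathlib

open Filter Topology

noncomputable section

namespace LevelOne

/-! ## Linear differential equations over the convergent meromorphic series -/

/-- A formal meromorphic series at `x = 0` is convergent when its Taylor part has positive radius of
convergence (its polar part is finite in any case). -/
def IsConvergent (f : LaurentSeries ℂ) : Prop :=
  0 < (FormalMultilinearSeries.ofScalars ℂ (fun n : ℕ => f.coeff (n : ℤ))).radius

/-- The derivation `d/dx` of the field of formal meromorphic series. -/
abbrev ddx : LaurentSeries ℂ →ₗ[ℂ] LaurentSeries ℂ := LaurentSeries.derivative ℂ

/-- The series `a * x ^ k`. -/
abbrev mono (k : ℤ) (a : ℂ) : LaurentSeries ℂ := HahnSeries.single k a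

/-- The monic operator `D = (d/dx)^N + ∑_{i < N} c i (d/dx)^i`, applied to a series. -/
def diffOp {N : ℕ} (c : Fin N → LaurentSeries ℂ) (f : LaurentSeries ℂ) : LaurentSeries ℂ :=
  ddx^[N] f + ∑ i : Fin N, c i * ddx^[(i : ℕ)] f

/-- The companion matrix `C`: the equation `D y = 0` is the system `Y' = C Y` for
`Y = (y, y', …, y^(N-1))`. -/
def companion {N : ℕ} (c : Fin N → LaurentSeries ℂ) :
    Matrix (Fin N) (Fin N) (LaurentSeries ℂ) :=
  Matrix.of fun i j =>
    if (j : ℕ) = (i : ℕ) + 1 then 1 else if (i : ℕ) + 1 = N then - c j else 0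

/-- The nilpotent Jordan block of size `n`. -/
def nilJordan (n : ℕ) : Matrix (Fin n) (Fin n) (LaurentSeries ℂ) :=
  Matrix.of fun i j => if (j : ℕ) = (i : ℕ) + 1 then 1 else 0

/-- The matrix `A₀ = ⊕_j (a_j I + x (lam_j I + J_{n_j}))` of the normal form `x² Y' = A₀ Y`, whose
fundamental solution is `x^L exp(Q(1/x))` with `L = ⊕_j (lam_j I + J_{n_j})` and
`Q(1/x) = ⊕_j (-a_j/x) I`. -/
def normalForm {J : ℕ} (n : Fin J → ℕ) (lam a : Fin J → ℂ) :
    Matrix (Σ j, Fin (n j)) (Σ j, Fin (n j)) (LaurentSeries ℂ) :=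
  Matrix.blockDiagonal' fun j =>
    mono 0 (a j) • (1 : Matrix (Fin (n j)) (Fin (n j)) (LaurentSeries ℂ)) +
      mono 1 1 • (mono 0 (lam j) • (1 : Matrix (Fin (n j)) (Fin (n j)) (LaurentSeries ℂ)) +
        nilJordan (n j))

/-- The equation `D y = 0` has a formal fundamental solution `F(x) x^L exp(Q(1/x))` with `F` an
invertible formal meromorphic matrix, where `L = ⊕_j (lam_j I + J_{n_j})` is a Jordan matrix of
exponents of formal monodromy `lam_j` and `Q(1/x) = ⊕_j (-a_j/x) I` with Stokes values `a_j`.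
All the determining polynomials being of the form `-a_j/x`, the equation has single level `1`, or
level `0` when the `a_j` coincide. Since `L` and `Q` commute, `F x^L exp(Q(1/x))` is a solution of
`Y' = C Y` exactly when `x² F' = x² C F - F A₀`. -/
def HasFormalFundamentalSolution {N : ℕ} (c : Fin N → LaurentSeries ℂ)
    {J : ℕ} (n : Fin J → ℕ) (lam a : Fin J → ℂ) : Prop :=
  ∃ (F : Matrix (Fin N) (Σ j, Fin (n j)) (LaurentSeries ℂ))
    (G : Matrix (Σ j, Fin (n j)) (Fin N) (LaurentSeries ℂ)),
    F * G = 1 ∧ G * F = 1 ∧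
    mono 2 1 • F.map ddx = mono 2 1 • (companion c * F) - F * normalForm n lam a

/-- The set of all formal meromorphic series that solve a linear differential equation `D y = 0`
with convergent meromorphic coefficients, of single level `0` or `1`, with exponents of formal
monodromy in `ℤ Λ` and Stokes values in `ℤ Ω`. -/
def solutionSet (Λ Ω : Finset ℂ) : Set (LaurentSeries ℂ) :=
  {f | ∃ (N : ℕ) (c : Fin N → LaurentSeries ℂ) (J : ℕ) (n : Fin J → ℕ) (lam a : Fin J → ℂ),
    (∀ i, IsConvergent (c i)) ∧ (∀ j, 0 < n j) ∧
    HasFormalFundamentalSolution c n lam a ∧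
    (∀ j, lam j ∈ Submodule.span ℤ (Λ : Set ℂ)) ∧
    (∀ j, a j ∈ Submodule.span ℤ (Ω : Set ℂ)) ∧
    diffOp c f = 0}

/-! ## The Borel plane -/

/-- Elements `∑ P_k δ^(k) + φ(ξ)` of `ℂ[δ^(k), k ∈ ℕ] ⊕ ℂ[[ξ]]`, as pairs `(∑ P_k X^k, φ)`. -/
def BorelSeries : Type := Polynomial ℂ × PowerSeries ℂ

namespace BorelSeries

/-- The coefficients of the derivatives of the Dirac distribution. -/
def sing (u : BorelSeries) : Polynomial ℂ := u.1

/-- The part in `ℂ[[ξ]]`. -/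
def reg (u : BorelSeries) : PowerSeries ℂ := u.2

/-- The element `∑ P_k δ^(k) + φ(ξ)`. -/
def mk (P : Polynomial ℂ) (φ : PowerSeries ℂ) : BorelSeries := (P, φ)

instance : AddCommGroup BorelSeries := inferInstanceAs (AddCommGroup (Polynomial ℂ × PowerSeries ℂ))

instance : Module ℂ BorelSeries := inferInstanceAs (Module ℂ (Polynomial ℂ × PowerSeries ℂ))

/-- The derivation `∂_ξ` in the sense of distributions: `∂ δ^(k) = δ^(k+1)` and
`∂ φ = φ' + φ(0) δ`. -/
def dxi : BorelSeries →ₗ[ℂ] BorelSeries where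
  toFun u := mk (Polynomial.X * u.sing + Polynomial.C (PowerSeries.constantCoeff u.reg))
    (PowerSeries.derivative ℂ u.reg)
  map_add' u v := by
    refine Prod.ext ?_ ?_
    · change Polynomial.X * (u.1 + v.1) + Polynomial.C (PowerSeries.constantCoeff (u.2 + v.2)) =
        (Polynomial.X * u.1 + Polynomial.C (PowerSeries.constantCoeff u.2)) +
        (Polynomial.X * v.1 + Polynomial.C (PowerSeries.constantCoeff v.2))
      rw [map_add, map_add]; ring
    · exact map_add (PowerSeries.derivative ℂ) u.2 v.2
  map_smul' r u := by
    refine Prod.ext ?_ ?_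
    · change Polynomial.X * (r • u.1) + Polynomial.C (PowerSeries.constantCoeff (r • u.2)) =
        r • (Polynomial.X * u.1 + Polynomial.C (PowerSeries.constantCoeff u.2))
      simp [Polynomial.smul_eq_C_mul]; ring
    · exact (PowerSeries.derivative ℂ).map_smul r u.2

/-- Multiplication by `ξ`: `ξ δ = 0`, `ξ δ^(k+1) = -(k+1) δ^(k)`, and the usual product on
`ℂ[[ξ]]`. -/
def mulXi (u : BorelSeries) : BorelSeries :=
  mk (-(Polynomial.derivative u.sing)) (PowerSeries.X * u.reg)

/-- The convolution `φ ⋆ ψ = ∫_0^ξ φ(ξ - t) ψ(t) dt` of power series, computed term by term with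
`∫_0^ξ (ξ - t)^i t^j dt = i! j! / (i + j + 1)! ξ^(i+j+1)`. -/
def conv (φ ψ : PowerSeries ℂ) : PowerSeries ℂ :=
  PowerSeries.mk fun m => match m with
    | 0 => 0
    | k + 1 => ∑ p ∈ Finset.HasAntidiagonal.antidiagonal k,
        PowerSeries.coeff p.1 φ * PowerSeries.coeff p.2 ψ *
          ((p.1.factorial : ℂ) * (p.2.factorial : ℂ) / ((k + 1).factorial : ℂ))

/-- The Dirac distribution `δ` is the unit of convolution. -/
instance : One BorelSeries := ⟨mk 1 0⟩

/-- The convolution product: `δ^(k) ⋆ v = ∂^k v`, and `φ ⋆ ψ` is the integral above for `φ` and `ψ`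
in `ℂ[[ξ]]`. -/
instance : Mul BorelSeries := ⟨fun u v =>
  Polynomial.aeval dxi u.sing v + Polynomial.aeval dxi v.sing (mk 0 u.reg) +
    mk 0 (conv u.reg v.reg)⟩

/-- The power series `∑ n! φ_n x^(n+1)`. -/
def laplaceReg (φ : PowerSeries ℂ) : PowerSeries ℂ :=
  PowerSeries.X * PowerSeries.mk fun n => (n.factorial : ℂ) * PowerSeries.coeff n φ

/-- The formal Laplace transform. It only serves to check the ring axioms. -/
def laplace (u : BorelSeries) : LaurentSeries ℂ :=
  Polynomial.eval₂ HahnSeries.C (mono (-1) 1) u.sing + HahnSeries.ofPowerSeries ℤ ℂ (laplaceReg u.reg)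

theorem laplace_add (u v : BorelSeries) : laplace (u + v) = laplace u + laplace v := by
  have h : laplaceReg (u.2 + v.2) = laplaceReg u.2 + laplaceReg v.2 := by
    simp only [laplaceReg, ← mul_add]
    congr 1
    ext n
    simp [mul_add]
  change Polynomial.eval₂ HahnSeries.C (mono (-1) 1) (u.1 + v.1) + HahnSeries.ofPowerSeries ℤ ℂ (laplaceReg (u.2 + v.2)) = _
  rw [h, Polynomial.eval₂_add, map_add]
  simp only [laplace, sing, reg]
  ring

theorem laplace_smul (r : ℂ) (u : BorelSeries) : laplace (r • u) = HahnSeries.C r * laplace u := by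
  have h : laplaceReg (r • u.2) = PowerSeries.C r * laplaceReg u.2 := by
    ext n
    cases n with
    | zero => simp [laplaceReg]
    | succ n => simp [laplaceReg, PowerSeries.coeff_succ_X_mul]; ring
  change Polynomial.eval₂ HahnSeries.C (mono (-1) 1) (r • u.1) + HahnSeries.ofPowerSeries ℤ ℂ (laplaceReg (r • u.2)) = _
  rw [h, Polynomial.eval₂_smul, map_mul, HahnSeries.ofPowerSeries_C]
  simp only [laplace, sing, reg]
  ring

theorem laplace_dxi (u : BorelSeries) : laplace (dxi u) = mono (-1) 1 * laplace u := by
  have h1 : PowerSeries.mk (fun n => (n.factorial : ℂ) * PowerSeries.coeff n u.2) =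
      PowerSeries.C (PowerSeries.constantCoeff u.2) +
        laplaceReg (PowerSeries.derivative ℂ u.2) := by
    ext n
    cases n with
    | zero => simp [laplaceReg]
    | succ n =>
      simp [laplaceReg, PowerSeries.coeff_succ_X_mul, PowerSeries.coeff_derivative, Nat.factorial_succ]
      ring
  have h2 : mono (-1) 1 * HahnSeries.ofPowerSeries ℤ ℂ (laplaceReg u.2) =
      HahnSeries.C (PowerSeries.constantCoeff u.2) +
        HahnSeries.ofPowerSeries ℤ ℂ (laplaceReg (PowerSeries.derivative ℂ u.2)) := by
    rw [← HahnSeries.ofPowerSeries_C (Γ := ℤ), ← map_add, ← h1, laplaceReg, map_mul,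
      HahnSeries.ofPowerSeries_X, ← mul_assoc, HahnSeries.single_mul_single]
    simp
  change Polynomial.eval₂ HahnSeries.C (mono (-1) 1) (Polynomial.X * u.1 + Polynomial.C (PowerSeries.constantCoeff u.2)) +
    HahnSeries.ofPowerSeries ℤ ℂ (laplaceReg (PowerSeries.derivative ℂ u.2)) = _
  simp only [laplace, sing, reg]
  rw [mul_add, h2, Polynomial.eval₂_add, Polynomial.eval₂_mul, Polynomial.eval₂_X,
    Polynomial.eval₂_C]
  ring

theorem laplace_aeval (P : Polynomial ℂ) (u : BorelSeries) :
    laplace (Polynomial.aeval dxi P u) = Polynomial.eval₂ HahnSeries.C (mono (-1) 1) P * laplace u := by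
  induction P using Polynomial.induction_on' with
  | add p q hp hq => simp [laplace_add, hp, hq, add_mul, Polynomial.eval₂_add]
  | monomial n a =>
    have h : ∀ n : ℕ, laplace ((dxi ^ n) u) = (mono (-1) 1) ^ n * laplace u := by
      intro n
      induction n with
      | zero => simp
      | succ n ih =>
        rw [pow_succ', Module.End.mul_apply, laplace_dxi, ih]
        ring
    rw [Polynomial.aeval_monomial, Polynomial.eval₂_monomial, ← Algebra.smul_def,
      LinearMap.smul_apply, laplace_smul, h, mul_assoc]

theorem laplaceReg_conv (φ ψ : PowerSeries ℂ) :
    laplaceReg (conv φ ψ) = laplaceReg φ * laplaceReg ψ := by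
  have h : PowerSeries.mk (fun n => (n.factorial : ℂ) * PowerSeries.coeff n (conv φ ψ)) =
      PowerSeries.X * (PowerSeries.mk (fun n => (n.factorial : ℂ) * PowerSeries.coeff n φ) *
        PowerSeries.mk (fun n => (n.factorial : ℂ) * PowerSeries.coeff n ψ)) := by
    ext n
    cases n with
    | zero => simp [conv]
    | succ n =>
      rw [PowerSeries.coeff_succ_X_mul, PowerSeries.coeff_mul, PowerSeries.coeff_mk, conv,
        PowerSeries.coeff_mk, Finset.mul_sum]
      refine Finset.sum_congr rfl fun p _ => ?_
      have : ((n + 1).factorial : ℂ) ≠ 0 := by exact_mod_cast Nat.factorial_ne_zero _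
      simp only [PowerSeries.coeff_mk]
      field_simp
  rw [laplaceReg, h, laplaceReg, laplaceReg]
  ring

theorem laplace_mk_zero (φ : PowerSeries ℂ) :
    laplace (mk 0 φ) = HahnSeries.ofPowerSeries ℤ ℂ (laplaceReg φ) := by
  simp [laplace, mk, sing, reg]

theorem laplace_mul (u v : BorelSeries) : laplace (u * v) = laplace u * laplace v := by
  change laplace (Polynomial.aeval dxi u.sing v + Polynomial.aeval dxi v.sing (mk 0 u.reg) +
    mk 0 (conv u.reg v.reg)) = _
  rw [laplace_add, laplace_add, laplace_aeval, laplace_aeval, laplace_mk_zero, laplace_mk_zero,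
    laplaceReg_conv, map_mul]
  simp only [laplace]
  ring

theorem laplace_one : laplace 1 = 1 := by
  change Polynomial.eval₂ HahnSeries.C (mono (-1) 1) (1 : Polynomial ℂ) +
    HahnSeries.ofPowerSeries ℤ ℂ (laplaceReg (0 : PowerSeries ℂ)) = 1
  have : laplaceReg (0 : PowerSeries ℂ) = 0 := by
    ext n
    cases n <;> simp [laplaceReg, PowerSeries.coeff_succ_X_mul]
  rw [this, Polynomial.eval₂_one, map_zero, add_zero]

theorem coeff_laplace_neg (u : BorelSeries) (k : ℕ) :
    (laplace u).coeff (-(k : ℤ)) = u.sing.coeff k := by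
  have h1 : (HahnSeries.ofPowerSeries ℤ ℂ (laplaceReg u.reg)).coeff (-(k : ℤ)) = 0 := by
    cases k with
    | zero =>
      have := HahnSeries.ofPowerSeries_apply_coeff (Γ := ℤ) (laplaceReg u.reg) 0
      simpa [laplaceReg] using this
    | succ k =>
      exact (PowerSeries.coeff_coe _ _).trans (if_pos (by omega))
  have h2 : ∀ P : Polynomial ℂ, (Polynomial.eval₂ HahnSeries.C (mono (-1) 1) P).coeff (-(k : ℤ)) =
      P.coeff k := by
    intro P
    induction P using Polynomial.induction_on' with
    | add p q hp hq => simp [hp, hq, Polynomial.eval₂_add]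
    | monomial n a =>
      rw [Polynomial.eval₂_monomial, HahnSeries.single_pow, HahnSeries.C_mul_eq_smul,
        HahnSeries.coeff_smul, HahnSeries.coeff_single, Polynomial.coeff_monomial]
      by_cases hnk : n = k
      · simp [hnk]
      · have : ¬ (-(k : ℤ) = n • (-1 : ℤ)) := by simp; omega
        rw [if_neg this, if_neg hnk, smul_zero]
  rw [laplace, HahnSeries.coeff_add, h1, h2, add_zero]

theorem coeff_laplace_succ (u : BorelSeries) (k : ℕ) :
    (laplace u).coeff ((k : ℤ) + 1) = (k.factorial : ℂ) * PowerSeries.coeff k u.reg := by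
  have h1 : (HahnSeries.ofPowerSeries ℤ ℂ (laplaceReg u.reg)).coeff ((k : ℤ) + 1) =
      (k.factorial : ℂ) * PowerSeries.coeff k u.reg := by
    have := HahnSeries.ofPowerSeries_apply_coeff (Γ := ℤ) (laplaceReg u.reg) (k + 1)
    simpa [laplaceReg, PowerSeries.coeff_succ_X_mul] using this
  have h2 : ∀ P : Polynomial ℂ, (Polynomial.eval₂ HahnSeries.C (mono (-1) 1) P).coeff ((k : ℤ) + 1) = 0 := by
    intro P
    induction P using Polynomial.induction_on' with
    | add p q hp hq => simp [hp, hq, Polynomial.eval₂_add]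
    | monomial n a =>
      rw [Polynomial.eval₂_monomial, HahnSeries.single_pow, HahnSeries.C_mul_eq_smul,
        HahnSeries.coeff_smul, HahnSeries.coeff_single, if_neg (by simp; omega), smul_zero]
  rw [laplace, HahnSeries.coeff_add, h1, h2, zero_add]

theorem laplace_injective : Function.Injective laplace := by
  intro u v h
  refine Prod.ext ?_ ?_
  · ext k
    have := congrArg (fun f => f.coeff (-(k : ℤ))) h
    simp only [coeff_laplace_neg] at this
    exact this
  · ext k
    have := congrArg (fun f => f.coeff ((k : ℤ) + 1)) h
    simp only [coeff_laplace_succ] at this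
    exact mul_left_cancel₀ (by exact_mod_cast Nat.factorial_ne_zero k) this

theorem laplace_zero : laplace 0 = 0 := by
  have := laplace_smul 0 0
  rwa [zero_smul, map_zero, zero_mul] at this

/-- The commutative ring whose product is the convolution product. -/
instance : CommRing BorelSeries :=
  { (inferInstance : AddCommGroup BorelSeries), (inferInstance : Mul BorelSeries),
    (inferInstance : One BorelSeries) with
    mul_assoc := fun u v w => laplace_injective (by simp only [laplace_mul, mul_assoc])
    mul_comm := fun u v => laplace_injective (by simp only [laplace_mul, mul_comm])
    one_mul := fun u => laplace_injective (by simp only [laplace_mul, laplace_one, one_mul])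
    mul_one := fun u => laplace_injective (by simp only [laplace_mul, laplace_one, mul_one])
    zero_mul := fun u => laplace_injective (by simp only [laplace_mul, laplace_zero, zero_mul])
    mul_zero := fun u => laplace_injective (by simp only [laplace_mul, laplace_zero, mul_zero])
    left_distrib := fun u v w => laplace_injective (by
      simp only [laplace_mul, laplace_add, mul_add])
    right_distrib := fun u v w => laplace_injective (by
      simp only [laplace_mul, laplace_add, add_mul]) }

/-- The `ℂ`-algebra of the Borel plane. -/
instance : Algebra ℂ BorelSeries :=
  Algebra.ofModule
    (fun r u v => laplace_injective (by simp only [laplace_mul, laplace_smul, mul_assoc]))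
    (fun r u v => laplace_injective (by simp only [laplace_mul, laplace_smul, mul_left_comm]))

end BorelSeries

/-- The formal Borel transform: `x^(-k) ↦ δ^(k)` for `k ≥ 0` and `x^(n+1) ↦ ξ^n / n!`. -/
def borelTransform (f : LaurentSeries ℂ) : BorelSeries :=
  BorelSeries.mk
    (∑ k ∈ Finset.range ((-f.order).toNat + 1), Polynomial.monomial k (f.coeff (-(k : ℤ))))
    (PowerSeries.mk fun n => f.coeff ((n : ℤ) + 1) / (n.factorial : ℂ))

/-! ## Resurgence and singularities in the Borel plane -/

/-- The power series `φ` converges near `0` and `F` is its sum there. -/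
def IsSum (φ : PowerSeries ℂ) (F : ℂ → ℂ) : Prop :=
  HasFPowerSeriesAt F (FormalMultilinearSeries.ofScalars ℂ fun n => PowerSeries.coeff n φ) 0

/-- A path issuing from `0` that avoids `S` except at its starting point. -/
def Admissible (S : Finset ℂ) (γ : C(unitInterval, ℂ)) : Prop :=
  γ 0 = 0 ∧ ∀ t, t ≠ 0 → γ t ∉ S

/-- `g t` represents a germ of analytic function at `γ t` for each `t`, and these germs are
deduced from one another by analytic continuation along `γ`. -/
def IsContinuation (γ : C(unitInterval, ℂ)) (g : unitInterval → ℂ → ℂ) : Prop :=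
  (∀ t, AnalyticAt ℂ (g t) (γ t)) ∧ ∀ t, ∀ᶠ s in 𝓝 t, g s =ᶠ[𝓝 (γ s)] g t

/-- `φ` is resurgent with singular support `S`: it converges near `0` and its sum can be continued
analytically along every path issuing from `0` and avoiding `S` afterwards. -/
def IsResurgent (S : Finset ℂ) (φ : PowerSeries ℂ) : Prop :=
  (∃ F, IsSum φ F) ∧ ∀ γ, Admissible S γ → ∃ g, IsContinuation γ g ∧ IsSum φ (g 0)

/-- Near the point `ξ₀` of the punctured disc of centre `ω` and radius `R`, the function `F` is a
finite sum of terms `h_{μ,p}(ζ) ζ^(μ - m) (ln ζ)^p`, where `ζ = ξ - ω`, `0 ≤ Re μ < 1`, `ln` is a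
determination of the logarithm near `ξ₀ - ω` and the `h_{μ,p}` are holomorphic on the disc
`|ζ| < R`. For `m = 1` this means that the singularity at `ω` is simple-moderate (the terms with
`μ = 0` form the simple part); for larger `m`, multiple poles are allowed. -/
def HasModerateForm (m : ℕ) (ω : ℂ) (R : ℝ) (ξ₀ : ℂ) (F : ℂ → ℂ) : Prop :=
  ∃ (E : Finset ℂ) (M : ℕ) (h : ℂ → ℕ → ℂ → ℂ) (ln : ℂ → ℂ),
    (∀ μ ∈ E, 0 ≤ μ.re ∧ μ.re < 1) ∧
    (∀ μ ∈ E, ∀ p ≤ M, DifferentiableOn ℂ (h μ p) (Metric.ball 0 R)) ∧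
    AnalyticAt ℂ ln (ξ₀ - ω) ∧ (∀ᶠ ζ in 𝓝 (ξ₀ - ω), Complex.exp (ln ζ) = ζ) ∧
    ∀ᶠ ζ in 𝓝 (ξ₀ - ω), F (ω + ζ) =
      ∑ μ ∈ E, ∑ p ∈ Finset.range (M + 1),
        h μ p ζ * Complex.exp ((μ - (m : ℂ)) * ln ζ) * ln ζ ^ p

/-- All the singularities of `φ` lie in `S` and are simple-moderate up to poles of order `m`: for
every path `γ` from `0` towards a point `ω` of `S`, i.e. ending in a disc around `ω` that contains
no other point of `S`, the continuation of `φ` along `γ` has at `ω` the form above. -/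
def HasModerateSingularities (m : ℕ) (S : Finset ℂ) (φ : PowerSeries ℂ) : Prop :=
  IsResurgent S φ ∧
  ∀ γ g, Admissible S γ → IsContinuation γ g → IsSum φ (g 0) →
    ∀ ω ∈ S, ∀ R : ℝ, (∀ ω' ∈ S, ω' ∈ Metric.ball ω R → ω' = ω) → γ 1 ∈ Metric.ball ω R →
      HasModerateForm m ω R (γ 1) (g 1)

end LevelOne

end

open Filter Topology

noncomputable section

namespace LevelOne

/-! Stability. Exponents and Stokes values of a direct sum of systems are those of the summands;
those of a tensor product are sums of one from each factor. As `ℤΛ` and `ℤΩ` are groups, nothing new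
appears. This is cleaner for systems than for scalar equations, so solutions are described by
`IsSystemSolution`: convergent linear forms in a solution of a convergent system whose columns are
spanned by vectors killed by powers of `twist A (formalExp a l)`. The span condition
`HasSpecialSpan` passes to direct sums, tensor products and quotients. For a companion system it
amounts to a formal fundamental solution: the columns of such a solution are special, and conversely
`exists_jordan_chains` arranges special vectors in Jordan chains, which
`linearIndependent_of_chains` shows to be independent over `ℂ((x))`. To return to a scalar equation
(`IsSystemSolution.mem_solutionSet`), the linear form is differentiated until a derivative depends
on the preceding ones over the field of convergent series; the companion system so obtained is a
quotient of the given one.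

Borel plane. The formal Laplace transform is injective, inverts the Borel transform and turns
convolution into the product, so every identity is checked on Laurent series.

Singularities. Truncating a normalised formal fundamental solution gives a convergent gauge
transformation to `x² h' = (a + x L + x² ∑ C_j x^j) h`, with `a` diagonal, `L` in Jordan form and `1
≤ Re λ < 2`. With `∂^(-1)` the integration from `0`, the Borel transform `φ` of `h` satisfies `(ξ -
a) φ' = (L - 1) φ + ∑ C_j ∂^(-j-1) φ`. The integral terms are removed by enlarging the unknown: the
functions `b_i = ρ^(-i) ∑_j C_(i+j) ∂^(-j-1) φ` satisfy `b_i' = ρ^(-i) C_i φ + ρ b_(i+1)`, and since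
`C_i = O(ρ^i)` these are bounded operators on bounded sequences. Thus `(φ, b)` solves a linear
differential equation in a Banach space with rational coefficients and simple poles at `0` and the
Stokes values at most (`hasModerateSingularities_of_prepared`).

Each residue is killed by a polynomial whose roots are `0` and the `λ - 1`, with real parts in `[0,
1)`, hence never differing by a nonzero integer. So the theory of Fuchs holds verbatim: near a pole
every solution is `P(ζ) exp(R ln ζ) c` with `P` holomorphic up to the next pole, and `exp(R ln ζ)`
is a finite sum of terms `ζ^μ (ln ζ)^p` (`hasModerateForm_of_isSol`). Continuation along paths is
that of solutions of a linear equation (`exists_continuation`). Poles of the linear form correspond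
to derivations in `ξ`, which lower the exponents by an integer `m`. -/

/-! ## The field of convergent meromorphic series -/

/-- A sequence bounded by a geometric one. -/
def GeomBounded {E : Type*} [Norm E] (a : ℕ → E) : Prop :=
  ∃ C r : ℝ, 0 ≤ C ∧ 1 ≤ r ∧ ∀ n, ‖a n‖ ≤ C * r ^ n

/-- Geometric bounds are easier to combine than radii, and later supply the weight `ρ` of the
sequence space. The ratio may always be enlarged to be at least `1`. -/
theorem isConvergent_iff (f : LaurentSeries ℂ) :
    IsConvergent f ↔ GeomBounded fun n : ℕ => f.coeff (n : ℤ) := by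
  constructor
  · intro h
    obtain ⟨r, hr0, hr⟩ := ENNReal.lt_iff_exists_nnreal_btwn.mp h
    obtain ⟨C, hC, hb⟩ := FormalMultilinearSeries.norm_mul_pow_le_of_lt_radius _ hr
    have hr0 : 0 < (r : ℝ) := by exact_mod_cast hr0
    refine ⟨C, max 1 (r : ℝ)⁻¹, hC.le, le_max_left _ _, fun n => ?_⟩
    have h1 := hb n
    rw [FormalMultilinearSeries.ofScalars_norm] at h1
    calc ‖f.coeff (n : ℤ)‖ = ‖f.coeff (n : ℤ)‖ * (r : ℝ) ^ n * (r : ℝ)⁻¹ ^ n := by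
          rw [inv_pow, mul_inv_cancel_right₀ (by positivity)]
      _ ≤ C * (r : ℝ)⁻¹ ^ n := by gcongr
      _ ≤ _ := by gcongr; exact le_max_right _ _
  · rintro ⟨C, r, hC, hr, h⟩
    have hr0 : 0 < r := by linarith
    have : ENNReal.ofNNReal ⟨r⁻¹, by positivity⟩ ≤
        (FormalMultilinearSeries.ofScalars ℂ (fun n : ℕ => f.coeff (n : ℤ))).radius := by
      refine FormalMultilinearSeries.le_radius_of_bound _ C fun n => ?_
      rw [FormalMultilinearSeries.ofScalars_norm]
      change ‖f.coeff (n : ℤ)‖ * r⁻¹ ^ n ≤ C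
      rw [inv_pow, ← div_eq_mul_inv, div_le_iff₀ (by positivity)]
      exact h n
    refine lt_of_lt_of_le ?_ this
    exact ENNReal.coe_pos.mpr (show (0 : ℝ) < r⁻¹ by positivity)

namespace GeomBounded

variable {E : Type*} [SeminormedAddCommGroup E]

theorem exists_common {ι : Type*} [Finite ι] {a : ι → ℕ → E} (h : ∀ i, GeomBounded (a i)) :
    ∃ C r : ℝ, 0 ≤ C ∧ 1 ≤ r ∧ ∀ i n, ‖a i n‖ ≤ C * r ^ n := by
  choose C r hC hr hb using h
  obtain ⟨C', hC'⟩ := (Set.finite_range C).bddAbove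
  obtain ⟨r', hr'⟩ := (Set.finite_range r).bddAbove
  refine ⟨max 0 C', max 1 r', le_max_left _ _, le_max_left _ _, fun i n => (hb i n).trans ?_⟩
  have h1 : C i ≤ max 0 C' := (hC' ⟨i, rfl⟩).trans (le_max_right _ _)
  have h2 : r i ≤ max 1 r' := (hr' ⟨i, rfl⟩).trans (le_max_right _ _)
  have := hC i
  have := hr i
  gcongr

theorem exists_common₂ {F : Type*} [SeminormedAddCommGroup F] {a : ℕ → E} {b : ℕ → F}
    (ha : GeomBounded a) (hb : GeomBounded b) :
    ∃ C r : ℝ, 0 ≤ C ∧ 1 ≤ r ∧ ∀ n, ‖a n‖ ≤ C * r ^ n ∧ ‖b n‖ ≤ C * r ^ n := by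
  obtain ⟨C, r, hC, hr, ha⟩ := ha
  obtain ⟨D, s, hD, hs, hb⟩ := hb
  refine ⟨max C D, max r s, le_max_of_le_left hC, le_max_of_le_left hr, fun n => ⟨?_, ?_⟩⟩
  · refine (ha n).trans ?_
    gcongr
    exacts [le_max_left _ _, le_max_left _ _]
  · refine (hb n).trans ?_
    gcongr
    exacts [le_max_right _ _, le_max_right _ _]

theorem add {a b : ℕ → E} (ha : GeomBounded a) (hb : GeomBounded b) :
    GeomBounded fun n => a n + b n := by
  obtain ⟨C, r, hC, hr, h⟩ := exists_common₂ ha hb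
  refine ⟨2 * C, r, by positivity, hr, fun n => ?_⟩
  have := norm_add_le (a n) (b n)
  have := h n
  linarith

theorem neg {a : ℕ → E} (ha : GeomBounded a) : GeomBounded fun n => - a n := by
  obtain ⟨C, r, hC, hr, h⟩ := ha
  exact ⟨C, r, hC, hr, fun n => by simpa using h n⟩

theorem of_succ {a : ℕ → E} (h : GeomBounded fun n => a (n + 1)) : GeomBounded a := by
  obtain ⟨C, r, hC, hr, h⟩ := h
  refine ⟨max C ‖a 0‖, r, le_max_of_le_left hC, hr, fun n => ?_⟩
  cases n with
  | zero => simp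
  | succ n =>
    refine (h n).trans ?_
    gcongr
    · exact le_max_left _ _
    · omega

theorem succ {a : ℕ → E} (h : GeomBounded a) : GeomBounded fun n => a (n + 1) := by
  obtain ⟨C, r, hC, hr, h⟩ := h
  exact ⟨C * r, r, by positivity, hr, fun n => (h (n + 1)).trans_eq (by ring)⟩

theorem mul {a b : ℕ → ℂ} (ha : GeomBounded a) (hb : GeomBounded b) :
    GeomBounded fun n => ∑ p ∈ Finset.HasAntidiagonal.antidiagonal n, a p.1 * b p.2 := by
  obtain ⟨C, r, hC, hr, h⟩ := exists_common₂ ha hb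
  refine ⟨C * C, 2 * r, by positivity, by linarith, fun n => ?_⟩
  have h1 : ∀ p ∈ Finset.HasAntidiagonal.antidiagonal n, ‖a p.1 * b p.2‖ ≤ C * C * r ^ n := by
    intro p hp
    rw [Finset.HasAntidiagonal.mem_antidiagonal] at hp
    rw [norm_mul, ← hp, pow_add]
    calc _ ≤ (C * r ^ p.1) * (C * r ^ p.2) := by
          gcongr
          exacts [(h _).1, (h _).2]
      _ = _ := by ring
  refine (norm_sum_le_of_le _ h1).trans ?_
  rw [Finset.sum_const, Finset.Nat.card_antidiagonal, nsmul_eq_mul, mul_pow]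
  have : ((n + 1 : ℕ) : ℝ) ≤ 2 ^ n := by exact_mod_cast Nat.lt_two_pow_self
  calc _ ≤ (2 : ℝ) ^ n * (C * C * r ^ n) := by gcongr
    _ = _ := by ring

/-- The inverse of a convergent power series with constant term `1` converges. -/
theorem inverse {a b : ℕ → ℂ} (ha : GeomBounded a) (h0 : ‖b 0‖ ≤ 1)
    (h : ∀ n, b (n + 1) = - ∑ k ∈ Finset.range (n + 1), a (k + 1) * b (n - k)) :
    GeomBounded b := by
  obtain ⟨C, r, hC, hr, ha⟩ := ha
  -- This choice gives `C r = R - r`, so the geometric sum in `key` telescopes to `R^n - r^n` and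
  -- the bound `R^n` reproduces itself under the recursion.
  set R := r * (1 + C) with hR
  have hRr : r ≤ R := by rw [hR]; nlinarith
  have hR0 : 0 < R := by linarith
  refine ⟨1, R, zero_le_one, by linarith, fun n => ?_⟩
  rw [one_mul]
  have key : ∀ n : ℕ, ∑ k ∈ Finset.range n, C * r ^ (k + 1) * R ^ (n - 1 - k) ≤ R ^ n := by
    intro n
    have h1 : ∑ k ∈ Finset.range n, C * r ^ (k + 1) * R ^ (n - 1 - k) =
        C * r * ∑ k ∈ Finset.range n, r ^ k * R ^ (n - 1 - k) := by
      rw [Finset.mul_sum]; exact Finset.sum_congr rfl fun k _ => by ring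
    have h2 := (Commute.all r R).geom_sum₂_mul n
    have h3 : (C * r) = R - r := by rw [hR]; ring
    rw [h1, h3]
    have : 0 ≤ r ^ n := by positivity
    nlinarith
  induction n using Nat.strong_induction_on with
  | _ n ih =>
    cases n with
    | zero => simpa using h0
    | succ n =>
      rw [h, norm_neg]
      refine (norm_sum_le _ _).trans (le_trans ?_ (key (n + 1)))
      refine Finset.sum_le_sum fun k hk => ?_
      rw [norm_mul]
      have := ih (n - k) (by omega)
      simp only [Nat.add_sub_cancel]
      gcongr
      exact ha _

end GeomBounded

theorem isConvergent_mono_mul {f : LaurentSeries ℂ} (h : IsConvergent f) (k : ℤ) :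
    IsConvergent (mono k 1 * f) := by
  rw [isConvergent_iff] at h ⊢
  have hc : ∀ k n : ℤ, (mono k 1 * f).coeff n = f.coeff (n - k) := by
    intro k n
    have := HahnSeries.coeff_single_mul_add (r := (1 : ℂ)) (x := f) (a := n - k) (b := k)
    simpa using this
  simp only [hc]
  induction k using Int.induction_on with
  | zero => simpa using h
  | succ k ih =>
    refine GeomBounded.of_succ ?_
    refine cast ?_ ih
    congr 1; ext n; congr 1; push_cast; ring
  | pred k ih =>
    refine cast ?_ ih.succ
    congr 1; ext n; congr 1; push_cast; ring

theorem isConvergent_ofPowerSeries (p : PowerSeries ℂ) :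
    IsConvergent (HahnSeries.ofPowerSeries ℤ ℂ p) ↔ GeomBounded fun n => PowerSeries.coeff n p := by
  rw [isConvergent_iff]
  simp only [HahnSeries.ofPowerSeries_apply_coeff]

theorem IsConvergent.add {f g : LaurentSeries ℂ} (hf : IsConvergent f) (hg : IsConvergent g) :
    IsConvergent (f + g) := by
  rw [isConvergent_iff] at *
  exact hf.add hg

theorem IsConvergent.neg {f : LaurentSeries ℂ} (hf : IsConvergent f) : IsConvergent (-f) := by
  rw [isConvergent_iff] at *
  exact hf.neg

/-- Every series is, up to a power of `x`, a power series. -/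
theorem exists_mono_mul_ofPowerSeries (f : LaurentSeries ℂ) :
    ∃ (k : ℤ) (p : PowerSeries ℂ), f = mono k 1 * HahnSeries.ofPowerSeries ℤ ℂ p ∧
      (f ≠ 0 → PowerSeries.constantCoeff p ≠ 0) := by
  refine ⟨f.order, f.powerSeriesPart, (LaurentSeries.single_order_mul_powerSeriesPart f).symm, ?_⟩
  intro hf
  rw [← PowerSeries.coeff_zero_eq_constantCoeff_apply, LaurentSeries.powerSeriesPart_coeff]
  simpa using HahnSeries.coeff_order_eq_zero.not.mpr hf

theorem IsConvergent.of_mono_mul {f : LaurentSeries ℂ} {k : ℤ} (h : IsConvergent (mono k 1 * f)) :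
    IsConvergent f := by
  have := isConvergent_mono_mul h (-k)
  rwa [← mul_assoc, HahnSeries.single_mul_single, neg_add_cancel, one_mul,
    HahnSeries.single_zero_one, one_mul] at this

theorem IsConvergent.mul {f g : LaurentSeries ℂ} (hf : IsConvergent f) (hg : IsConvergent g) :
    IsConvergent (f * g) := by
  obtain ⟨k, p, rfl, -⟩ := exists_mono_mul_ofPowerSeries f
  obtain ⟨l, q, rfl, -⟩ := exists_mono_mul_ofPowerSeries g
  have hp := (isConvergent_ofPowerSeries p).mp hf.of_mono_mul
  have hq := (isConvergent_ofPowerSeries q).mp hg.of_mono_mul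
  have : IsConvergent (HahnSeries.ofPowerSeries ℤ ℂ (p * q)) := by
    rw [isConvergent_ofPowerSeries]
    simpa only [PowerSeries.coeff_mul] using hp.mul hq
  have := isConvergent_mono_mul (isConvergent_mono_mul this l) k
  rw [map_mul] at this
  convert this using 1
  ring

theorem isConvergent_C (a : ℂ) : IsConvergent (HahnSeries.C a) := by
  rw [isConvergent_iff]
  refine ⟨‖a‖, 1, norm_nonneg _, le_rfl, fun n => ?_⟩
  simp only [HahnSeries.C_apply, HahnSeries.coeff_single]
  split_ifs <;> simp

/-- A power of `x` and the leading coefficient are split off; what remains has constant term `1`,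
where `GeomBounded.inverse` applies. -/
theorem IsConvergent.inv {f : LaurentSeries ℂ} (hf : IsConvergent f) : IsConvergent f⁻¹ := by
  by_cases h0 : f = 0
  · simpa [h0] using isConvergent_C 0
  obtain ⟨k, p, rfl, hp0⟩ := exists_mono_mul_ofPowerSeries f
  have hp0 := hp0 h0
  have hp := (isConvergent_ofPowerSeries p).mp hf.of_mono_mul
  set c := PowerSeries.constantCoeff p with hc
  set q : PowerSeries ℂ := PowerSeries.C c⁻¹ * p with hq
  have hqc : IsConvergent (HahnSeries.ofPowerSeries ℤ ℂ q) := by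
    rw [hq, map_mul, HahnSeries.ofPowerSeries_C]
    exact (isConvergent_C _).mul ((isConvergent_ofPowerSeries p).mpr hp)
  rw [isConvergent_ofPowerSeries] at hqc
  have hq1 : PowerSeries.constantCoeff q = 1 := by
    rw [hq, map_mul, PowerSeries.constantCoeff_C, ← hc, inv_mul_cancel₀ hp0]
  have hqi : q * q⁻¹ = 1 := PowerSeries.mul_inv_cancel q (by rw [hq1]; exact one_ne_zero)
  have h1 : GeomBounded fun n => PowerSeries.coeff n q⁻¹ := by
    refine GeomBounded.inverse hqc ?_ fun n => ?_
    · simp [hq1]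
    · have := congrArg (PowerSeries.coeff (n + 1)) hqi
      rw [PowerSeries.coeff_mul, Finset.Nat.sum_antidiagonal_eq_sum_range_succ_mk,
        Finset.sum_range_succ'] at this
      simp only [PowerSeries.coeff_one, Nat.add_sub_add_right, Nat.sub_zero,
        PowerSeries.coeff_zero_eq_constantCoeff, hq1, one_mul] at this
      rw [if_neg (by omega)] at this
      exact eq_neg_of_add_eq_zero_right this
  rw [← isConvergent_ofPowerSeries] at h1
  have h2 := isConvergent_mono_mul ((isConvergent_C c⁻¹).mul h1) (-k)
  convert h2 using 1
  refine inv_eq_of_mul_eq_one_right ?_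
  have h3 : HahnSeries.ofPowerSeries ℤ ℂ q * HahnSeries.ofPowerSeries ℤ ℂ q⁻¹ = 1 := by
    rw [← map_mul, hqi, map_one]
  have h4 : HahnSeries.ofPowerSeries ℤ ℂ q = HahnSeries.C c⁻¹ * HahnSeries.ofPowerSeries ℤ ℂ p := by
    rw [hq, map_mul, HahnSeries.ofPowerSeries_C]
  have h5 : mono (-k) 1 * mono k 1 = (1 : LaurentSeries ℂ) := by
    rw [HahnSeries.single_mul_single, neg_add_cancel, one_mul, HahnSeries.single_zero_one]
  calc _ = (mono (-k) 1 * mono k 1) * ((HahnSeries.C c⁻¹ * HahnSeries.ofPowerSeries ℤ ℂ p) *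
          HahnSeries.ofPowerSeries ℤ ℂ q⁻¹) := by ring
    _ = 1 := by rw [h5, ← h4, h3, one_mul]

/-- The field of convergent meromorphic series. -/
def convergentField : Subfield (LaurentSeries ℂ) where
  carrier := {f | IsConvergent f}
  mul_mem' := IsConvergent.mul
  one_mem' := by simpa using isConvergent_C 1
  add_mem' := IsConvergent.add
  zero_mem' := by simpa using isConvergent_C 0
  neg_mem' := IsConvergent.neg
  inv_mem' _ := IsConvergent.inv

theorem coeff_ddx (f : LaurentSeries ℂ) (n : ℤ) : (ddx f).coeff n = (n + 1) * f.coeff (n + 1) := by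
  simp [ddx]

theorem IsConvergent.ddx {f : LaurentSeries ℂ} (hf : IsConvergent f) : IsConvergent (ddx f) := by
  rw [isConvergent_iff] at *
  obtain ⟨C, r, hC, hr, h⟩ := hf.succ
  refine ⟨C, 2 * r, hC, by linarith, fun n => ?_⟩
  change ‖(LevelOne.ddx f).coeff (n : ℤ)‖ ≤ _
  rw [coeff_ddx, norm_mul, mul_pow]
  have h1 : ‖((n : ℤ) : ℂ) + 1‖ ≤ 2 ^ n := by
    have h2 : ((n : ℤ) : ℂ) + 1 = ((n + 1 : ℕ) : ℂ) := by push_cast; rfl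
    rw [h2, Complex.norm_natCast]
    exact_mod_cast Nat.lt_two_pow_self
  calc _ ≤ (2 : ℝ) ^ n * (C * r ^ n) := by
        gcongr
        exact_mod_cast h n
    _ = _ := by ring

theorem ddx_mul (f g : LaurentSeries ℂ) : ddx (f * g) = ddx f * g + f * ddx g := by
  -- The operator `x d/dx` multiplies each coefficient by its degree and does not enlarge supports,
  -- so its Leibniz rule is `n = i + j` on each term of the product. The factor `x` is cancelled
  -- afterwards.
  have key : ∀ f g : LaurentSeries ℂ, mono 1 1 * ddx (f * g) =
      (mono 1 1 * ddx f) * g + f * (mono 1 1 * ddx g) := by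
    have hc : ∀ (f : LaurentSeries ℂ) (n : ℤ), (mono 1 1 * ddx f).coeff n = n * f.coeff n := by
      intro f n
      have := HahnSeries.coeff_single_mul_add (r := (1 : ℂ)) (x := ddx f) (a := n - 1) (b := 1)
      rw [sub_add_cancel] at this
      rw [this, coeff_ddx]
      simp
    intro f g
    have hs : ∀ f : LaurentSeries ℂ, (mono 1 1 * ddx f).support ⊆ f.support := by
      intro f n hn h
      rw [HahnSeries.mem_support, hc] at hn
      rw [h, mul_zero] at hn
      exact hn rfl
    ext n
    rw [hc, HahnSeries.coeff_add, HahnSeries.coeff_mul, HahnSeries.coeff_mul_left' f.isPWO_support (hs f),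
      HahnSeries.coeff_mul_right' g.isPWO_support (hs g), Finset.mul_sum,
      ← Finset.sum_add_distrib]
    refine Finset.sum_congr rfl fun p hp => ?_
    rw [hc, hc, ← (Finset.mem_antidiagonal.mp hp).2.2]
    push_cast
    ring
  have h0 : (mono 1 1 : LaurentSeries ℂ) ≠ 0 := by simp
  apply mul_left_cancel₀ h0
  rw [key]
  ring

/-! ## Jordan chains -/

open Polynomial in
/-- Finitely many vectors killed by powers of an endomorphism lie in the span of finitely many
independent Jordan chains. -/
theorem exists_jordan_chains {V : Type*} [AddCommGroup V] [Module ℂ V] (T : Module.End ℂ V)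
    {s : Set V} (hs : s.Finite) (hT : ∀ y ∈ s, ∃ k : ℕ, (T ^ k) y = 0) :
    ∃ (d : ℕ) (n : Fin d → ℕ) (w : (Σ j, Fin (n j)) → V), LinearIndependent ℂ w ∧
      s ⊆ Submodule.span ℂ (Set.range w) ∧
      ∀ j k, T (w ⟨j, k⟩) = ∑ k' : Fin (n j), if (k : ℕ) = (k' : ℕ) + 1 then w ⟨j, k'⟩ else 0 := by
  classical
  -- `ℂ[X]` acts through `T`. The submodule generated by `s` is finitely generated and torsion for
  -- the powers of `X`, so it is a direct sum of cyclic modules `ℂ[X] / (X^n)`.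
  let A := Module.AEval' T
  let o : V ≃ₗ[ℂ] A := Module.AEval'.of T
  let P : Submodule ℂ[X] A := Submodule.span ℂ[X] (o '' s)
  have hX : ∀ (k : ℕ) (v : V), (X ^ k : ℂ[X]) • o v = o ((T ^ k) v) := by
    intro k v
    exact Module.AEval'.X_pow_smul_of T v k
  have : Module.Finite ℂ[X] P := Module.Finite.iff_fg.mpr (Submodule.fg_span (hs.image o))
  have htor : Module.IsTorsion' P (Submonoid.powers (X : ℂ[X])) := by
    have key : ∀ z ∈ P, ∃ k : ℕ, (X ^ k : ℂ[X]) • z = 0 := by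
      intro z hz
      induction hz using Submodule.span_induction with
      | mem z hz =>
        obtain ⟨y, hy, rfl⟩ := hz
        obtain ⟨k, hk⟩ := hT y hy
        exact ⟨k, by rw [hX, hk, map_zero]⟩
      | zero => exact ⟨0, smul_zero _⟩
      | add y z _ _ hy hz =>
        obtain ⟨k, hk⟩ := hy
        obtain ⟨l, hl⟩ := hz
        refine ⟨k + l, ?_⟩
        rw [smul_add, pow_add, mul_smul, mul_smul, hl, smul_zero, add_zero, smul_comm, hk,
          smul_zero]
      | smul a y _ hy =>
        obtain ⟨k, hk⟩ := hy
        exact ⟨k, by rw [smul_comm, hk, smul_zero]⟩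
    rintro ⟨z, hz⟩
    obtain ⟨k, hk⟩ := key z hz
    exact ⟨⟨X ^ k, k, rfl⟩, Subtype.ext hk⟩
  obtain ⟨d, n, ⟨e⟩⟩ := Module.torsion_by_prime_power_decomposition (Polynomial.irreducible_X) htor
  -- The cyclic vector of the `j`-th summand, the image of `1`.
  let g : Fin d → V := fun j =>
    o.symm (e.symm (DirectSum.of (fun j => ℂ[X] ⧸ ℂ[X] ∙ (X ^ n j : ℂ[X])) j
      (Submodule.Quotient.mk 1)) : P)
  have hg : ∀ (p : ℂ[X]) (j), o ((aeval T p) (g j)) =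
      ((e.symm (DirectSum.of (fun j => ℂ[X] ⧸ ℂ[X] ∙ (X ^ n j : ℂ[X])) j
      (Submodule.Quotient.mk p)) : P) : A) := by
    intro p j
    have h1 : o ((aeval T p) (g j)) = p • o (g j) := rfl
    rw [h1]
    simp only [g, LinearEquiv.apply_symm_apply]
    rw [← Submodule.coe_smul, ← map_smul]
    congr 2
    have : (Submodule.Quotient.mk p : ℂ[X] ⧸ ℂ[X] ∙ (X ^ n j : ℂ[X])) =
      p • Submodule.Quotient.mk 1 := by
      rw [← Submodule.Quotient.mk_smul, smul_eq_mul, mul_one]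
    rw [this]
    exact (DirectSum.lof ℂ[X] (Fin d) (fun j => ℂ[X] ⧸ ℂ[X] ∙ (X ^ n j : ℂ[X])) j).map_smul _ _ |>.symm
  have hg0 : ∀ j, (T ^ n j) (g j) = 0 := by
    intro j
    apply o.injective
    have := hg (X ^ n j) j
    rw [map_pow, aeval_X] at this
    rw [this, map_zero]
    have h0 : (Submodule.Quotient.mk (X ^ n j) : ℂ[X] ⧸ ℂ[X] ∙ (X ^ n j : ℂ[X])) = 0 := by
      rw [Submodule.Quotient.mk_eq_zero]
      exact Submodule.mem_span_singleton_self _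
    rw [h0]
    simp
  -- Powers in reverse order: the vector of index `0` is killed by `T`, and `T` lowers the index by
  -- one.
  let w : (Σ j, Fin (n j)) → V := fun q => (T ^ (n q.1 - 1 - q.2)) (g q.1)
  have hTw : ∀ j k, T (w ⟨j, k⟩) =
      ∑ k' : Fin (n j), if (k : ℕ) = (k' : ℕ) + 1 then w ⟨j, k'⟩ else 0 := by
    intro j k
    have h1 : T (w ⟨j, k⟩) = (T ^ (n j - k)) (g j) := by
      have : n j - k = (n j - 1 - k) + 1 := by omega
      rw [this, pow_succ']
      rfl
    rw [h1]
    by_cases hk : (k : ℕ) = 0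
    · rw [hk, Nat.sub_zero, hg0, Finset.sum_eq_zero]
      intro k' _
      rw [if_neg (by omega)]
    · rw [Finset.sum_eq_single ⟨k - 1, by omega⟩]
      · rw [if_pos (by simp; omega)]
        simp only [w]
        congr 2
        omega
      · intro k' _ hk'
        rw [if_neg]
        intro h
        apply hk'
        ext
        simp; omega
      · simp
  refine ⟨d, n, w, ?_, ?_, hTw⟩
  · rw [Fintype.linearIndependent_iff]
    intro c hc
    -- A linear relation is a family of polynomials of degree less than `n j`; in the direct sum
    -- each of them must be divisible by `X ^ n j`, so all coefficients vanish.
    have h1 : ∑ j, (aeval T (∑ k : Fin (n j), monomial (n j - 1 - k) (c ⟨j, k⟩))) (g j) = 0 := by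
      rw [← hc, Fintype.sum_sigma]
      refine Finset.sum_congr rfl fun j _ => ?_
      rw [map_sum, LinearMap.sum_apply]
      refine Finset.sum_congr rfl fun k _ => ?_
      rw [aeval_monomial]
      simp [w, ← Algebra.smul_def]
    have h2 := congrArg o h1
    rw [map_sum, map_zero] at h2
    simp only [hg] at h2
    rw [← Submodule.coe_sum, ← map_sum, ZeroMemClass.coe_eq_zero, map_eq_zero_iff _ e.symm.injective] at h2
    rintro ⟨j, k⟩
    have h3 := congrArg (fun z => z j) h2
    simp only [DirectSum.sum_apply, DirectSum.zero_apply] at h3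
    rw [Finset.sum_eq_single j (by
      intro i _ hij
      exact DirectSum.of_eq_of_ne _ _ _ hij.symm) (by simp), DirectSum.of_eq_same,
      Submodule.Quotient.mk_eq_zero, Submodule.mem_span_singleton] at h3
    obtain ⟨a, ha⟩ := h3
    have h4 : (∑ k : Fin (n j), monomial (n j - 1 - k) (c ⟨j, k⟩)).coeff (n j - 1 - k) = 0 := by
      rw [← ha, smul_eq_mul, coeff_mul_X_pow', if_neg (by omega)]
    rw [finsetSum_coeff, Finset.sum_eq_single k] at h4
    · simpa using h4
    · intro k' _ hk'
      rw [coeff_monomial, if_neg]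
      intro h
      apply hk'
      ext
      omega
    · simp
  · intro y hy
    have hyP : o y ∈ P := Submodule.subset_span ⟨y, hy, rfl⟩
    have hz : ∀ z : DirectSum (Fin d) (fun j => ℂ[X] ⧸ ℂ[X] ∙ (X ^ n j : ℂ[X])),
        o.symm (e.symm z : P) ∈ Submodule.span ℂ (Set.range w) := by
      intro z
      induction z using DirectSum.induction_on with
      | zero => simp
      | add z z' h h' =>
        rw [map_add, Submodule.coe_add, map_add]
        exact add_mem h h'
      | of j z =>
        obtain ⟨p, rfl⟩ := Submodule.Quotient.mk_surjective _ z
        rw [← hg, LinearEquiv.symm_apply_apply]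
        induction p using Polynomial.induction_on' with
        | add p q hp hq => rw [map_add]; exact add_mem hp hq
        | monomial m a =>
          rw [aeval_monomial, ← Algebra.smul_def]
          refine Submodule.smul_mem _ _ ?_
          by_cases hm : m < n j
          · refine Submodule.subset_span ⟨⟨j, ⟨n j - 1 - m, by omega⟩⟩, ?_⟩
            simp only [w]
            congr 2
            omega
          · have : m = (m - n j) + n j := by omega
            rw [this, pow_add, Module.End.mul_apply, hg0, map_zero]
            exact zero_mem _
    have := hz (e ⟨o y, hyP⟩)
    simpa using this

/-! ## Scalar equations -/

theorem coeff_mono_mul (k : ℤ) (a : ℂ) (f : LaurentSeries ℂ) (n : ℤ) :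
    (mono k a * f).coeff n = a * f.coeff (n - k) := by
  have := HahnSeries.coeff_single_mul_add (r := a) (x := f) (a := n - k) (b := k)
  rwa [sub_add_cancel] at this

scoped instance : SMulCommClass ℂ (LaurentSeries ℂ) (LaurentSeries ℂ) :=
  ⟨fun a f g => by simp only [smul_eq_mul, ← HahnSeries.C_mul_eq_smul, mul_left_comm]⟩

/-- The Euler derivation `x d/dx`. -/
def euler : LaurentSeries ℂ →ₗ[ℂ] LaurentSeries ℂ := LinearMap.mulLeft ℂ (mono 1 1) ∘ₗ ddx

theorem euler_apply (f : LaurentSeries ℂ) : euler f = mono 1 1 * ddx f := rfl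

theorem coeff_euler (f : LaurentSeries ℂ) (n : ℤ) : (euler f).coeff n = n * f.coeff n := by
  rw [euler_apply, coeff_mono_mul, coeff_ddx]
  simp

theorem euler_mul (f g : LaurentSeries ℂ) : euler (f * g) = euler f * g + f * euler g := by
  simp only [euler_apply, ddx_mul]
  ring

/-- The series `a / x + l`. -/
def formalExp (a l : ℂ) : LaurentSeries ℂ := mono (-1) a + mono 0 l

theorem coeff_formalExp_mul (a l : ℂ) (f : LaurentSeries ℂ) (n : ℤ) :
    (formalExp a l * f).coeff n = a * f.coeff (n + 1) + l * f.coeff n := by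
  rw [formalExp, add_mul, HahnSeries.coeff_add, coeff_mono_mul, coeff_mono_mul]
  simp

theorem formalExp_sub (a l a' l' : ℂ) :
    formalExp a l - formalExp a' l' = formalExp (a - a') (l - l') := by
  simp only [formalExp, mono, HahnSeries.single_sub]
  ring

theorem formalExp_add (a l a' l' : ℂ) :
    formalExp a l + formalExp a' l' = formalExp (a + a') (l + l') := by
  simp only [formalExp, mono, HahnSeries.single_add]
  ring

/-- The lowest degree decides. If `a ≠ 0`, the coefficient of degree `order - 1` is `a` times the
leading coefficient of `f`; if `a = 0`, that of degree `order` is `order + l` times it. -/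
theorem eq_zero_of_euler_add {a l : ℂ} {f : LaurentSeries ℂ} (h : euler f + formalExp a l * f = 0)
    (hal : a = 0 → ∀ n : ℤ, l ≠ n) : f = 0 := by
  by_contra hf
  have h1 := HahnSeries.coeff_order_eq_zero.not.mpr hf
  by_cases ha : a = 0
  · have := congrArg (fun g => g.coeff f.order) h
    simp only [HahnSeries.coeff_add, coeff_euler, coeff_formalExp_mul, ha, zero_mul, zero_add,
      HahnSeries.coeff_zero, ← add_mul] at this
    rcases mul_eq_zero.mp this with h2 | h2
    · apply hal ha (-f.order)
      push_cast
      exact eq_neg_of_add_eq_zero_right h2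
    · exact h1 h2
  · have := congrArg (fun g => g.coeff (f.order - 1)) h
    have h2 : f.coeff (f.order - 1) = 0 := HahnSeries.coeff_eq_zero_of_lt_order (by omega)
    simp only [HahnSeries.coeff_add, coeff_euler, coeff_formalExp_mul, h2, mul_zero, zero_add,
      sub_add_cancel, HahnSeries.coeff_zero, add_zero] at this
    rcases mul_eq_zero.mp this with h2 | h2
    · exact ha h2
    · exact h1 h2

theorem eq_C_of_euler_eq_C {f : LaurentSeries ℂ} {c : ℂ} (h : euler f = HahnSeries.C c) :
    f = HahnSeries.C (f.coeff 0) := by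
  ext n
  have := congrArg (fun g => g.coeff n) h
  simp only [coeff_euler, HahnSeries.C_apply, HahnSeries.coeff_single] at this ⊢
  split_ifs with hn
  · rw [hn]
  · rw [if_neg hn] at this
    rcases mul_eq_zero.mp this with h | h
    · exact absurd (by exact_mod_cast h) hn
    · exact h

/-! The operations of the module structures, so that the lemmas on modules are found at once. -/

scoped instance : Mul (LaurentSeries ℂ) := (inferInstance : Ring (LaurentSeries ℂ)).toMul

scoped instance {ι : Type*} : SMul (LaurentSeries ℂ) (ι → LaurentSeries ℂ) :=
  (Pi.Function.module ι (LaurentSeries ℂ) (LaurentSeries ℂ)).toSMul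

/-! ## From special vectors to formal fundamental solutions -/

/-- Jordan chains of a differential module over the formal meromorphic series, with exponents that
never differ by a nonzero integer, are independent over the formal meromorphic series as soon as
the chains of the same exponents are independent over `ℂ`. -/
theorem linearIndependent_of_chains {M : Type*} [AddCommGroup M] [Module (LaurentSeries ℂ) M]
    (D : M →+ M) (hD : ∀ (f : LaurentSeries ℂ) (w : M), D (f • w) = euler f • w + f • D w)
    {κ : Type*} [Fintype κ] (n : κ → ℕ) (a l : κ → ℂ) (w : (Σ j, Fin (n j)) → M)
    (hw : ∀ j k, D (w ⟨j, k⟩) + formalExp (a j) (l j) • w ⟨j, k⟩ =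
      - ∑ k' : Fin (n j), if (k : ℕ) = (k' : ℕ) + 1 then w ⟨j, k'⟩ else 0)
    (hcls : ∀ i j, a i = a j → ∀ m : ℤ, l i - l j = m → l i = l j)
    (hind : ∀ (j₀ : κ) (c : (Σ j, Fin (n j)) → ℂ),
      (∀ q, c q ≠ 0 → a q.1 = a j₀ ∧ l q.1 = l j₀) →
      ∑ q, (HahnSeries.C (c q) : LaurentSeries ℂ) • w q = 0 → c = 0) :
    LinearIndependent (LaurentSeries ℂ) w := by
  classical
  let e := Fintype.equivFin κ
  -- The position in the chain dominates. Up to multiples of itself, `D` sends each vector to its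
  -- predecessor in the chain, which comes earlier in this order.
  let ord : (Σ j, Fin (n j)) → ℕ := fun q => q.2 * Fintype.card κ + e q.1
  have ord_inj : ∀ q q', ord q = ord q' → q = q' := by
    rintro ⟨j, k⟩ ⟨j', k'⟩ h
    simp only [ord] at h
    have h1 := (e j).2
    have h2 := (e j').2
    have hk : (k : ℕ) = k' := by
      have := congrArg (· / Fintype.card κ) h
      simp only [mul_comm _ (Fintype.card κ)] at this
      rwa [Nat.mul_add_div (Nat.zero_lt_of_lt h1), Nat.mul_add_div (Nat.zero_lt_of_lt h1),
        Nat.div_eq_of_lt h1, Nat.div_eq_of_lt h2] at this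
    have hj : j = j' := e.injective (Fin.ext (by rw [hk] at h; omega))
    subst hj
    simp only [Sigma.mk.injEq, heq_eq_eq, true_and]
    exact Fin.ext hk
  have ord_lt : ∀ j (k k' : Fin (n j)), (k' : ℕ) = k + 1 → ord ⟨j, k⟩ < ord ⟨j, k'⟩ := by
    intro j k k' h
    simp only [ord, h]
    have := (e j).2
    nlinarith
  -- Induction on the position of the last nonzero coefficient. Once this coefficient is normalised
  -- to `1`, applying `D + E q0.1` gives a relation whose last coefficient comes earlier. That
  -- relation is trivial, and its vanishing coefficients are differential equations for the original
  -- ones.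
  have key : ∀ (B : ℕ) (f : (Σ j, Fin (n j)) → LaurentSeries ℂ), ∑ q, f q • w q = 0 →
      (∀ q, B ≤ ord q → f q = 0) → ∀ q, f q = 0 := by
    intro B
    induction B with
    | zero => exact fun f _ h q => h q (Nat.zero_le _)
    | succ B ih =>
      intro f hf hB
      by_cases hq0 : ∃ q0, ord q0 = B ∧ f q0 ≠ 0
      swap
      · push Not at hq0
        refine ih f hf fun q hq => ?_
        rcases hq.eq_or_lt with h | h
        · exact hq0 q h.symm
        · exact hB q h
      exfalso
      obtain ⟨q0, hq0B, hfq0⟩ := hq0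
      let f' : (Σ j, Fin (n j)) → LaurentSeries ℂ := fun q => (f q0)⁻¹ * f q
      have hf' : ∑ q, f' q • w q = 0 := by
        simp only [f', mul_smul, ← Finset.smul_sum, hf, smul_zero]
      have hf'B : ∀ q, B + 1 ≤ ord q → f' q = 0 := fun q hq => by simp [f', hB q hq]
      have hf'0 : f' q0 = 1 := inv_mul_cancel₀ hfq0
      let E : κ → LaurentSeries ℂ := fun j => formalExp (a j) (l j)
      -- The coefficient of the next vector of the same chain, which `D` carries to position `q`.
      let S : (Σ j, Fin (n j)) → LaurentSeries ℂ := fun q =>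
        ∑ k' : Fin (n q.1), if (k' : ℕ) = (q.2 : ℕ) + 1 then f' ⟨q.1, k'⟩ else 0
      let g : (Σ j, Fin (n j)) → LaurentSeries ℂ := fun q =>
        euler (f' q) + (E q0.1 - E q.1) * f' q - S q
      have hsum : ∑ q, S q • w q = ∑ q : (Σ j, Fin (n j)), f' q •
          ∑ k' : Fin (n q.1), if (q.2 : ℕ) = (k' : ℕ) + 1 then w ⟨q.1, k'⟩ else 0 := by
        rw [Fintype.sum_sigma, Fintype.sum_sigma]
        refine Finset.sum_congr rfl fun j _ => ?_
        simp only [S, Finset.sum_smul, Finset.smul_sum]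
        refine Eq.trans (Finset.sum_comm (s := Finset.univ) (t := Finset.univ)
          (f := fun (k k' : Fin (n j)) => (if (k' : ℕ) = (k : ℕ) + 1 then f' ⟨j, k'⟩ else 0) • w ⟨j, k⟩)) ?_
        refine Finset.sum_congr rfl fun k _ => Finset.sum_congr rfl fun k' _ => ?_
        split_ifs <;> simp
      have hg : ∑ q, g q • w q = 0 := by
        have h1 : D (∑ q, f' q • w q) + E q0.1 • ∑ q, f' q • w q = ∑ q, g q • w q := by
          have h2 : ∀ q : (Σ j, Fin (n j)), D (w q) = - E q.1 • w q -
              ∑ k' : Fin (n q.1), if (q.2 : ℕ) = (k' : ℕ) + 1 then w ⟨q.1, k'⟩ else 0 := by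
            rintro ⟨j, k⟩
            rw [eq_sub_of_add_eq (hw j k), neg_smul, sub_eq_add_neg, sub_eq_add_neg, add_comm]
          have h3 : ∑ q, g q • w q = ∑ q, (euler (f' q) • w q + (E q0.1 - E q.1) • f' q • w q) -
              ∑ q, S q • w q := by
            rw [← Finset.sum_sub_distrib]
            refine Finset.sum_congr rfl fun q _ => ?_
            simp only [g, sub_smul, add_smul, mul_smul]
          rw [h3, hsum, map_sum, Finset.smul_sum, ← Finset.sum_add_distrib, ← Finset.sum_sub_distrib]
          refine Finset.sum_congr rfl fun q _ => ?_
          rw [hD, h2 q, smul_sub, sub_smul, smul_smul, smul_smul, smul_smul, mul_comm (f' q),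
            show -E q.1 * f' q = -(E q.1 * f' q) by ring, neg_smul]
          generalize (f' q • ∑ k' : Fin (n q.1), if (q.2 : ℕ) = (k' : ℕ) + 1 then w ⟨q.1, k'⟩ else 0) = Z
          abel
        rw [← h1, hf']
        simp
      -- At `q0` itself three terms vanish: the derivative of `1`, the difference of exponents, and
      -- `S q0`, which involves a later position.
      have hg0 : ∀ q, g q = 0 := by
        refine ih g hg fun q hq => ?_
        have hS : S q = 0 := by
          refine Finset.sum_eq_zero fun k' _ => ?_
          split_ifs with h
          · exact hf'B _ (Nat.succ_le_of_lt (lt_of_le_of_lt hq (ord_lt q.1 q.2 k' h)))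
          · rfl
        rcases hq.eq_or_lt with h | h
        · have : q = q0 := ord_inj _ _ (by rw [hq0B, h])
          simp only [g, hS]
          rw [this, hf'0]
          have h1 : euler (1 : LaurentSeries ℂ) = 0 := by
            ext m
            rw [coeff_euler, HahnSeries.coeff_one]
            split_ifs with hm <;> simp [hm]
          rw [h1]
          simp
        · simp [g, hS, hf'B q h]
      -- Backwards from the end of each chain: where the exponents are those of `q0` the equation
      -- integrates to a constant, elsewhere it has no nonzero solution. A constant relation inside
      -- a single class remains, to which `hind` applies.
      have hconst : ∀ (m : ℕ) (q : Σ j, Fin (n j)), n q.1 ≤ q.2 + m →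
          f' q = HahnSeries.C ((f' q).coeff 0) ∧
          (¬ (a q.1 = a q0.1 ∧ l q.1 = l q0.1) → f' q = 0) := by
        intro m
        induction m with
        | zero => intro q hq; exact absurd q.2.2 (by omega)
        | succ m ihm =>
          intro q hq
          have h0 := hg0 q
          by_cases hc : a q.1 = a q0.1 ∧ l q.1 = l q0.1
          · refine ⟨?_, fun h => absurd hc h⟩
            have hE : E q0.1 - E q.1 = 0 := by simp only [E, hc.1, hc.2, sub_self]
            have hSC : S q = HahnSeries.C ((S q).coeff 0) := by
              by_cases hk : (q.2 : ℕ) + 1 < n q.1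
              · have : S q = f' ⟨q.1, ⟨q.2 + 1, hk⟩⟩ := by
                  simp only [S]
                  rw [Finset.sum_eq_single ⟨q.2 + 1, hk⟩]
                  · simp
                  · intro k' _ hk'
                    rw [if_neg]
                    intro h
                    exact hk' (Fin.ext h)
                  · simp
                rw [this]
                exact (ihm ⟨q.1, ⟨q.2 + 1, hk⟩⟩ (by simp only; omega)).1
              · have : S q = 0 := Finset.sum_eq_zero fun k' _ => if_neg (by omega)
                rw [this]; simp
            refine eq_C_of_euler_eq_C (c := (S q).coeff 0) ?_
            rw [← hSC]
            simp only [g, hE, zero_mul, add_zero] at h0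
            exact sub_eq_zero.mp h0
          · have hS : S q = 0 := by
              refine Finset.sum_eq_zero fun k' _ => ?_
              split_ifs with h
              · exact (ihm ⟨q.1, k'⟩ (by simp only; omega)).2 hc
              · rfl
            have hz : f' q = 0 := by
              simp only [g, hS, sub_zero, E, formalExp_sub] at h0
              refine eq_zero_of_euler_add h0 fun ha p hp => hc ?_
              have ha' := (sub_eq_zero.mp ha).symm
              exact ⟨ha', (hcls _ _ ha'.symm p hp).symm⟩
            exact ⟨by rw [hz]; simp, fun _ => hz⟩
      have hc := hind q0.1 (fun q => (f' q).coeff 0) ?_ ?_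
      · have := congrFun hc q0
        simp only [hf'0, Pi.zero_apply] at this
        simp at this
      · intro q hq
        by_contra h
        rw [(hconst (n q.1) q (by omega)).2 h] at hq
        exact hq rfl
      · rw [← hf']
        refine Finset.sum_congr rfl fun q _ => ?_
        rw [← (hconst (n q.1) q (by omega)).1]
  rw [Fintype.linearIndependent_iff]
  intro f hf
  obtain ⟨B, hB⟩ := (Set.finite_range ord).bddAbove
  exact key (B + 1) f hf fun q hq => absurd (hB ⟨q, rfl⟩) (by omega)

/-! ### Twisted operators and special vectors -/

variable {ι : Type*} [Fintype ι]

/-- The operator `y ↦ x y' - x A y + α y` on columns. -/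
def twist (A : Matrix ι ι (LaurentSeries ℂ)) (α : LaurentSeries ℂ) :
    Module.End ℂ (ι → LaurentSeries ℂ) where
  toFun y := fun i => euler (y i) - mono 1 1 * (A.mulVec y) i + α * y i
  map_add' y z := by
    ext1 i
    simp only [Pi.add_apply, map_add, Matrix.mulVec_add]
    ring
  map_smul' c y := by
    ext1 i
    have h : c • y = (HahnSeries.C c : LaurentSeries ℂ) • y := by
      ext1 i; simp
    simp only [RingHom.id_apply, Pi.smul_apply, map_smul]
    rw [h, Matrix.mulVec_smul]
    simp only [Pi.smul_apply, smul_eq_mul, ← HahnSeries.C_mul_eq_smul]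
    ring

theorem twist_apply (A : Matrix ι ι (LaurentSeries ℂ)) (α : LaurentSeries ℂ)
    (y : ι → LaurentSeries ℂ) :
    twist A α y = fun i => euler (y i) - mono 1 1 * (A.mulVec y) i + α * y i := rfl

theorem twist_smul (A : Matrix ι ι (LaurentSeries ℂ)) (α f : LaurentSeries ℂ)
    (y : ι → LaurentSeries ℂ) : twist A α (f • y) = euler f • y + f • twist A α y := by
  ext1 i
  simp only [twist_apply, Matrix.mulVec_smul, Pi.smul_apply, Pi.add_apply, smul_eq_mul, euler_mul]
  ring

theorem twist_eq (A : Matrix ι ι (LaurentSeries ℂ)) (α : LaurentSeries ℂ)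
    (y : ι → LaurentSeries ℂ) : twist A α y = twist A 0 y + α • y := by
  ext1 i
  simp only [twist_apply, Pi.smul_apply, Pi.add_apply, smul_eq_mul]
  ring

/-- The columns `y` such that `y x^l exp(-a/x)` is, up to logarithms, the head of a solution of
`Y' = A Y`, for an exponent `l` in `ℤ Λ` and a Stokes value `a` in `ℤ Ω`. -/
def specialVectors (Λ Ω : Finset ℂ) (A : Matrix ι ι (LaurentSeries ℂ)) :
    Set (ι → LaurentSeries ℂ) :=
  {y | ∃ a ∈ Submodule.span ℤ (Ω : Set ℂ), ∃ l ∈ Submodule.span ℤ (Λ : Set ℂ), ∃ k : ℕ,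
    (twist A (formalExp a l) ^ k) y = 0}

/-- The special vectors span all columns. -/
def HasSpecialSpan (Λ Ω : Finset ℂ) (A : Matrix ι ι (LaurentSeries ℂ)) : Prop :=
  Submodule.span (LaurentSeries ℂ) (specialVectors Λ Ω A) = ⊤

/-- Multiplication by `x^(-m)` trades the exponent `l` for `l + m`, so exponents matter only modulo
the integers. -/
theorem twist_formalExp_add_int (A : Matrix ι ι (LaurentSeries ℂ)) (a l : ℂ) (m : ℤ)
    (y : ι → LaurentSeries ℂ) :
    twist A (formalExp a (l + m)) ((mono (-m) 1 : LaurentSeries ℂ) • y) =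
      (mono (-m) 1 : LaurentSeries ℂ) • twist A (formalExp a l) y := by
  rw [twist_smul, twist_eq A (formalExp a (l + m)), twist_eq A (formalExp a l)]
  have h1 : euler (mono (-m) 1) = - mono 0 (m : ℂ) * mono (-m) 1 := by
    ext k
    rw [coeff_euler, show -mono 0 (m : ℂ) * mono (-m) 1 = -(mono 0 (m : ℂ) * mono (-m) 1) by ring,
      HahnSeries.coeff_neg, coeff_mono_mul, HahnSeries.coeff_single,
      HahnSeries.coeff_single]
    by_cases hk : k = -m
    · simp [hk]
    · simp [hk]
  have h2 : formalExp a (l + m) = formalExp a l + mono 0 (m : ℂ) := by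
    simp only [formalExp, mono, HahnSeries.single_add, add_assoc]
  rw [h1, h2]
  ext1 i
  simp only [Pi.add_apply, Pi.smul_apply, smul_eq_mul]
  ring

theorem twist_pow_formalExp_add_int (A : Matrix ι ι (LaurentSeries ℂ)) (a l : ℂ) (m : ℤ)
    (y : ι → LaurentSeries ℂ) (k : ℕ) :
    (twist A (formalExp a (l + m)) ^ k) ((mono (-m) 1 : LaurentSeries ℂ) • y) =
      (mono (-m) 1 : LaurentSeries ℂ) • (twist A (formalExp a l) ^ k) y := by
  induction k with
  | zero => rfl
  | succ k ih => rw [pow_succ', Module.End.mul_apply, ih, twist_formalExp_add_int, pow_succ',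
      Module.End.mul_apply]

/-- Representatives modulo the integers. -/
theorem exists_representatives (G : Submodule ℤ ℂ) :
    ∃ rep : ℂ → ℂ, (∀ l ∈ G, rep l ∈ G ∧ ∃ m : ℤ, rep l = l + m) ∧
      ∀ l ∈ G, ∀ l' ∈ G, ∀ m : ℤ, rep l - rep l' = m → rep l = rep l' := by
  classical
  -- The relation is taken on `G` itself, so representatives stay in `G` even if `G` does not
  -- contain the integers.
  let s : Setoid G :=
    { r := fun l l' => ∃ m : ℤ, (l : ℂ) = l' + m
      iseqv := ⟨fun l => ⟨0, by simp⟩, fun {l l'} ⟨m, h⟩ => ⟨-m, by rw [h]; push_cast; ring⟩,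
        fun {l l' l''} ⟨m, h⟩ ⟨m', h'⟩ => ⟨m' + m, by rw [h, h']; push_cast; ring⟩⟩ }
  let rep : ℂ → ℂ := fun l => if h : l ∈ G then ((Quotient.mk s ⟨l, h⟩).out : G) else 0
  have hrep : ∀ l (h : l ∈ G), rep l = ((Quotient.mk s ⟨l, h⟩).out : G) := fun l h => dif_pos h
  have h1 : ∀ l (h : l ∈ G), ∃ m : ℤ, rep l = l + m := by
    intro l h
    rw [hrep l h]
    exact Quotient.exact (Quotient.out_eq (Quotient.mk s ⟨l, h⟩))
  refine ⟨rep, fun l h => ⟨by rw [hrep l h]; exact Subtype.coe_prop _, h1 l h⟩, ?_⟩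
  intro l h l' h' m hm
  rw [hrep l h, hrep l' h']
  congr 2
  refine Quotient.sound ?_
  obtain ⟨p, hp⟩ := h1 l h
  obtain ⟨p', hp'⟩ := h1 l' h'
  refine ⟨m - p + p', ?_⟩
  change l = l' + _
  rw [hp, hp'] at hm
  push_cast
  rw [← hm]
  ring

theorem neg_pow_apply_eq_zero {V : Type*} [AddCommGroup V] [Module ℂ V] (T : Module.End ℂ V)
    {k : ℕ} {y : V} (h : (T ^ k) y = 0) : ((-T) ^ k) y = 0 := by
  rw [neg_pow, Module.End.mul_apply, h, map_zero]

/-- The operator `y ↦ x y' - x A y` as an additive map. -/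
def twistHom (A : Matrix ι ι (LaurentSeries ℂ)) :
    (ι → LaurentSeries ℂ) →+ (ι → LaurentSeries ℂ) where
  toFun y := twist A 0 y
  map_zero' := map_zero _
  map_add' := map_add _

theorem twistHom_smul (A : Matrix ι ι (LaurentSeries ℂ)) (f : LaurentSeries ℂ)
    (y : ι → LaurentSeries ℂ) : twistHom A (f • y) = euler f • y + f • twistHom A y :=
  twist_smul A 0 f y

theorem twistHom_add_smul (A : Matrix ι ι (LaurentSeries ℂ)) (α : LaurentSeries ℂ)
    (y : ι → LaurentSeries ℂ) : twistHom A y + α • y = twist A α y :=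
  (twist_eq A α y).symm

/-- Blocks can be numbered, leaving out the empty ones. -/
theorem exists_positive_blocks {κ : Type*} [Fintype κ] (n : κ → ℕ) :
    ∃ (J : ℕ) (q : Fin J → κ), (∀ j, 0 < n (q j)) ∧
      Function.Bijective fun p : (Σ j, Fin (n (q j))) => (⟨q p.1, p.2⟩ : Σ j, Fin (n j)) := by
  classical
  let κ' := {j : κ // 0 < n j}
  let e := Fintype.equivFin κ'
  refine ⟨Fintype.card κ', fun j => (e.symm j).1, fun j => (e.symm j).2, ?_, ?_⟩
  · rintro ⟨j, k⟩ ⟨j', k'⟩ h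
    have hj : j = j' := e.symm.injective (Subtype.ext (congrArg Sigma.fst h))
    subst hj
    simpa using h
  · rintro ⟨j, k⟩
    obtain ⟨i, hi⟩ := e.symm.surjective ⟨j, Nat.zero_lt_of_lt k.2⟩
    have hi' : (e.symm i).1 = j := congrArg Subtype.val hi
    subst hi'
    exact ⟨⟨i, k⟩, rfl⟩

/-- Special vectors can be organised in a basis of Jordan chains. -/
theorem HasSpecialSpan.exists_chains {Λ Ω : Finset ℂ} {A : Matrix ι ι (LaurentSeries ℂ)}
    (h : HasSpecialSpan Λ Ω A) :
    ∃ (J : ℕ) (n : Fin J → ℕ) (l a : Fin J → ℂ) (w : (Σ j, Fin (n j)) → ι → LaurentSeries ℂ),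
      (∀ j, 0 < n j) ∧ (∀ j, l j ∈ Submodule.span ℤ (Λ : Set ℂ)) ∧
      (∀ j, a j ∈ Submodule.span ℤ (Ω : Set ℂ)) ∧
      LinearIndependent (LaurentSeries ℂ) w ∧
      Submodule.span (LaurentSeries ℂ) (Set.range w) = ⊤ ∧
      ∀ j k, twist A (formalExp (a j) (l j)) (w ⟨j, k⟩) =
        - ∑ k' : Fin (n j), if (k : ℕ) = (k' : ℕ) + 1 then w ⟨j, k'⟩ else 0 := by
  classical
  obtain ⟨b, hbs, hbspan, hbli⟩ := exists_linearIndependent (LaurentSeries ℂ) (specialVectors Λ Ω A)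
  rw [h] at hbspan
  have : Finite b := hbli.finite
  have : Fintype b := Fintype.ofFinite b
  have hbs' : ∀ y : b, ∃ a ∈ Submodule.span ℤ (Ω : Set ℂ), ∃ l ∈ Submodule.span ℤ (Λ : Set ℂ),
    ∃ k : ℕ, (twist A (formalExp a l) ^ k) y.1 = 0 := fun y => hbs y.2
  choose av hav lv hlv kv hkv using hbs'
  obtain ⟨rep, hrep, hrep'⟩ := exists_representatives (Submodule.span ℤ (Λ : Set ℂ))
  have hrep1 : ∀ y, ∃ m : ℤ, rep (lv y) = lv y + m := fun y => (hrep _ (hlv y)).2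
  choose mv hmv using hrep1
  -- Basis vectors with equal Stokes values and exponents congruent modulo `ℤ` form one class. After
  -- the shifts in `y'` they are all killed by powers of one operator.
  let cls : b → ℂ × ℂ := fun y => (av y, rep (lv y))
  let y' : b → ι → LaurentSeries ℂ := fun y =>
    (mono (-(mv y)) 1 : LaurentSeries ℂ) • (y : ι → LaurentSeries ℂ)
  have : Fintype (Set.range cls) := Fintype.ofFinite _
  -- The sign is that of the term `- F A₀` in the equation of a fundamental solution: on its columns
  -- `twist` lowers the index with a minus sign.
  have hchain : ∀ c : Set.range cls, ∃ (d : ℕ) (n : Fin d → ℕ)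
      (w : (Σ j, Fin (n j)) → ι → LaurentSeries ℂ),
      LinearIndependent ℂ w ∧ y' '' {y | cls y = c} ⊆ Submodule.span ℂ (Set.range w) ∧
      ∀ j k, (- twist A (formalExp c.1.1 c.1.2)) (w ⟨j, k⟩) =
        ∑ k' : Fin (n j), if (k : ℕ) = (k' : ℕ) + 1 then w ⟨j, k'⟩ else 0 := by
    intro c
    refine exists_jordan_chains _ (Set.toFinite _) ?_
    rintro _ ⟨y, hy, rfl⟩
    refine ⟨kv y, ?_⟩
    refine neg_pow_apply_eq_zero _ ?_
    have hy' : c.1 = (av y, lv y + mv y) := by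
      rw [← hmv y]
      exact hy.symm
    rw [hy', twist_pow_formalExp_add_int, hkv y, smul_zero]
  choose d n w hwli hws hwT using hchain
  let nn : (Σ c, Fin (d c)) → ℕ := fun q => n q.1 q.2
  let W : (Σ q, Fin (nn q)) → ι → LaurentSeries ℂ := fun p => w p.1.1 ⟨p.1.2, p.2⟩
  have hmem : ∀ c : Set.range cls, c.1.1 ∈ Submodule.span ℤ (Ω : Set ℂ) ∧
      ∃ l ∈ Submodule.span ℤ (Λ : Set ℂ), c.1.2 = rep l := by
    rintro ⟨_, y, rfl⟩
    exact ⟨hav y, _, hlv y, rfl⟩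
  have hW : ∀ j k, twist A (formalExp j.1.1.1 j.1.1.2) (W ⟨j, k⟩) =
        - ∑ k' : Fin (nn j), if (k : ℕ) = (k' : ℕ) + 1 then W ⟨j, k'⟩ else 0 := by
    intro j k
    have := hwT j.1 j.2 k
    rw [LinearMap.neg_apply, neg_eq_iff_eq_neg] at this
    exact this
  have hli : LinearIndependent (LaurentSeries ℂ) W := by
    refine linearIndependent_of_chains (twistHom A) (twistHom_smul A) nn (fun j => j.1.1.1) (fun j => j.1.1.2) W ?_ ?_ ?_
    · intro j k
      rw [← hW j k]
      exact twistHom_add_smul _ _ _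
    · intro i j _ m hm
      obtain ⟨l, hl, h⟩ := (hmem i.1).2
      obtain ⟨l', hl', h'⟩ := (hmem j.1).2
      change i.1.1.2 - j.1.1.2 = m at hm
      rw [h, h'] at hm ⊢
      exact hrep' l hl l' hl' m hm
    · intro j₀ c hc hsum
      -- A constant relation supported on one pair of exponents involves the chains of a single
      -- class, which are independent over `ℂ` by construction.
      have hc' : ∀ q, c q ≠ 0 → q.1.1 = j₀.1 := fun q hq =>
        Subtype.ext (Prod.ext (hc q hq).1 (hc q hq).2)
      have h1 : ∀ p : (Σ j, Fin (n j₀.1 j)), c ⟨⟨j₀.1, p.1⟩, p.2⟩ = 0 := by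
        refine Fintype.linearIndependent_iff.mp (hwli j₀.1) (fun p => c ⟨⟨j₀.1, p.1⟩, p.2⟩) ?_
        rw [Fintype.sum_sigma, Fintype.sum_sigma, Finset.sum_eq_single j₀.1] at hsum
        · rw [Fintype.sum_sigma, ← hsum]
          refine Finset.sum_congr rfl fun j _ => Finset.sum_congr rfl fun k _ => ?_
          ext1 i
          simp only [Pi.smul_apply, smul_eq_mul, HahnSeries.C_mul_eq_smul]
          rfl
        · intro C _ hC
          refine Finset.sum_eq_zero fun j _ => Finset.sum_eq_zero fun k _ => ?_
          have : c ⟨⟨C, j⟩, k⟩ = 0 := by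
            by_contra h
            exact hC (hc' _ h)
          rw [this, map_zero, zero_smul]
        · simp
      ext ⟨⟨C, j⟩, k⟩
      by_contra h
      have hC : C = j₀.1 := hc' _ h
      subst hC
      exact h (h1 ⟨j, k⟩)
  have hsp : Submodule.span (LaurentSeries ℂ) (Set.range W) = ⊤ := by
    rw [eq_top_iff, ← hbspan, Submodule.span_le]
    intro y hy
    have h1 : y' ⟨y, hy⟩ ∈ Submodule.span ℂ (Set.range (w ⟨cls ⟨y, hy⟩, ⟨y, hy⟩, rfl⟩)) :=
      hws _ ⟨⟨y, hy⟩, rfl, rfl⟩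
    have h2 : y' ⟨y, hy⟩ ∈ Submodule.span (LaurentSeries ℂ) (Set.range W) := by
      refine Submodule.span_induction (p := fun z _ => z ∈ Submodule.span (LaurentSeries ℂ)
        (Set.range W)) ?_ (zero_mem _) (fun _ _ _ _ => add_mem) ?_ h1
      · rintro _ ⟨p, rfl⟩
        exact Submodule.subset_span ⟨⟨⟨_, p.1⟩, p.2⟩, rfl⟩
      · intro a z _ hz
        have : a • z = (HahnSeries.C a : LaurentSeries ℂ) • z := by
          ext1 i; simp
        rw [this]
        exact Submodule.smul_mem _ _ hz
    have h3 := Submodule.smul_mem _ (mono (mv ⟨y, hy⟩) 1 : LaurentSeries ℂ) h2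
    simp only [y', smul_smul, HahnSeries.single_mul_single, add_neg_cancel, one_mul] at h3
    rwa [HahnSeries.single_zero_one, one_smul] at h3
  obtain ⟨J, q, hq, hbij⟩ := exists_positive_blocks nn
  refine ⟨J, fun j => nn (q j), fun j => (q j).1.1.2, fun j => (q j).1.1.1,
    W ∘ fun p : (Σ j, Fin (nn (q j))) => (⟨q p.1, p.2⟩ : Σ i, Fin (nn i)), hq, fun j => ?_, fun j => (hmem _).1, hli.comp _ hbij.1, ?_,
    fun j k => hW (q j) k⟩
  · obtain ⟨l, hl, h⟩ := (hmem (q j).1).2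
    change (q j).1.1.2 ∈ _
    rw [h]
    exact (hrep l hl).1
  · rw [Set.range_comp, hbij.2.range_eq, Set.image_univ, hsp]

/-- A companion system whose columns are spanned by special vectors has a formal fundamental
solution. -/
theorem HasSpecialSpan.hasFormalFundamentalSolution {Λ Ω : Finset ℂ} {N : ℕ}
    {c : Fin N → LaurentSeries ℂ} (h : HasSpecialSpan Λ Ω (companion c)) :
    ∃ (J : ℕ) (n : Fin J → ℕ) (lam a : Fin J → ℂ), (∀ j, 0 < n j) ∧
      HasFormalFundamentalSolution c n lam a ∧
      (∀ j, lam j ∈ Submodule.span ℤ (Λ : Set ℂ)) ∧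
      (∀ j, a j ∈ Submodule.span ℤ (Ω : Set ℂ)) := by
  classical
  obtain ⟨J, n, l, a, w, hn, hl, ha, hli, hsp, hw⟩ := h.exists_chains
  refine ⟨J, n, l, a, hn, ?_, hl, ha⟩
  let b := Module.Basis.mk hli hsp.ge
  have hb : ∀ p, b p = w p := fun p => Module.Basis.mk_apply hli hsp.ge p
  -- The chains form a basis; they are the columns of `F`, and the coordinates in this basis give
  -- its inverse.
  refine ⟨Matrix.of fun i p => w p i, Matrix.of fun p i => b.repr (Pi.single i 1) p, ?_, ?_, ?_⟩
  · ext1 i i'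
    have := congrFun (b.sum_repr (Pi.single i' 1)) i
    rw [Matrix.mul_apply, Matrix.one_apply]
    simp only [hb, Finset.sum_apply, Pi.smul_apply, smul_eq_mul, Pi.single_apply] at this
    rw [← this]
    refine Finset.sum_congr rfl fun p _ => ?_
    simp [mul_comm]
  · ext1 p q
    have h1 : ∑ i, w q i • (Pi.single i 1 : Fin N → LaurentSeries ℂ) = b q := by
      rw [hb]
      ext1 i
      simp [Finset.sum_apply, Pi.single_apply]
    have h2 := congrArg (fun z => b.repr z p) h1
    simp only [map_sum, map_smul, Module.Basis.repr_self, Finsupp.coe_finsetSum, Finset.sum_apply,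
      Finsupp.smul_apply, smul_eq_mul] at h2
    rw [Matrix.mul_apply, Matrix.one_apply]
    simp only [Matrix.of_apply, mul_comm]
    rw [h2, Finsupp.single_apply]
    simp only [eq_comm]
  · ext1 i ⟨j, k⟩
    have h1 := congrFun (hw j k) i
    simp only [twist_apply, Pi.neg_apply, Finset.sum_apply] at h1
    have hx : (mono 2 1 : LaurentSeries ℂ) = mono 1 1 * mono 1 1 := by
      rw [HahnSeries.single_mul_single]; norm_num
    have h2 : (Matrix.of (fun i p => w p i) * normalForm n l a : Matrix (Fin N) _ _) i ⟨j, k⟩ =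
        mono 1 1 * (formalExp (a j) (l j) * w ⟨j, k⟩ i +
          ∑ k' : Fin (n j), (if (k : ℕ) = (k' : ℕ) + 1 then w ⟨j, k'⟩ else 0) i) := by
      rw [Matrix.mul_apply, Fintype.sum_sigma, Finset.sum_eq_single j]
      · simp only [normalForm, Matrix.blockDiagonal'_apply_eq, Matrix.of_apply, Matrix.add_apply,
          Matrix.smul_apply, nilJordan, smul_eq_mul, Matrix.one_apply]
        have h3 : mono 1 1 * formalExp (a j) (l j) = mono 0 (a j) + mono 1 1 * mono 0 (l j) := by
          rw [formalExp, mul_add, HahnSeries.single_mul_single, one_mul]; norm_num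
        rw [mul_add, ← mul_assoc, h3, Finset.mul_sum]
        have h4 : (mono 0 (a j) + mono 1 1 * mono 0 (l j)) * w ⟨j, k⟩ i =
            ∑ k', w ⟨j, k'⟩ i * (mono 0 (a j) * (if k' = k then 1 else 0) +
              mono 1 1 * (mono 0 (l j) * (if k' = k then 1 else 0))) := by
          rw [Finset.sum_eq_single k]
          · simp only [if_true]; ring
          · intro k' _ hk'
            simp [hk']
          · simp
        rw [h4, ← Finset.sum_add_distrib]
        refine Finset.sum_congr rfl fun k' _ => ?_
        split_ifs <;> (try simp only [Pi.zero_apply]) <;> ring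
      · intro j' _ hj'
        refine Finset.sum_eq_zero fun k' _ => ?_
        rw [normalForm, Matrix.blockDiagonal'_apply_ne _ _ _ hj', mul_zero]
      · simp
    rw [Matrix.sub_apply, h2]
    simp only [Matrix.smul_apply, Matrix.map_apply, Matrix.of_apply, smul_eq_mul]
    have h5 : (companion c * Matrix.of fun i p => w p i) i ⟨j, k⟩ =
        (companion c).mulVec (w ⟨j, k⟩) i := rfl
    rw [h5, hx, mul_assoc, mul_assoc, ← mul_sub]
    congr 1
    rw [← euler_apply]
    linear_combination h1

/-! ## Linear combinations of solutions of convergent systems -/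

/-- `f` is a convergent linear combination of the entries of a formal meromorphic solution of a
convergent system whose columns are spanned by special vectors. -/
def IsSystemSolution (Λ Ω : Finset ℂ) (f : LaurentSeries ℂ) : Prop :=
  ∃ (ι : Type) (_ : Fintype ι) (A : Matrix ι ι (LaurentSeries ℂ)) (h r : ι → LaurentSeries ℂ),
    (∀ i j, IsConvergent (A i j)) ∧ (∀ i, IsConvergent (r i)) ∧
    (∀ i, ddx (h i) = A.mulVec h i) ∧ HasSpecialSpan Λ Ω A ∧ f = ∑ i, r i * h i

theorem IsConvergent.zero : IsConvergent 0 := zero_mem convergentField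

theorem IsConvergent.one : IsConvergent 1 := one_mem convergentField

theorem IsConvergent.sum {κ : Type*} (s : Finset κ) {f : κ → LaurentSeries ℂ}
    (h : ∀ i ∈ s, IsConvergent (f i)) : IsConvergent (∑ i ∈ s, f i) :=
  sum_mem (S := convergentField) h

theorem ddx_one : ddx (1 : LaurentSeries ℂ) = 0 := by
  ext n
  rw [coeff_ddx, HahnSeries.coeff_one, HahnSeries.coeff_zero]
  split_ifs with h
  · rw [← Int.cast_one (R := ℂ), ← Int.cast_add, h]; simp
  · simp

/-- A formal fundamental solution gives special vectors. -/
theorem HasFormalFundamentalSolution.hasSpecialSpan {Λ Ω : Finset ℂ} {N : ℕ}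
    {c : Fin N → LaurentSeries ℂ} {J : ℕ} {n : Fin J → ℕ} {l a : Fin J → ℂ}
    (h : HasFormalFundamentalSolution c n l a)
    (hl : ∀ j, l j ∈ Submodule.span ℤ (Λ : Set ℂ)) (ha : ∀ j, a j ∈ Submodule.span ℤ (Ω : Set ℂ)) :
    HasSpecialSpan Λ Ω (companion c) := by
  obtain ⟨F, G, hFG, -, hF⟩ := h
  let w : (Σ j, Fin (n j)) → Fin N → LaurentSeries ℂ := fun p i => F i p
  have hw : ∀ j k, twist (companion c) (formalExp (a j) (l j)) (w ⟨j, k⟩) =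
      - ∑ k' : Fin (n j), if (k : ℕ) = (k' : ℕ) + 1 then w ⟨j, k'⟩ else 0 := by
    intro j k
    ext1 i
    have h1 := congrFun (congrFun hF i) ⟨j, k⟩
    have h2 : (F * normalForm n l a) i ⟨j, k⟩ =
        mono 1 1 * (formalExp (a j) (l j) * F i ⟨j, k⟩ +
          ∑ k' : Fin (n j), (if (k : ℕ) = (k' : ℕ) + 1 then w ⟨j, k'⟩ else 0) i) := by
      rw [Matrix.mul_apply, Fintype.sum_sigma, Finset.sum_eq_single j]
      · simp only [normalForm, Matrix.blockDiagonal'_apply_eq, Matrix.of_apply, Matrix.add_apply,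
          Matrix.smul_apply, nilJordan, smul_eq_mul, Matrix.one_apply]
        have h3 : mono 1 1 * formalExp (a j) (l j) = mono 0 (a j) + mono 1 1 * mono 0 (l j) := by
          rw [formalExp, mul_add, HahnSeries.single_mul_single, one_mul]; norm_num
        rw [mul_add, ← mul_assoc, h3, Finset.mul_sum]
        have h4 : (mono 0 (a j) + mono 1 1 * mono 0 (l j)) * F i ⟨j, k⟩ =
            ∑ k', F i ⟨j, k'⟩ * (mono 0 (a j) * (if k' = k then 1 else 0) +
              mono 1 1 * (mono 0 (l j) * (if k' = k then 1 else 0))) := by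
          rw [Finset.sum_eq_single k]
          · simp only [if_true]; ring
          · intro k' _ hk'
            simp [hk']
          · simp
        rw [h4, ← Finset.sum_add_distrib]
        refine Finset.sum_congr rfl fun k' _ => ?_
        split_ifs <;> (try simp only [Pi.zero_apply, w]) <;> ring
      · intro j' _ hj'
        refine Finset.sum_eq_zero fun k' _ => ?_
        rw [normalForm, Matrix.blockDiagonal'_apply_ne _ _ _ hj', mul_zero]
      · simp
    have hx : (mono 2 1 : LaurentSeries ℂ) = mono 1 1 * mono 1 1 := by
      rw [HahnSeries.single_mul_single]; norm_num
    have hx0 : (mono 1 1 : LaurentSeries ℂ) ≠ 0 := by simp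
    rw [Matrix.sub_apply, h2] at h1
    simp only [Matrix.smul_apply, Matrix.map_apply, smul_eq_mul] at h1
    have h5 : (companion c * F) i ⟨j, k⟩ = (companion c).mulVec (w ⟨j, k⟩) i := rfl
    rw [h5, hx] at h1
    simp only [twist_apply, Pi.neg_apply, Finset.sum_apply, euler_apply]
    apply mul_left_cancel₀ hx0
    change mono 1 1 * (mono 1 1 * ddx (F i ⟨j, k⟩) - _ + _ * F i ⟨j, k⟩) = _
    linear_combination h1
  -- Each application goes one step down the chain, so the column of index `k` is killed by the
  -- power `k + 1`.
  have hpow : ∀ j (m : ℕ) (k : Fin (n j)), (k : ℕ) < m →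
      (twist (companion c) (formalExp (a j) (l j)) ^ m) (w ⟨j, k⟩) = 0 := by
    intro j m
    induction m with
    | zero => intro k hk; omega
    | succ m ih =>
      intro k hk
      rw [pow_succ, Module.End.mul_apply, hw, map_neg, map_sum, Finset.sum_eq_zero, neg_zero]
      intro k' _
      split_ifs with hkk
      · exact ih k' (by omega)
      · exact map_zero _
  rw [HasSpecialSpan, eq_top_iff]
  intro v _
  have hv : v = ∑ p, G.mulVec v p • w p := by
    have : v = F.mulVec (G.mulVec v) := by rw [Matrix.mulVec_mulVec, hFG, Matrix.one_mulVec]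
    conv_lhs => rw [this]
    ext1 i
    simp only [Finset.sum_apply, Pi.smul_apply, smul_eq_mul, w]
    exact Finset.sum_congr rfl fun p _ => mul_comm _ _
  rw [hv]
  refine Submodule.sum_mem _ fun p _ => Submodule.smul_mem _ _ (Submodule.subset_span ?_)
  exact ⟨a p.1, ha _, l p.1, hl _, p.2 + 1, hpow p.1 _ p.2 (Nat.lt_succ_self _)⟩

/-- A solution of `D y = 0` is an entry of a solution of the companion system. -/
theorem exists_companion_solution {N : ℕ} {c : Fin N → LaurentSeries ℂ}
    (hc : ∀ i, IsConvergent (c i)) {f : LaurentSeries ℂ} (hD : diffOp c f = 0) :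
    (∀ i j, IsConvergent (companion c i j)) ∧ ∃ y r : Fin N → LaurentSeries ℂ,
      (∀ i, IsConvergent (r i)) ∧ (∀ i, ddx (y i) = (companion c).mulVec y i) ∧
      f = ∑ i, r i * y i := by
  refine ⟨?_, fun i => ddx^[i] f, fun i => if (i : ℕ) = 0 then 1 else 0, ?_, ?_, ?_⟩
  · intro i j
    simp only [companion, Matrix.of_apply]
    split_ifs
    exacts [IsConvergent.one, (hc j).neg, IsConvergent.zero]
  · intro i
    dsimp only
    split_ifs
    exacts [IsConvergent.one, IsConvergent.zero]
  · intro i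
    rw [← Function.iterate_succ_apply' ddx]
    simp only [Matrix.mulVec, dotProduct, companion, Matrix.of_apply]
    by_cases hi : (i : ℕ) + 1 < N
    · rw [Finset.sum_eq_single ⟨i + 1, hi⟩]
      · simp
      · intro j _ hj
        rw [if_neg (fun h => hj (Fin.ext h)), if_neg (by omega), zero_mul]
      · simp
    · have hN : (i : ℕ) + 1 = N := by omega
      rw [Nat.succ_eq_add_one, hN]
      have h1 : ddx^[N] f = - ∑ j : Fin N, c j * ddx^[(j : ℕ)] f := eq_neg_of_add_eq_zero_left hD
      rw [h1, ← Finset.sum_neg_distrib]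
      refine Finset.sum_congr rfl fun j _ => ?_
      rw [if_neg (by omega), if_pos rfl]
      ring
  -- For `N = 0` there is no first entry, but the equation itself says `f = 0`.
  · rcases Nat.eq_zero_or_pos N with rfl | hN
    · simpa [diffOp] using hD
    · rw [Finset.sum_eq_single ⟨0, hN⟩]
      · simp
      · intro j _ hj
        dsimp only
        rw [if_neg (fun h => hj (Fin.ext h)), zero_mul]
      · simp

theorem isSystemSolution_of_mem_solutionSet {Λ Ω : Finset ℂ} {f : LaurentSeries ℂ}
    (hf : f ∈ solutionSet Λ Ω) : IsSystemSolution Λ Ω f := by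
  obtain ⟨N, c, J, n, l, a, hc, -, hF, hl, ha, hD⟩ := hf
  obtain ⟨hC, y, r, hr, hy, hf⟩ := exists_companion_solution hc hD
  exact ⟨Fin N, inferInstance, companion c, y, r, hC, hr, hy, hF.hasSpecialSpan hl ha, hf⟩

/-- Constants come from the rank one system `y' = 0`, whose exponent and Stokes value are `0`. -/
theorem isSystemSolution_C (Λ Ω : Finset ℂ) (a : ℂ) : IsSystemSolution Λ Ω (HahnSeries.C a) := by
  refine ⟨Unit, inferInstance, 0, fun _ => 1, fun _ => HahnSeries.C a, fun _ _ => IsConvergent.zero,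
    fun _ => isConvergent_C a, fun i => ?_, ?_, by simp⟩
  · rw [ddx_one, Matrix.zero_mulVec]; rfl
  · rw [HasSpecialSpan, eq_top_iff]
    intro v _
    have hv : v = v () • (fun _ => 1) := by ext1 i; simp
    rw [hv]
    refine Submodule.smul_mem _ _ (Submodule.subset_span ⟨0, zero_mem _, 0, zero_mem _, 1, ?_⟩)
    ext1 i
    rw [pow_one, twist_apply, Matrix.zero_mulVec, euler_apply, ddx_one]
    simp [formalExp]

/-! ### Direct sums and tensor products of systems -/

section
variable {ι κ : Type*} [Fintype ι] [Fintype κ]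

theorem twist_fromBlocks (A : Matrix ι ι (LaurentSeries ℂ)) (B : Matrix κ κ (LaurentSeries ℂ))
    (α : LaurentSeries ℂ) (y : ι → LaurentSeries ℂ) (z : κ → LaurentSeries ℂ) :
    twist (Matrix.fromBlocks A 0 0 B) α (Sum.elim y z) = Sum.elim (twist A α y) (twist B α z) := by
  ext1 i
  rw [twist_apply, Matrix.fromBlocks_mulVec]
  rcases i with i | i <;> simp [twist_apply, Function.comp_def]

theorem twist_pow_fromBlocks (A : Matrix ι ι (LaurentSeries ℂ)) (B : Matrix κ κ (LaurentSeries ℂ))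
    (α : LaurentSeries ℂ) (y : ι → LaurentSeries ℂ) (z : κ → LaurentSeries ℂ) (m : ℕ) :
    (twist (Matrix.fromBlocks A 0 0 B) α ^ m) (Sum.elim y z) =
      Sum.elim ((twist A α ^ m) y) ((twist B α ^ m) z) := by
  induction m with
  | zero => rfl
  | succ m ih => simp only [pow_succ', Module.End.mul_apply, ih, twist_fromBlocks]

theorem HasSpecialSpan.fromBlocks {Λ Ω : Finset ℂ} {A : Matrix ι ι (LaurentSeries ℂ)}
    {B : Matrix κ κ (LaurentSeries ℂ)} (hA : HasSpecialSpan Λ Ω A) (hB : HasSpecialSpan Λ Ω B) :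
    HasSpecialSpan Λ Ω (Matrix.fromBlocks A 0 0 B) := by
  rw [HasSpecialSpan, eq_top_iff]
  intro v _
  have h1 : ∀ y ∈ Submodule.span (LaurentSeries ℂ) (specialVectors Λ Ω A),
      Sum.elim y (0 : κ → LaurentSeries ℂ) ∈ Submodule.span (LaurentSeries ℂ)
        (specialVectors Λ Ω (Matrix.fromBlocks A 0 0 B)) := by
    intro y hy
    induction hy using Submodule.span_induction with
    | mem y hy =>
      obtain ⟨a, ha, l, hl, m, hm⟩ := hy
      refine Submodule.subset_span ⟨a, ha, l, hl, m, ?_⟩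
      rw [twist_pow_fromBlocks, hm, map_zero]
      ext1 i; rcases i with i | i <;> rfl
    | zero =>
      refine cast (congrArg (· ∈ _) ?_) (zero_mem (Submodule.span (LaurentSeries ℂ)
        (specialVectors Λ Ω (Matrix.fromBlocks A 0 0 B))))
      ext1 i; rcases i with i | i <;> rfl
    | add y z _ _ hy hz =>
      convert add_mem hy hz
      ext1 i; rcases i with i | i <;> simp
    | smul a y _ hy =>
      convert Submodule.smul_mem _ a hy
      ext1 i; rcases i with i | i <;> simp
  have h2 : ∀ y ∈ Submodule.span (LaurentSeries ℂ) (specialVectors Λ Ω B),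
      Sum.elim (0 : ι → LaurentSeries ℂ) y ∈ Submodule.span (LaurentSeries ℂ)
        (specialVectors Λ Ω (Matrix.fromBlocks A 0 0 B)) := by
    intro y hy
    induction hy using Submodule.span_induction with
    | mem y hy =>
      obtain ⟨a, ha, l, hl, m, hm⟩ := hy
      refine Submodule.subset_span ⟨a, ha, l, hl, m, ?_⟩
      rw [twist_pow_fromBlocks, hm, map_zero]
      ext1 i; rcases i with i | i <;> rfl
    | zero =>
      refine cast (congrArg (· ∈ _) ?_) (zero_mem (Submodule.span (LaurentSeries ℂ)
        (specialVectors Λ Ω (Matrix.fromBlocks A 0 0 B))))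
      ext1 i; rcases i with i | i <;> rfl
    | add y z _ _ hy hz =>
      convert add_mem hy hz
      ext1 i; rcases i with i | i <;> simp
    | smul a y _ hy =>
      convert Submodule.smul_mem _ a hy
      ext1 i; rcases i with i | i <;> simp
  have hv : v = Sum.elim (fun i => v (Sum.inl i)) (0 : κ → LaurentSeries ℂ) + Sum.elim (0 : ι → LaurentSeries ℂ) (fun i => v (Sum.inr i)) := by
    ext1 i; rcases i with i | i <;> simp
  rw [hv]
  refine add_mem (h1 _ ?_) (h2 _ ?_)
  · rw [hA]; trivial
  · rw [hB]; trivial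

variable [DecidableEq ι] [DecidableEq κ]

/-- The matrix `A ⊗ 1 + 1 ⊗ B`. -/
def kronSum (A : Matrix ι ι (LaurentSeries ℂ)) (B : Matrix κ κ (LaurentSeries ℂ)) :
    Matrix (ι × κ) (ι × κ) (LaurentSeries ℂ) :=
  Matrix.of fun p q => (if p.2 = q.2 then A p.1 q.1 else 0) + (if p.1 = q.1 then B p.2 q.2 else 0)

theorem kronSum_mulVec (A : Matrix ι ι (LaurentSeries ℂ)) (B : Matrix κ κ (LaurentSeries ℂ))
    (y : ι → LaurentSeries ℂ) (z : κ → LaurentSeries ℂ) (p : ι × κ) :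
    (kronSum A B).mulVec (fun q => y q.1 * z q.2) p =
      A.mulVec y p.1 * z p.2 + y p.1 * B.mulVec z p.2 := by
  simp only [Matrix.mulVec, dotProduct, kronSum, Matrix.of_apply, add_mul, Finset.sum_add_distrib]
  congr 1
  · rw [Fintype.sum_prod_type, Finset.sum_mul]
    refine Finset.sum_congr rfl fun i _ => ?_
    rw [Finset.sum_eq_single p.2]
    · simp [mul_assoc]
    · intro j _ hj
      simp [hj.symm]
    · simp
  · rw [Fintype.sum_prod_type_right, Finset.mul_sum]
    refine Finset.sum_congr rfl fun i _ => ?_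
    rw [Finset.sum_eq_single p.1]
    · simp [mul_left_comm]
    · intro j _ hj
      simp [hj.symm]
    · simp

/-- The Leibniz rule distributes the twist `α + β` over the two factors. This is why exponents and
Stokes values add. -/
theorem twist_kronSum (A : Matrix ι ι (LaurentSeries ℂ)) (B : Matrix κ κ (LaurentSeries ℂ))
    (α β : LaurentSeries ℂ) (y : ι → LaurentSeries ℂ) (z : κ → LaurentSeries ℂ) :
    twist (kronSum A B) (α + β) (fun q => y q.1 * z q.2) =
      (fun q => twist A α y q.1 * z q.2) + fun q => y q.1 * twist B β z q.2 := by
  ext1 p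
  simp only [twist_apply, kronSum_mulVec, Pi.add_apply, euler_mul]
  ring

/-- As in the binomial formula, each term of the `(k + l)`-th power has at least `k` applications on
`y` or at least `l` on `z`. -/
theorem twist_pow_kronSum (A : Matrix ι ι (LaurentSeries ℂ)) (B : Matrix κ κ (LaurentSeries ℂ))
    (α β : LaurentSeries ℂ) (m : ℕ) : ∀ (k l : ℕ) (_ : k + l = m) (y : ι → LaurentSeries ℂ)
    (z : κ → LaurentSeries ℂ) (_ : (twist A α ^ k) y = 0) (_ : (twist B β ^ l) z = 0),
    (twist (kronSum A B) (α + β) ^ m) (fun q => y q.1 * z q.2) = 0 := by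
  have hy0 : ∀ (m : ℕ) (z : κ → LaurentSeries ℂ), (twist (kronSum A B) (α + β) ^ m)
      (fun q => (0 : ι → LaurentSeries ℂ) q.1 * z q.2) = 0 := by
    intro m z
    refine Eq.trans (congrArg _ ?_) (map_zero (twist (kronSum A B) (α + β) ^ m))
    ext1 q
    simp
  have hz0 : ∀ (m : ℕ) (y : ι → LaurentSeries ℂ), (twist (kronSum A B) (α + β) ^ m)
      (fun q => y q.1 * (0 : κ → LaurentSeries ℂ) q.2) = 0 := by
    intro m z
    refine Eq.trans (congrArg _ ?_) (map_zero (twist (kronSum A B) (α + β) ^ m))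
    ext1 q
    simp
  induction m with
  | zero =>
    intro k l hkl y z hy hz
    obtain rfl : k = 0 := by omega
    rw [pow_zero, Module.End.one_apply] at hy
    rw [hy, hy0]
  | succ m ih =>
    intro k l hkl y z hy hz
    rw [pow_succ, Module.End.mul_apply, twist_kronSum, map_add]
    have h1 : (twist (kronSum A B) (α + β) ^ m) (fun q => twist A α y q.1 * z q.2) = 0 := by
      cases k with
      | zero =>
        rw [pow_zero, Module.End.one_apply] at hy
        rw [hy, map_zero, hy0]
      | succ k => exact ih k l (by omega) _ _ (by rwa [pow_succ, Module.End.mul_apply] at hy) hz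
    have h2 : (twist (kronSum A B) (α + β) ^ m) (fun q => y q.1 * twist B β z q.2) = 0 := by
      cases l with
      | zero =>
        rw [pow_zero, Module.End.one_apply] at hz
        rw [hz, map_zero, hz0]
      | succ l => exact ih k l (by omega) _ _ hy (by rwa [pow_succ, Module.End.mul_apply] at hz)
    rw [h1, h2, add_zero]

/-- Products of special vectors are special, their exponents and Stokes values being sums in the
same groups; by bilinearity they span. -/
theorem HasSpecialSpan.kronSum {Λ Ω : Finset ℂ} {A : Matrix ι ι (LaurentSeries ℂ)}
    {B : Matrix κ κ (LaurentSeries ℂ)} (hA : HasSpecialSpan Λ Ω A) (hB : HasSpecialSpan Λ Ω B) :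
    HasSpecialSpan Λ Ω (kronSum A B) := by
  rw [HasSpecialSpan, eq_top_iff]
  set P := Submodule.span (LaurentSeries ℂ) (specialVectors Λ Ω (LevelOne.kronSum A B)) with hP
  have h1 : ∀ z ∈ specialVectors Λ Ω B, ∀ y : ι → LaurentSeries ℂ,
      (fun q : ι × κ => y q.1 * z q.2) ∈ P := by
    intro z hz y
    have hy : y ∈ Submodule.span (LaurentSeries ℂ) (specialVectors Λ Ω A) := by rw [hA]; trivial
    induction hy using Submodule.span_induction with
    | mem y hy =>
      obtain ⟨a, ha, l, hl, m, hm⟩ := hy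
      obtain ⟨a', ha', l', hl', m', hm'⟩ := hz
      refine Submodule.subset_span ⟨a + a', add_mem ha ha', l + l', add_mem hl hl', m + m', ?_⟩
      rw [← formalExp_add]
      exact twist_pow_kronSum A B _ _ _ m m' rfl y z hm hm'
    | zero =>
      convert zero_mem P
      simp
    | add x y _ _ hx hy =>
      convert add_mem hx hy
      simp [add_mul]
    | smul a y _ hy =>
      convert Submodule.smul_mem _ a hy
      simp [mul_assoc]
  have h2 : ∀ (y : ι → LaurentSeries ℂ) (z : κ → LaurentSeries ℂ),
      (fun q : ι × κ => y q.1 * z q.2) ∈ P := by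
    intro y z
    have hz : z ∈ Submodule.span (LaurentSeries ℂ) (specialVectors Λ Ω B) := by rw [hB]; trivial
    induction hz using Submodule.span_induction with
    | mem z hz => exact h1 z hz y
    | zero =>
      convert zero_mem P
      simp
    | add x y _ _ hx hy =>
      convert add_mem hx hy
      simp [mul_add]
    | smul a y _ hy =>
      convert Submodule.smul_mem _ a hy
      simp [mul_left_comm]
  intro v _
  have hv : v = ∑ j : κ, fun q : ι × κ => v (q.1, j) * (Pi.single j 1 : κ → LaurentSeries ℂ) q.2 := by
    ext1 q
    simp [Finset.sum_apply, Pi.single_apply]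
  rw [hv]
  exact Submodule.sum_mem _ fun j _ => h2 (fun i => v (i, j)) _

end

theorem IsSystemSolution.add {Λ Ω : Finset ℂ} {f g : LaurentSeries ℂ}
    (hf : IsSystemSolution Λ Ω f) (hg : IsSystemSolution Λ Ω g) : IsSystemSolution Λ Ω (f + g) := by
  obtain ⟨ι, _, A, h, r, hA, hr, hh, hS, rfl⟩ := hf
  obtain ⟨κ, _, B, h', r', hB, hr', hh', hS', rfl⟩ := hg
  refine ⟨ι ⊕ κ, inferInstance, Matrix.fromBlocks A 0 0 B, Sum.elim h h', Sum.elim r r', ?_, ?_, ?_,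
    hS.fromBlocks hS', by simp⟩
  · rintro (i | i) (j | j) <;> simp [hA, hB, IsConvergent.zero]
  · rintro (i | i) <;> simp [hr, hr']
  · rw [Matrix.fromBlocks_mulVec]
    rintro (i | i) <;> simp [hh, hh', Function.comp_def]

theorem IsSystemSolution.mul {Λ Ω : Finset ℂ} {f g : LaurentSeries ℂ}
    (hf : IsSystemSolution Λ Ω f) (hg : IsSystemSolution Λ Ω g) : IsSystemSolution Λ Ω (f * g) := by
  classical
  obtain ⟨ι, _, A, h, r, hA, hr, hh, hS, rfl⟩ := hf
  obtain ⟨κ, _, B, h', r', hB, hr', hh', hS', rfl⟩ := hg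
  refine ⟨ι × κ, inferInstance, kronSum A B, fun q => h q.1 * h' q.2, fun q => r q.1 * r' q.2, ?_, ?_,
    ?_, hS.kronSum hS', ?_⟩
  · intro p q
    simp only [kronSum, Matrix.of_apply]
    refine IsConvergent.add ?_ ?_
    · split_ifs
      exacts [hA _ _, IsConvergent.zero]
    · split_ifs
      exacts [hB _ _, IsConvergent.zero]
  · exact fun q => (hr _).mul (hr' _)
  · intro p
    rw [kronSum_mulVec, ddx_mul, hh, hh']
  · rw [Finset.sum_mul_sum, Fintype.sum_prod_type]
    refine Finset.sum_congr rfl fun i _ => Finset.sum_congr rfl fun j _ => by ring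

/-! ### Derivatives, and the return to a scalar equation -/

/-- The derivative of `∑ r_i h_i` along `h' = A h`. -/
def rowDeriv {ι : Type*} [Fintype ι] (A : Matrix ι ι (LaurentSeries ℂ)) (r : ι → LaurentSeries ℂ) :
    ι → LaurentSeries ℂ := fun j => ddx (r j) + ∑ i, r i * A i j

theorem ddx_sum_mul {ι : Type*} [Fintype ι] {A : Matrix ι ι (LaurentSeries ℂ)}
    {h : ι → LaurentSeries ℂ} (hh : ∀ i, ddx (h i) = A.mulVec h i) (r : ι → LaurentSeries ℂ) :
    ddx (∑ i, r i * h i) = ∑ i, rowDeriv A r i * h i := by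
  simp only [map_sum, ddx_mul, hh, rowDeriv, Finset.sum_add_distrib, add_mul, Finset.sum_mul]
  congr 1
  rw [Finset.sum_comm]
  refine Finset.sum_congr rfl fun i _ => ?_
  rw [Matrix.mulVec, dotProduct, Finset.mul_sum]
  exact Finset.sum_congr rfl fun j _ => by ring

theorem isConvergent_rowDeriv {ι : Type*} [Fintype ι] {A : Matrix ι ι (LaurentSeries ℂ)}
    {r : ι → LaurentSeries ℂ} (hA : ∀ i j, IsConvergent (A i j)) (hr : ∀ i, IsConvergent (r i))
    (i : ι) : IsConvergent (rowDeriv A r i) :=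
  (hr i).ddx.add (IsConvergent.sum _ fun j _ => (hr j).mul (hA j i))

theorem IsSystemSolution.ddx {Λ Ω : Finset ℂ} {f : LaurentSeries ℂ}
    (hf : IsSystemSolution Λ Ω f) : IsSystemSolution Λ Ω (ddx f) := by
  obtain ⟨ι, _, A, h, r, hA, hr, hh, hS, rfl⟩ := hf
  exact ⟨ι, inferInstance, A, h, rowDeriv A r, hA, isConvergent_rowDeriv hA hr, hh, hS,
    ddx_sum_mul hh r⟩

/-- In a finite dimensional space, a sequence has a first vector that depends on the preceding
ones. -/
theorem exists_first_dependent {K V : Type*} [Field K] [AddCommGroup V] [Module K V]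
    [FiniteDimensional K V] (σ : ℕ → V) :
    ∃ N : ℕ, LinearIndependent K (fun i : Fin N => σ i) ∧
      σ N ∈ Submodule.span K (Set.range fun i : Fin N => σ i) := by
  classical
  by_contra! hcon
  have h : ∀ N : ℕ, LinearIndependent K (fun i : Fin N => σ i) := by
    intro N
    induction N with
    | zero => exact linearIndependent_empty_type
    | succ N ih =>
      rw [linearIndependent_finSucc']
      exact ⟨ih, hcon N ih⟩
  have := (h (Module.finrank K V + 1)).fintype_card_le_finrank
  simp at this

theorem exists_right_inverse {K : Type*} [Field K] {κ ι : Type*} [Fintype κ] [DecidableEq κ]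
    [Fintype ι] {E : Matrix κ ι K} (h : LinearIndependent K E.row) :
    ∃ R : Matrix ι κ K, E * R = 1 := by
  classical
  rw [← Matrix.mulVec_surjective_iff_exists_right_inverse]
  have h1 : E.rank = Fintype.card κ := h.rank_matrix
  have h2 : LinearMap.range E.mulVecLin = ⊤ := by
    apply Submodule.eq_top_of_finrank_eq
    rw [← Matrix.rank, h1]
    simp
  exact LinearMap.range_eq_top.mp h2

/-- The successive derivatives of `∑ r_i h_i` are linear forms with convergent rows. The first
dependence among the rows is a scalar equation, and no cyclic vector is needed because a quotient of
the system is enough. -/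
theorem IsSystemSolution.mem_solutionSet {Λ Ω : Finset ℂ} {f : LaurentSeries ℂ}
    (hf : IsSystemSolution Λ Ω f) : f ∈ solutionSet Λ Ω := by
  classical
  obtain ⟨ι, _, A, h, r, hA, hr, hh, hS, rfl⟩ := hf
  let ρ : ℕ → ι → LaurentSeries ℂ := fun m => (rowDeriv A)^[m] r
  have hρ : ∀ m, ρ (m + 1) = rowDeriv A (ρ m) := fun m => Function.iterate_succ_apply' _ _ _
  have hρc : ∀ m i, IsConvergent (ρ m i) := by
    intro m
    induction m with
    | zero => exact hr
    | succ m ih => rw [hρ]; exact isConvergent_rowDeriv hA ih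
  have hρf : ∀ m, LevelOne.ddx^[m] (∑ i, r i * h i) = ∑ i, ρ m i * h i := by
    intro m
    induction m with
    | zero => rfl
    | succ m ih => rw [Function.iterate_succ_apply', ih, ddx_sum_mul hh, hρ]
  let σ : ℕ → ι → convergentField := fun m i => ⟨ρ m i, hρc m i⟩
  -- The dependence is taken over the convergent series, which makes the coefficients of the
  -- equation convergent.
  obtain ⟨N, hli, hN⟩ := exists_first_dependent (K := convergentField) σ
  obtain ⟨c, hc⟩ := (Submodule.mem_span_range_iff_exists_fun convergentField).mp hN
  have hcN : ∀ i, ρ N i = ∑ j : Fin N, (c j : LaurentSeries ℂ) * ρ j i := by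
    intro i
    have := congrArg Subtype.val (congrFun hc i)
    simp only [Finset.sum_apply, Pi.smul_apply, smul_eq_mul, AddSubmonoidClass.coe_finsetSum] at this
    exact this.symm
  obtain ⟨R, hR⟩ := exists_right_inverse (E := Matrix.of fun (i : Fin N) => σ i) hli
  let E : Matrix (Fin N) ι (LaurentSeries ℂ) := Matrix.of fun i => ρ i
  let d : Fin N → LaurentSeries ℂ := fun j => - (c j : LaurentSeries ℂ)
  have hER : E * R.map convergentField.subtype = 1 := by
    have := congrArg (fun M => M.map convergentField.subtype) hR
    simp only [Matrix.map_mul] at this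
    rw [Matrix.map_one _ (map_zero _) (map_one _)] at this
    exact this
  -- `E` is a morphism from the given system to the companion system: differentiating a row moves to
  -- the next one, and the last one is reduced by the dependence.
  have hEA : ∀ (i : Fin N) (k : ι), rowDeriv A (E i) k = ∑ j, companion d i j * E j k := by
    intro i k
    have h1 : rowDeriv A (E i) = ρ (i + 1) := (hρ i).symm
    rw [h1]
    by_cases hi : (i : ℕ) + 1 < N
    · rw [Finset.sum_eq_single ⟨i + 1, hi⟩]
      · simp [companion, E]
      · intro j _ hj
        simp only [companion, Matrix.of_apply]
        rw [if_neg (fun h => hj (Fin.ext h)), if_neg (by omega), zero_mul]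
      · simp
    · have hiN : (i : ℕ) + 1 = N := by omega
      rw [hiN, hcN]
      refine Finset.sum_congr rfl fun j _ => ?_
      simp only [companion, Matrix.of_apply]
      rw [if_neg (by omega), if_pos hiN]
      simp [d, E]
  have htw : ∀ α y, twist (companion d) α (E.mulVec y) = E.mulVec (twist A α y) := by
    intro α y
    ext1 i
    have h1 : (companion d).mulVec (E.mulVec y) i = ∑ k, rowDeriv A (E i) k * y k := by
      rw [Matrix.mulVec_mulVec]
      exact Finset.sum_congr rfl fun k _ => by rw [hEA i k]; rfl
    rw [twist_apply]
    dsimp only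
    rw [h1]
    simp only [Matrix.mulVec, dotProduct, twist_apply, map_sum, euler_mul, rowDeriv, add_mul,
      Finset.sum_add_distrib, mul_add, mul_sub, Finset.mul_sum, Finset.sum_sub_distrib,
      Finset.sum_mul]
    have h2 : ∑ k, euler (E i k) * y k = ∑ k, mono 1 1 * (LevelOne.ddx (E i k) * y k) :=
      Finset.sum_congr rfl fun k _ => by rw [euler_apply]; ring
    have h3 : ∑ k, ∑ j, mono 1 1 * (E i j * A j k * y k) =
        ∑ j, ∑ k, E i j * (mono 1 1 * (A j k * y k)) := by
      rw [Finset.sum_comm]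
      exact Finset.sum_congr rfl fun j _ => Finset.sum_congr rfl fun k _ => by ring
    have h4 : ∑ k, α * (E i k * y k) = ∑ k, E i k * (α * y k) :=
      Finset.sum_congr rfl fun k _ => by ring
    rw [h2, h3, h4]
    ring
  have htwp : ∀ α y m, (twist (companion d) α ^ m) (E.mulVec y) = E.mulVec ((twist A α ^ m) y) := by
    intro α y m
    induction m with
    | zero => rfl
    | succ m ih => rw [pow_succ', Module.End.mul_apply, ih, htw, pow_succ', Module.End.mul_apply]
  -- `E` commutes with the twisted operators, so it carries special vectors to special vectors;
  -- having a right inverse, it is surjective and the images span.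
  have hspan : HasSpecialSpan Λ Ω (companion d) := by
    rw [HasSpecialSpan, eq_top_iff]
    have h1 : ∀ y : ι → LaurentSeries ℂ, E.mulVec y ∈
        Submodule.span (LaurentSeries ℂ) (specialVectors Λ Ω (companion d)) := by
      intro y
      have hy : y ∈ Submodule.span (LaurentSeries ℂ) (specialVectors Λ Ω A) := by rw [hS]; trivial
      induction hy using Submodule.span_induction with
      | mem y hy =>
        obtain ⟨a, ha, l, hl, m, hm⟩ := hy
        refine Submodule.subset_span ⟨a, ha, l, hl, m, ?_⟩
        rw [htwp, hm, Matrix.mulVec_zero]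
      | zero => rw [Matrix.mulVec_zero]; exact zero_mem _
      | add y z _ _ hy hz => rw [Matrix.mulVec_add]; exact add_mem hy hz
      | smul a y _ hy => rw [Matrix.mulVec_smul]; exact Submodule.smul_mem _ _ hy
    intro v _
    have hv : v = E.mulVec ((R.map convergentField.subtype).mulVec v) := by
      rw [Matrix.mulVec_mulVec, hER, Matrix.one_mulVec]
    rw [hv]
    exact h1 _
  obtain ⟨J, n, l, a, hn, hF, hl, ha⟩ := hspan.hasFormalFundamentalSolution
  refine ⟨N, d, J, n, l, a, fun i => (c i).2.neg, hn, hF, hl, ha, ?_⟩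
  simp only [diffOp, hρf]
  simp only [hcN, Finset.sum_mul, Finset.mul_sum]
  rw [Finset.sum_comm, ← Finset.sum_add_distrib]
  refine Finset.sum_eq_zero fun j _ => ?_
  rw [← Finset.sum_add_distrib]
  refine Finset.sum_eq_zero fun i _ => ?_
  simp only [d]
  ring

theorem mem_solutionSet_iff {Λ Ω : Finset ℂ} {f : LaurentSeries ℂ} :
    f ∈ solutionSet Λ Ω ↔ IsSystemSolution Λ Ω f :=
  ⟨isSystemSolution_of_mem_solutionSet, IsSystemSolution.mem_solutionSet⟩

theorem algebraMap_eq_C (a : ℂ) : algebraMap ℂ (LaurentSeries ℂ) a = HahnSeries.C a := by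
  rw [HahnSeries.algebraMap_apply']
  simp

/-- The algebra of the formal meromorphic solutions. -/
def solutionAlgebra (Λ Ω : Finset ℂ) : Subalgebra ℂ (LaurentSeries ℂ) where
  carrier := solutionSet Λ Ω
  mul_mem' ha hb := by
    rw [mem_solutionSet_iff] at *
    exact ha.mul hb
  add_mem' ha hb := by
    rw [mem_solutionSet_iff] at *
    exact ha.add hb
  algebraMap_mem' a := by
    rw [mem_solutionSet_iff, algebraMap_eq_C]
    exact isSystemSolution_C Λ Ω a

theorem ddx_mem_solutionSet {Λ Ω : Finset ℂ} {f : LaurentSeries ℂ} (hf : f ∈ solutionSet Λ Ω) :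
    ddx f ∈ solutionSet Λ Ω := by
  rw [mem_solutionSet_iff] at *
  exact hf.ddx

/-! ## The formal Borel transform -/

open BorelSeries

/-- With `laplace_injective`, this reduces each identity in the Borel plane to one between Laurent
series. -/
theorem laplace_borelTransform (f : LaurentSeries ℂ) : laplace (borelTransform f) = f := by
  ext n
  rcases le_or_gt n 0 with hn | hn
  · obtain ⟨k, rfl⟩ : ∃ k : ℕ, n = -(k : ℤ) := ⟨n.natAbs, by omega⟩
    rw [coeff_laplace_neg]
    change (∑ k ∈ Finset.range ((-f.order).toNat + 1),
      Polynomial.monomial k (f.coeff (-(k : ℤ)))).coeff k = _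
    simp only [Polynomial.finsetSum_coeff, Polynomial.coeff_monomial]
    rw [Finset.sum_ite_eq' (Finset.range _) k]
    split_ifs with h
    · rfl
    · rw [Finset.mem_range] at h
      exact (HahnSeries.coeff_eq_zero_of_lt_order (by omega)).symm
  · obtain ⟨k, rfl⟩ : ∃ k : ℕ, n = (k : ℤ) + 1 := ⟨(n - 1).toNat, by omega⟩
    rw [coeff_laplace_succ]
    change (k.factorial : ℂ) * PowerSeries.coeff k (PowerSeries.mk fun n =>
      f.coeff ((n : ℤ) + 1) / (n.factorial : ℂ)) = _
    rw [PowerSeries.coeff_mk, mul_div_cancel₀]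
    exact_mod_cast Nat.factorial_ne_zero k

theorem borelTransform_injective : Function.Injective borelTransform :=
  Function.LeftInverse.injective laplace_borelTransform

theorem borelTransform_mul (f g : LaurentSeries ℂ) :
    borelTransform (f * g) = borelTransform f * borelTransform g := by
  apply laplace_injective
  simp only [laplace_mul, laplace_borelTransform]

theorem borelTransform_add (f g : LaurentSeries ℂ) :
    borelTransform (f + g) = borelTransform f + borelTransform g := by
  apply laplace_injective
  rw [laplace_add, laplace_borelTransform, laplace_borelTransform, laplace_borelTransform]

theorem borelTransform_C (a : ℂ) :
    borelTransform (HahnSeries.C a) = algebraMap ℂ BorelSeries a := by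
  apply laplace_injective
  rw [Algebra.algebraMap_eq_smul_one, laplace_smul, laplace_one, laplace_borelTransform]
  exact (mul_one (HahnSeries.C a : LaurentSeries ℂ)).symm

/-- Both sides multiply the coefficient of degree `n - 1` by `n - 1` and place it in degree `n`; for
`n ≤ 0` this is `ξ δ^(k+1) = -(k+1) δ^(k)`. -/
theorem laplace_mulXi (u : BorelSeries) : laplace (mulXi u) = mono 2 1 * ddx (laplace u) := by
  ext n
  have hR : (mono 2 1 * ddx (laplace u)).coeff n = (n - 1) * (laplace u).coeff (n - 1) := by
    rw [coeff_mono_mul, coeff_ddx, one_mul, show n - 2 + 1 = n - 1 by ring]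
    push_cast
    ring
  rw [hR]
  rcases le_or_gt n 0 with hn | hn
  · obtain ⟨k, rfl⟩ : ∃ k : ℕ, n = -(k : ℤ) := ⟨n.natAbs, by omega⟩
    rw [coeff_laplace_neg, show -(k : ℤ) - 1 = -((k + 1 : ℕ) : ℤ) by push_cast; ring,
      coeff_laplace_neg]
    change (-(Polynomial.derivative u.sing)).coeff k = _
    rw [Polynomial.coeff_neg, Polynomial.coeff_derivative]
    push_cast
    ring
  · obtain ⟨k, rfl⟩ : ∃ k : ℕ, n = (k : ℤ) + 1 := ⟨(n - 1).toNat, by omega⟩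
    rw [coeff_laplace_succ]
    change (k.factorial : ℂ) * PowerSeries.coeff k (PowerSeries.X * u.reg) = _
    cases k with
    | zero => simp
    | succ k =>
      rw [PowerSeries.coeff_succ_X_mul, add_sub_cancel_right, Nat.cast_succ, coeff_laplace_succ,
        Nat.factorial_succ]
      push_cast
      ring

theorem borelTransform_mono_mul_ddx (f : LaurentSeries ℂ) :
    borelTransform (mono 2 1 * ddx f) = mulXi (borelTransform f) := by
  apply laplace_injective
  rw [laplace_mulXi, laplace_borelTransform, laplace_borelTransform]

theorem borelTransform_ddx (f : LaurentSeries ℂ) :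
    borelTransform (ddx f) = dxi (dxi (mulXi (borelTransform f))) := by
  apply laplace_injective
  rw [laplace_dxi, laplace_dxi, laplace_mulXi, laplace_borelTransform, laplace_borelTransform]
  ext n
  simp only [coeff_mono_mul, one_mul]
  congr 1
  ring

theorem mulXi_mul (u v : BorelSeries) : mulXi (u * v) = mulXi u * v + u * mulXi v := by
  apply laplace_injective
  rw [laplace_add]
  simp only [laplace_mul, laplace_mulXi]
  change mono 2 1 * ddx (laplace u * laplace v) = _
  rw [ddx_mul]
  change _ = (mono 2 1 * ddx (laplace u)) * laplace v + laplace u * (mono 2 1 * ddx (laplace v))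
  ring

/-- Formal solutions multiplied by convergent series. -/
theorem IsSystemSolution.mono_mul {Λ Ω : Finset ℂ} {f : LaurentSeries ℂ}
    (hf : IsSystemSolution Λ Ω f) (k : ℤ) : IsSystemSolution Λ Ω (mono k 1 * f) := by
  obtain ⟨ι, _, A, h, r, hA, hr, hh, hS, rfl⟩ := hf
  refine ⟨ι, inferInstance, A, h, fun i => mono k 1 * r i, hA, fun i => isConvergent_mono_mul (hr i) k,
    hh, hS, ?_⟩
  rw [Finset.mul_sum]
  exact Finset.sum_congr rfl fun i _ => by ring

/-- The algebra of the Borel transforms of the formal meromorphic solutions. -/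
def borelAlgebra (Λ Ω : Finset ℂ) : Subalgebra ℂ BorelSeries where
  carrier := borelTransform '' solutionSet Λ Ω
  mul_mem' := by
    rintro _ _ ⟨f, hf, rfl⟩ ⟨g, hg, rfl⟩
    exact ⟨f * g, (solutionAlgebra Λ Ω).mul_mem hf hg, borelTransform_mul f g⟩
  add_mem' := by
    rintro _ _ ⟨f, hf, rfl⟩ ⟨g, hg, rfl⟩
    exact ⟨f + g, (solutionAlgebra Λ Ω).add_mem hf hg, borelTransform_add f g⟩
  algebraMap_mem' a :=
    ⟨HahnSeries.C a, mem_solutionSet_iff.mpr (isSystemSolution_C Λ Ω a), borelTransform_C a⟩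

theorem mulXi_mem_borelAlgebra {Λ Ω : Finset ℂ} {u : BorelSeries} (hu : u ∈ borelAlgebra Λ Ω) :
    mulXi u ∈ borelAlgebra Λ Ω := by
  obtain ⟨f, hf, rfl⟩ := hu
  refine ⟨mono 2 1 * ddx f, ?_, borelTransform_mono_mul_ddx f⟩
  exact mem_solutionSet_iff.mpr ((mem_solutionSet_iff.mp hf).ddx.mono_mul 2)

/-! ## Gauge transformations at a regular singular point -/

/-- Cauchy product of sequences. -/
def cauchy {A : Type*} [Ring A] (p q : ℕ → A) (n : ℕ) : A := ∑ k ∈ Finset.range (n + 1), p k * q (n - k)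

theorem cauchy_eq_coeff {A : Type*} [Ring A] (p q : ℕ → A) (n : ℕ) :
    cauchy p q n = PowerSeries.coeff n (PowerSeries.mk p * PowerSeries.mk q) := by
  rw [PowerSeries.coeff_mul, Finset.Nat.sum_antidiagonal_eq_sum_range_succ_mk]
  simp [cauchy]

section Algebra

variable {A : Type*} [Ring A] [Algebra ℂ A]

/-- The factorisation of `b^n - a^n` for commuting elements, extended linearly. -/
theorem exists_aeval_sub_eq_mul {a b : A} (h : Commute b a) (q : Polynomial ℂ) :
    ∃ s, Polynomial.aeval b q - Polynomial.aeval a q = (b - a) * s ∧ Commute (b - a) s := by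
  induction q using Polynomial.induction_on' with
  | add p q hp hq =>
    obtain ⟨s, hs, hs'⟩ := hp
    obtain ⟨t, ht, ht'⟩ := hq
    exact ⟨s + t, by rw [map_add, map_add, mul_add, ← hs, ← ht]; abel, hs'.add_right ht'⟩
  | monomial n c =>
    refine ⟨c • ∑ i ∈ Finset.range n, b ^ i * a ^ (n - 1 - i), ?_, ?_⟩
    · rw [mul_smul_comm, h.mul_geom_sum₂, Polynomial.aeval_monomial, Polynomial.aeval_monomial,
        ← Algebra.smul_def, ← Algebra.smul_def, smul_sub]
    · refine Commute.smul_right (Commute.sum_right _ _ _ fun i _ => ?_) c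
      have hb : Commute b (b ^ i * a ^ (n - 1 - i)) :=
        (Commute.refl b).pow_right i |>.mul_right (h.pow_right _)
      have ha : Commute a (b ^ i * a ^ (n - 1 - i)) :=
        (h.symm.pow_right i).mul_right ((Commute.refl a).pow_right _)
      exact hb.sub_left ha

/-- A substitute for disjointness of spectra: `b - a` divides `q(b) - q(a) = q(b)`, with a quotient
that commutes with it. -/
theorem isUnit_sub_of_commute {a b : A} (h : Commute b a) {q : Polynomial ℂ}
    (ha : Polynomial.aeval a q = 0) (hb : IsUnit (Polynomial.aeval b q)) : IsUnit (b - a) := by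
  obtain ⟨s, hs, hc⟩ := exists_aeval_sub_eq_mul h q
  rw [ha, sub_zero] at hs
  exact (hc.isUnit_mul_iff.1 (hs ▸ hb)).1

/-- The polynomial `∏ (X - μ)^m` over `μ ∈ E`. -/
def rootPoly (E : Finset ℂ) (m : ℕ) : Polynomial ℂ :=
  ∏ μ ∈ E, (Polynomial.X - Polynomial.C μ) ^ m

theorem isCoprime_X_sub_C {a b : ℂ} (h : a ≠ b) :
    IsCoprime (Polynomial.X - Polynomial.C a) (Polynomial.X - Polynomial.C b) :=
  Polynomial.isCoprime_X_sub_C_of_isUnit_sub (sub_ne_zero.2 h).isUnit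

/-- `R` is killed by `∏ (X - μ)^m` and no two elements of `E` differ by a positive integer. -/
structure NonResonant (E : Finset ℂ) (m : ℕ) (R : A) : Prop where
  aeval_eq_zero : Polynomial.aeval R (rootPoly E m) = 0
  zero_mem : (0 : ℂ) ∈ E
  sub_ne : ∀ μ ∈ E, ∀ ν ∈ E, ∀ n : ℕ, μ - ν ≠ n + 1

/-- The roots of the shifted polynomial are the `μ - (n + 1)`, none of which lies in `E`. -/
theorem rootPoly_comp_coprime {E : Finset ℂ} {m : ℕ}
    (h : ∀ μ ∈ E, ∀ ν ∈ E, ∀ n : ℕ, μ - ν ≠ n + 1) (n : ℕ) :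
    IsCoprime ((rootPoly E m).comp (Polynomial.X + Polynomial.C ((n : ℂ) + 1))) (rootPoly E m) := by
  rw [rootPoly, Polynomial.prod_comp]
  refine IsCoprime.prod_left fun μ hμ => IsCoprime.prod_right fun ν hν => ?_
  rw [Polynomial.pow_comp]
  refine IsCoprime.pow ?_
  have : (Polynomial.X - Polynomial.C μ).comp (Polynomial.X + Polynomial.C ((n : ℂ) + 1)) =
      Polynomial.X - Polynomial.C (μ - (n + 1)) := by
    simp only [Polynomial.sub_comp, Polynomial.X_comp, Polynomial.C_comp, map_sub]
    ring
  rw [this]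
  refine isCoprime_X_sub_C fun h' => h μ hμ ν hν n ?_
  rw [← h']
  ring

theorem isUnit_aeval_of_isCoprime {a : A} {p q : Polynomial ℂ} (h : IsCoprime p q)
    (hq : Polynomial.aeval a q = 0) : IsUnit (Polynomial.aeval a p) := by
  obtain ⟨s, t, hst⟩ := h
  have h1 := congrArg (Polynomial.aeval a) hst
  rw [map_add, map_mul, map_mul, hq, mul_zero, add_zero, map_one] at h1
  have h2 := h1
  rw [← map_mul, mul_comm, map_mul] at h2
  exact ⟨⟨_, _, h2, h1⟩, rfl⟩

theorem aeval_mulLeft (R : A) (q : Polynomial ℂ) :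
    Polynomial.aeval (LinearMap.mulLeft ℂ R) q = LinearMap.mulLeft ℂ (Polynomial.aeval R q) := by
  exact Polynomial.aeval_algHom_apply (Algebra.lmul ℂ A) R q

theorem aeval_mulRight (R : A) (q : Polynomial ℂ) :
    Polynomial.aeval (LinearMap.mulRight ℂ R) q = LinearMap.mulRight ℂ (Polynomial.aeval R q) := by
  induction q using Polynomial.induction_on' with
  | add p q hp hq => 
    rw [map_add, map_add, hp, hq]
    ext x
    simp [mul_add]
  | monomial n c =>
    ext x
    rw [Polynomial.aeval_monomial, Polynomial.aeval_monomial, ← Algebra.smul_def,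
      ← Algebra.smul_def, LinearMap.pow_mulRight]
    simp

/-- The operator `Y ↦ (n+1) Y - R Y + Y R` is invertible. -/
theorem NonResonant.isUnit {E : Finset ℂ} {m : ℕ} {R : A} (h : NonResonant E m R) (n : ℕ) :
    IsUnit (LinearMap.mulRight ℂ R + algebraMap ℂ (Module.End ℂ A) (n + 1) -
      LinearMap.mulLeft ℂ R) := by
  -- Left and right multiplications by `R` commute. The polynomial kills the first, and by
  -- coprimality it is invertible at the second shifted by `n + 1`.
  refine isUnit_sub_of_commute (q := rootPoly E m) ?_ ?_ ?_
  · refine Commute.add_left (LinearMap.ext fun x => ?_) (Algebra.commute_algebraMap_left _ _)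
    simp [mul_assoc]
  · rw [aeval_mulLeft, h.aeval_eq_zero, LinearMap.mulLeft_zero_eq_zero]
  · have := isUnit_aeval_of_isCoprime (a := LinearMap.mulRight ℂ R)
      (rootPoly_comp_coprime (m := m) h.sub_ne n)
      (by rw [aeval_mulRight, h.aeval_eq_zero, LinearMap.mulRight_zero_eq_zero])
    rwa [Polynomial.aeval_comp, map_add, Polynomial.aeval_X, Polynomial.aeval_C] at this

/-- The membership `0 ∈ E` is used here: it implies that `n + 1` is not in `E`, hence not a root of
the polynomial. -/
theorem NonResonant.isUnit_sub {E : Finset ℂ} {m : ℕ} {R : A} (h : NonResonant E m R) (n : ℕ) :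
    IsUnit (algebraMap ℂ A (n + 1) - R) := by
  refine isUnit_sub_of_commute (q := rootPoly E m) (Algebra.commute_algebraMap_left _ _)
    h.aeval_eq_zero ?_
  rw [Polynomial.aeval_algebraMap_apply]
  refine IsUnit.map _ (IsUnit.mk0 _ ?_)
  rw [rootPoly, map_prod, Finset.prod_ne_zero_iff]
  intro μ hμ
  simp only [map_pow, map_sub, Polynomial.coe_aeval_eq_eval, Polynomial.eval_X, Polynomial.eval_C]
  refine pow_ne_zero _ fun h' => h.sub_ne ((n : ℂ) + 1) ?_ 0 h.zero_mem n (by ring)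
  rwa [sub_eq_zero.1 h']

theorem NonResonant.zero : NonResonant {0} 1 (0 : A) := by
  refine ⟨by simp [rootPoly], by simp, ?_⟩
  intro μ hμ ν hν n h
  rw [Finset.mem_singleton.1 hμ, Finset.mem_singleton.1 hν, sub_self] at h
  exact Nat.cast_add_one_ne_zero n h.symm

/-- A solution `Y` of `(n+1) Y - R Y + Y R = G`. -/
def adSolve (R : A) (n : ℕ) (G : A) : A :=
  Ring.inverse (LinearMap.mulRight ℂ R + algebraMap ℂ (Module.End ℂ A) (n + 1) -
      LinearMap.mulLeft ℂ R) G

theorem NonResonant.adSolve_spec {E : Finset ℂ} {m : ℕ} {R : A} (h : NonResonant E m R) (n : ℕ)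
    (G : A) : ((n : ℂ) + 1) • adSolve R n G = R * adSolve R n G - adSolve R n G * R + G := by
  have := congrArg (fun f => f G) (Ring.mul_inverse_cancel _ (h.isUnit n))
  simp only [Module.End.mul_apply, LinearMap.sub_apply, LinearMap.add_apply,
    LinearMap.mulRight_apply, LinearMap.mulLeft_apply, Module.algebraMap_end_apply,
    Module.End.one_apply] at this
  rw [← adSolve] at this
  calc _ = R * adSolve R n G - adSolve R n G * R + (adSolve R n G * R +
        ((n : ℂ) + 1) • adSolve R n G - R * adSolve R n G) := by abel
    _ = _ := by rw [this]

theorem NonResonant.eq_zero {E : Finset ℂ} {m : ℕ} {R : A} (h : NonResonant E m R) (n : ℕ)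
    {Y : A} (hY : ((n : ℂ) + 1) • Y = R * Y - Y * R) : Y = 0 := by
  have := congrArg (fun f => f Y) (Ring.inverse_mul_cancel _ (h.isUnit n))
  simp only [Module.End.mul_apply, LinearMap.sub_apply, LinearMap.add_apply,
    LinearMap.mulRight_apply, LinearMap.mulLeft_apply, Module.algebraMap_end_apply,
    Module.End.one_apply] at this
  rw [hY, add_sub_cancel, sub_self, map_zero] at this
  exact this.symm

/-- The sequence with `p 0 = 1` and `(n+1) p (n+1) = [R, p (n+1)] + ∑ β (N k) (p (n-k))`. -/
def fuchsSeq (R : A) (β : A → A → A) (N : ℕ → A) : ℕ → A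
  | 0 => 1
  | n + 1 => adSolve R n (∑ k : Fin (n + 1), β (N (n - k)) (fuchsSeq R β N k))

theorem NonResonant.fuchsSeq_succ {E : Finset ℂ} {m : ℕ} {R : A} (h : NonResonant E m R)
    (β : A → A → A) (N : ℕ → A) (n : ℕ) :
    ((n : ℂ) + 1) • fuchsSeq R β N (n + 1) = R * fuchsSeq R β N (n + 1) -
      fuchsSeq R β N (n + 1) * R +
      ∑ k ∈ Finset.range (n + 1), β (N (n - k)) (fuchsSeq R β N k) := by
  rw [fuchsSeq, h.adSolve_spec, Finset.sum_range fun k => β (N (n - k)) (fuchsSeq R β N k)]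

/-- The gauge transformation to the system `ζ v' = R v`. -/
def gauge (R : A) (N : ℕ → A) : ℕ → A := fuchsSeq R (fun x y => x * y) N

/-- The inverse gauge transformation. -/
def gaugeInv (R : A) (N : ℕ → A) : ℕ → A := fuchsSeq R (fun x y => -(y * x)) N

theorem NonResonant.gauge_succ {E : Finset ℂ} {m : ℕ} {R : A} (h : NonResonant E m R)
    (N : ℕ → A) (n : ℕ) :
    ((n : ℂ) + 1) • gauge R N (n + 1) = R * gauge R N (n + 1) - gauge R N (n + 1) * R +
      cauchy N (gauge R N) n := by
  rw [gauge, h.fuchsSeq_succ, cauchy, ← Finset.sum_range_reflect]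
  congr 1
  refine Finset.sum_congr rfl fun k hk => ?_
  have : n - (n - k) = k := by have := Finset.mem_range.1 hk; omega
  simp [this]

theorem NonResonant.gaugeInv_succ {E : Finset ℂ} {m : ℕ} {R : A} (h : NonResonant E m R)
    (N : ℕ → A) (n : ℕ) :
    ((n : ℂ) + 1) • gaugeInv R N (n + 1) = R * gaugeInv R N (n + 1) - gaugeInv R N (n + 1) * R -
      cauchy (gaugeInv R N) N n := by
  rw [gaugeInv, h.fuchsSeq_succ, cauchy, Finset.sum_neg_distrib, ← sub_eq_add_neg]

/-- The derivation `X d/dX` of power series with coefficients in a noncommutative ring. -/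
def seqEuler (p : PowerSeries A) : PowerSeries A := PowerSeries.mk fun n => (n : ℂ) • PowerSeries.coeff n p

theorem seqEuler_mul (p q : PowerSeries A) :
    seqEuler (p * q) = seqEuler p * q + p * seqEuler q := by
  ext n
  simp only [seqEuler, PowerSeries.coeff_mk, map_add, PowerSeries.coeff_mul, Finset.smul_sum,
    ← Finset.sum_add_distrib]
  refine Finset.sum_congr rfl fun x hx => ?_
  rw [← Finset.HasAntidiagonal.mem_antidiagonal.1 hx, smul_mul_assoc, mul_smul_comm, ← add_smul]
  push_cast
  rfl

/-- The equation `ζ P' = [R, P] + ζ N P` expresses that `P` carries solutions of `ζ v' = R v` to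
solutions of `ζ v' = (R + ζ N) v`. -/
theorem NonResonant.seqEuler_gauge {E : Finset ℂ} {m : ℕ} {R : A} (h : NonResonant E m R)
    (N : ℕ → A) : seqEuler (PowerSeries.mk (gauge R N)) =
      PowerSeries.C R * PowerSeries.mk (gauge R N) - PowerSeries.mk (gauge R N) * PowerSeries.C R +
      PowerSeries.X * (PowerSeries.mk N * PowerSeries.mk (gauge R N)) := by
  ext n
  cases n with
  | zero => simp [seqEuler, gauge, fuchsSeq]
  | succ n =>
    have := h.gauge_succ N n
    rw [cauchy_eq_coeff] at this
    simp [seqEuler, PowerSeries.coeff_succ_X_mul, this]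

theorem NonResonant.seqEuler_gaugeInv {E : Finset ℂ} {m : ℕ} {R : A} (h : NonResonant E m R)
    (N : ℕ → A) : seqEuler (PowerSeries.mk (gaugeInv R N)) =
      PowerSeries.C R * PowerSeries.mk (gaugeInv R N) -
        PowerSeries.mk (gaugeInv R N) * PowerSeries.C R -
      PowerSeries.X * (PowerSeries.mk (gaugeInv R N) * PowerSeries.mk N) := by
  ext n
  cases n with
  | zero => simp [seqEuler, gaugeInv, fuchsSeq]
  | succ n =>
    have := h.gaugeInv_succ N n
    rw [cauchy_eq_coeff] at this
    simp [seqEuler, PowerSeries.coeff_succ_X_mul, this]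

/-- Both the product `Z` and `1` solve `ζ Z' = [R, Z] + ζ [N, Z]`, and nonresonance determines a
solution from its constant term. -/
theorem NonResonant.gauge_mul_gaugeInv {E : Finset ℂ} {m : ℕ} {R : A} (h : NonResonant E m R)
    (N : ℕ → A) : PowerSeries.mk (gauge R N) * PowerSeries.mk (gaugeInv R N) = 1 := by
  set P := PowerSeries.mk (gauge R N)
  set Q := PowerSeries.mk (gaugeInv R N)
  set Z := P * Q with hZ
  have key : seqEuler Z = PowerSeries.C R * Z - Z * PowerSeries.C R +
      PowerSeries.X * (PowerSeries.mk N * Z - Z * PowerSeries.mk N) := by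
    rw [hZ, seqEuler_mul, h.seqEuler_gauge, h.seqEuler_gaugeInv, add_mul, sub_mul, mul_sub, mul_sub,
      ← mul_assoc P PowerSeries.X, (PowerSeries.commute_X P).eq, mul_sub]
    simp only [mul_assoc]
    abel
  have h0 : ∀ n, ∀ k ≤ n, PowerSeries.coeff k (Z - 1) = 0 := by
    intro n
    induction n with
    | zero =>
      intro k hk
      obtain rfl : k = 0 := by omega
      simp [hZ, P, Q, gauge, gaugeInv, fuchsSeq]
    | succ n ih =>
      intro k hk
      rcases Nat.lt_or_ge k (n + 1) with h' | h'
      · exact ih k (by omega)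
      obtain rfl : k = n + 1 := by omega
      have hc : PowerSeries.coeff (n + 1) (Z - 1) = PowerSeries.coeff (n + 1) Z := by
        simp [PowerSeries.coeff_one]
      have h1 := congrArg (PowerSeries.coeff (n + 1)) key
      -- Subtracting `1` does not change the commutator, and the coefficients of `Z - 1` up to
      -- degree `n` are already known to vanish.
      have h2 : PowerSeries.mk N * Z - Z * PowerSeries.mk N =
          PowerSeries.mk N * (Z - 1) - (Z - 1) * PowerSeries.mk N := by
        rw [mul_sub, sub_mul, mul_one, one_mul]
        abel
      have h3 : PowerSeries.coeff n (PowerSeries.mk N * (Z - 1) - (Z - 1) * PowerSeries.mk N) = 0 := by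
        rw [map_sub, PowerSeries.coeff_mul, PowerSeries.coeff_mul, Finset.sum_eq_zero,
          Finset.sum_eq_zero, sub_zero]
        · intro x hx
          rw [ih x.1 (by have := Finset.HasAntidiagonal.mem_antidiagonal.1 hx; omega), zero_mul]
        · intro x hx
          rw [ih x.2 (by have := Finset.HasAntidiagonal.mem_antidiagonal.1 hx; omega), mul_zero]
      rw [h2, map_add, PowerSeries.coeff_succ_X_mul, h3, add_zero, map_sub,
        PowerSeries.coeff_C_mul, PowerSeries.coeff_mul_C, seqEuler, PowerSeries.coeff_mk] at h1
      rw [hc]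
      exact h.eq_zero n (by exact_mod_cast h1)
  rw [← sub_eq_zero]
  ext n
  simpa using h0 n n le_rfl

/-- The Bézout relation between the cofactors of the pairwise coprime `(X - μ)^m`, evaluated at `R`:
a decomposition into generalised eigenspaces without finite dimension. -/
theorem exists_partition_of_aeval_eq_zero {E : Finset ℂ} {m : ℕ} {R : A}
    (h : Polynomial.aeval R (rootPoly E m) = 0) :
    ∃ e : ℂ → A, ∑ μ ∈ E, e μ = 1 ∧ ∀ μ ∈ E, (R - algebraMap ℂ A μ) ^ m * e μ = 0 := by
  classical
  rcases E.eq_empty_or_nonempty with rfl | hE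
  · refine ⟨0, ?_, by simp⟩
    simp only [rootPoly, Finset.prod_empty, map_one] at h
    simp [h]
  have hc : Pairwise (fun i j : E => IsCoprime ((Polynomial.X - Polynomial.C (i : ℂ)) ^ m)
      ((Polynomial.X - Polynomial.C (j : ℂ)) ^ m)) := fun i j hij =>
    IsCoprime.pow (isCoprime_X_sub_C fun h => hij (Subtype.ext h))
  have hc' : Pairwise (Function.onFun IsCoprime
      fun i : E => (Polynomial.X - Polynomial.C (i : ℂ)) ^ m) := hc
  obtain ⟨c, hc⟩ := (exists_sum_eq_one_iff_pairwise_coprime hE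
    (s := fun i => (Polynomial.X - Polynomial.C i) ^ m)).2 hc'
  refine ⟨fun μ => Polynomial.aeval R
    (c μ * ∏ j ∈ E \ {μ}, (Polynomial.X - Polynomial.C j) ^ m), ?_, ?_⟩
  · rw [← map_sum, hc, map_one]
  · intro μ hμ
    have h1 : (R - algebraMap ℂ A μ) ^ m =
        Polynomial.aeval R ((Polynomial.X - Polynomial.C μ) ^ m) := by simp
    have h2 : (Polynomial.X - Polynomial.C μ) ^ m *
        (c μ * ∏ j ∈ E \ {μ}, (Polynomial.X - Polynomial.C j) ^ m) = c μ * rootPoly E m := by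
      rw [rootPoly, ← Finset.mul_prod_erase _ _ hμ, Finset.erase_eq]
      ring
    rw [h1, ← map_mul, h2, map_mul, h, mul_zero]

end Algebra

/-! ### Exponentials of elements killed by a polynomial -/

section Normed

variable {A : Type*} [NormedRing A] [NormedAlgebra ℂ A] [CompleteSpace A]

/-- All terms of the exponential series from degree `m` on vanish; the harmless term of degree `m`
is kept to fit the range of `HasModerateForm`. -/
theorem exp_smul_mul_of_pow_mul_eq_zero {T e : A} {m : ℕ} (h : T ^ m * e = 0) (s : ℂ) :
    NormedSpace.exp (s • T) * e =
      ∑ p ∈ Finset.range (m + 1), (s ^ p) • ((p.factorial : ℂ)⁻¹ • (T ^ p * e)) := by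
  have hs : HasSum (fun n : ℕ => (s ^ n) • ((n.factorial : ℂ)⁻¹ • (T ^ n * e)))
      (NormedSpace.exp (s • T) * e) := by
    have := (NormedSpace.exp_series_hasSum_exp' (𝕂 := ℂ) (s • T)).mul_right e
    refine this.congr_fun fun n => ?_
    rw [smul_pow, smul_mul_assoc, smul_mul_assoc, smul_comm]
  refine hs.unique (hasSum_sum_of_ne_finset_zero fun n hn => ?_)
  obtain ⟨k, rfl⟩ : ∃ k, n = k + m := ⟨n - m, by rw [Finset.mem_range] at hn; omega⟩
  rw [pow_add T, mul_assoc, h, mul_zero, smul_zero, smul_zero]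

theorem exp_smul_eq_exp_smul {R : A} (μ s : ℂ) : NormedSpace.exp (s • R) =
    Complex.exp (μ * s) • NormedSpace.exp (s • (R - algebraMap ℂ A μ)) := by
  have h1 : s • R = algebraMap ℂ A (μ * s) + s • (R - algebraMap ℂ A μ) := by
    rw [smul_sub, Algebra.smul_def s (algebraMap ℂ A μ), ← map_mul, mul_comm s μ]
    abel
  let +nondep : NormedAlgebra ℚ A := .restrictScalars ℚ ℂ A
  rw [h1, NormedSpace.exp_add_of_commute (Algebra.commute_algebraMap_left _ _),
    ← NormedSpace.algebraMap_exp_comm, ← Algebra.smul_def, Complex.exp_eq_exp_ℂ]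

/-- On the `μ`-part of the partition, `exp(s R) = e^(μ s) exp(s (R - μ))` is `e^(μ s)` times a
polynomial in `s`. For `s = ln ζ` these are the functions `ζ^μ (ln ζ)^p`. -/
theorem exp_smul_eq_sum {E : Finset ℂ} {m : ℕ} {R : A}
    (h : Polynomial.aeval R (rootPoly E m) = 0) :
    ∃ a : ℂ → ℕ → A, ∀ s : ℂ, NormedSpace.exp (s • R) =
      ∑ μ ∈ E, ∑ p ∈ Finset.range (m + 1), (Complex.exp (μ * s) * s ^ p) • a μ p := by
  obtain ⟨e, he, he'⟩ := exists_partition_of_aeval_eq_zero h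
  refine ⟨fun μ p => ((p.factorial : ℂ)⁻¹) • ((R - algebraMap ℂ A μ) ^ p * e μ), fun s => ?_⟩
  rw [← mul_one (NormedSpace.exp (s • R)), ← he, Finset.mul_sum]
  refine Finset.sum_congr rfl fun μ hμ => ?_
  rw [exp_smul_eq_exp_smul μ s, smul_mul_assoc, exp_smul_mul_of_pow_mul_eq_zero (he' μ hμ),
    Finset.smul_sum]
  exact Finset.sum_congr rfl fun n _ => smul_smul _ _ _

end Normed

/-! ## Sequences with a given radius of convergence -/

/-- The power series `∑ p n ζ^n` converges absolutely for `|ζ| < r`. -/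
def ConvOn {V : Type*} [SeminormedAddCommGroup V] (r : ℝ) (p : ℕ → V) : Prop :=
  ∀ σ, 0 ≤ σ → σ < r → Summable fun n => ‖p n‖ * σ ^ n

/-- Boundedness at an intermediate radius `τ` gives comparison with a geometric series of ratio `σ /
τ`. -/
theorem convOn_of_bounded {V : Type*} [SeminormedAddCommGroup V] {r : ℝ} {p : ℕ → V}
    (h : ∀ σ, 0 < σ → σ < r → ∃ K, ∀ n, ‖p n‖ * σ ^ n ≤ K) : ConvOn r p := by
  intro σ h0 hσ
  obtain ⟨τ, hτ, hτr⟩ := exists_between hσ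
  have hτ0 : 0 < τ := h0.trans_lt hτ
  obtain ⟨K, hK⟩ := h τ hτ0 hτr
  have hg : Summable fun n => K * (σ / τ) ^ n :=
    (summable_geometric_of_lt_one (by positivity) ((div_lt_one hτ0).2 hτ)).mul_left K
  refine hg.of_nonneg_of_le (fun n => by positivity) fun n => ?_
  rw [div_pow, ← mul_div_assoc, le_div_iff₀ (by positivity)]
  calc ‖p n‖ * σ ^ n * τ ^ n = (‖p n‖ * τ ^ n) * σ ^ n := by ring
    _ ≤ K * σ ^ n := mul_le_mul_of_nonneg_right (hK n) (by positivity)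

theorem ConvOn.bounded {V : Type*} [SeminormedAddCommGroup V] {r : ℝ} {p : ℕ → V}
    (h : ConvOn r p) {σ : ℝ} (h0 : 0 ≤ σ) (hσ : σ < r) : ∃ K, 0 ≤ K ∧ ∀ n, ‖p n‖ * σ ^ n ≤ K :=
  ⟨_, tsum_nonneg fun n => by positivity, fun n => (h σ h0 hσ).le_tsum n fun j _ => by positivity⟩

/-- As soon as `n + 1` exceeds `|D| ∑ c`, the recursion cannot exceed a bound valid for the
preceding terms; the sum `K` of the first terms is such a bound. -/
theorem bounded_of_recursion {p c : ℕ → ℝ} (hp : ∀ n, 0 ≤ p n) (hc : ∀ n, 0 ≤ c n)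
    (hs : Summable c) {n₀ : ℕ} {D : ℝ} 
    (h : ∀ n ≥ n₀, (n + 1 : ℝ) * p (n + 1) ≤ D * ∑ k ∈ Finset.range (n + 1), c (n - k) * p k) :
    ∃ K, ∀ n, p n ≤ K := by
  obtain ⟨n₁, hn₁⟩ := exists_nat_ge (|D| * ∑' k, c k)
  set n₂ := max n₀ n₁
  set K := ∑ k ∈ Finset.range (n₂ + 1), p k
  have hK : 0 ≤ K := Finset.sum_nonneg fun k _ => hp k
  refine ⟨K, fun n => ?_⟩
  induction n using Nat.strong_induction_on with
  | _ n ih =>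
    rcases Nat.lt_or_ge n (n₂ + 1) with hn | hn
    · exact Finset.single_le_sum (f := p) (fun k _ => hp k) (Finset.mem_range.2 hn)
    obtain ⟨n, rfl⟩ : ∃ k, n = k + 1 := ⟨n - 1, by omega⟩
    have h1 := h n (by omega)
    have h2 : ∑ k ∈ Finset.range (n + 1), c (n - k) * p k ≤ (∑' k, c k) * K := by
      calc ∑ k ∈ Finset.range (n + 1), c (n - k) * p k
          ≤ ∑ k ∈ Finset.range (n + 1), c (n - k) * K :=
            Finset.sum_le_sum fun k hk => mul_le_mul_of_nonneg_left
              (ih k (Finset.mem_range.1 hk)) (hc _)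
        _ = (∑ k ∈ Finset.range (n + 1), c k) * K := by
            rw [← Finset.sum_mul]
            congr 1
            exact Finset.sum_range_reflect c (n + 1)
        _ ≤ (∑' k, c k) * K :=
            mul_le_mul_of_nonneg_right (hs.sum_le_tsum _ fun k _ => hc k) hK
    have h3 : 0 ≤ ∑ k ∈ Finset.range (n + 1), c (n - k) * p k :=
      Finset.sum_nonneg fun k _ => mul_nonneg (hc _) (hp _)
    have h4 : (n + 1 : ℝ) * p (n + 1) ≤ (n + 1 : ℝ) * K := by
      calc (n + 1 : ℝ) * p (n + 1) ≤ D * ∑ k ∈ Finset.range (n + 1), c (n - k) * p k := h1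
        _ ≤ |D| * ((∑' k, c k) * K) := mul_le_mul (le_abs_self D) h2 h3 (abs_nonneg D)
        _ = (|D| * ∑' k, c k) * K := by ring
        _ ≤ (n + 1 : ℝ) * K := by
          refine mul_le_mul_of_nonneg_right (hn₁.trans ?_) hK
          have : (n₁ : ℝ) ≤ n := by exact_mod_cast (by omega : n₁ ≤ n)
          linarith
    exact le_of_mul_le_mul_left h4 (by positivity)

/-- No radius is lost: from `n ≥ 4 ‖R‖` on, the commutator with `R` takes at most half of the left
side, and `bounded_of_recursion` applies at each radius below that of `N`. -/
theorem NonResonant.convOn_fuchsSeq {A : Type*} [NormedRing A] [NormedAlgebra ℂ A]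
    {E : Finset ℂ} {m : ℕ} {R : A}
    (h : NonResonant E m R) {β : A → A → A} (hβ : ∀ x y, ‖β x y‖ ≤ ‖x‖ * ‖y‖) {N : ℕ → A} {r : ℝ}
    (hN : ConvOn r N) : ConvOn r (fuchsSeq R β N) := by
  refine convOn_of_bounded fun σ h0 hσ => ?_
  obtain ⟨n₀, hn₀⟩ := exists_nat_ge (4 * ‖R‖)
  refine bounded_of_recursion (c := fun n => ‖N n‖ * σ ^ n) (fun n => by positivity)
    -- The factor `2` pays for the absorbed commutator, the factor `σ` for the step from `n` to `n +
    -- 1`.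
    (fun n => by positivity) (hN σ h0.le hσ) (n₀ := n₀) (D := 2 * σ) fun n hn => ?_
  set p := fuchsSeq R β N with hp
  have h1 := h.fuchsSeq_succ β N n
  rw [← hp] at h1
  have h2 : (n + 1 : ℝ) * ‖p (n + 1)‖ ≤ 2 * ‖R‖ * ‖p (n + 1)‖ +
      ∑ k ∈ Finset.range (n + 1), ‖N (n - k)‖ * ‖p k‖ := by
    have h3 : ‖((n : ℂ) + 1) • p (n + 1)‖ = (n + 1 : ℝ) * ‖p (n + 1)‖ := by
      rw [norm_smul]
      congr 1
      exact_mod_cast Complex.norm_natCast (n + 1)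
    rw [← h3, h1]
    refine (norm_add_le _ _).trans (add_le_add ?_ ?_)
    · refine (norm_sub_le _ _).trans ?_
      have := norm_mul_le R (p (n + 1))
      have := norm_mul_le (p (n + 1)) R
      linarith
    · exact (norm_sum_le _ _).trans (Finset.sum_le_sum fun k _ => hβ _ _)
  have h4 : (n + 1 : ℝ) * ‖p (n + 1)‖ ≤ 2 * ∑ k ∈ Finset.range (n + 1), ‖N (n - k)‖ * ‖p k‖ := by
    have h5 : (4 * ‖R‖) * ‖p (n + 1)‖ ≤ (n + 1 : ℝ) * ‖p (n + 1)‖ := by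
      refine mul_le_mul_of_nonneg_right (hn₀.trans ?_) (norm_nonneg _)
      have : (n₀ : ℝ) ≤ n := by exact_mod_cast hn
      linarith
    linarith
  have h5 : ∑ k ∈ Finset.range (n + 1), ‖N (n - k)‖ * σ ^ (n - k) * (‖p k‖ * σ ^ k) =
      (∑ k ∈ Finset.range (n + 1), ‖N (n - k)‖ * ‖p k‖) * σ ^ n := by
    rw [Finset.sum_mul]
    refine Finset.sum_congr rfl fun k hk => ?_
    have : σ ^ n = σ ^ (n - k) * σ ^ k := by
      rw [← pow_add]
      congr 1
      have := Finset.mem_range.1 hk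
      omega
    rw [this]
    ring
  rw [h5]
  calc (n + 1 : ℝ) * (‖p (n + 1)‖ * σ ^ (n + 1)) = ((n + 1 : ℝ) * ‖p (n + 1)‖) * σ ^ (n + 1) := by ring
    _ ≤ (2 * ∑ k ∈ Finset.range (n + 1), ‖N (n - k)‖ * ‖p k‖) * σ ^ (n + 1) :=
      mul_le_mul_of_nonneg_right h4 (by positivity)
    _ = _ := by ring

/-! ## Sums of convergent series with values in a Banach space -/

/-- The sum of the series `∑ ζ^n p n`. -/
def seriesSum {V : Type*} [NormedAddCommGroup V] [NormedSpace ℂ V] (p : ℕ → V) (ζ : ℂ) : V :=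
  ∑' n, ζ ^ n • p n

theorem ConvOn.succ {V : Type*} [NormedAddCommGroup V] {r : ℝ} {p : ℕ → V}
    (h : ConvOn r p) : ConvOn r fun n => p (n + 1) := by
  refine convOn_of_bounded fun σ h0 hσ => ?_
  obtain ⟨K, -, hK⟩ := h.bounded h0.le hσ
  refine ⟨K / σ, fun n => ?_⟩
  rw [le_div_iff₀ h0, mul_assoc, ← pow_succ]
  exact hK (n + 1)

section Series

variable {V : Type*} [NormedAddCommGroup V] [NormedSpace ℂ V] {r : ℝ} {p : ℕ → V} {ζ : ℂ}

theorem ConvOn.summable_norm (h : ConvOn r p) (hζ : ‖ζ‖ < r) : Summable fun n => ‖ζ ^ n • p n‖ := by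
  refine (h ‖ζ‖ (norm_nonneg _) hζ).congr fun n => ?_
  rw [norm_smul, norm_pow, mul_comm]

theorem seriesSum_zero_arg (p : ℕ → V) : seriesSum p 0 = p 0 := by
  rw [seriesSum, tsum_eq_single 0 fun n hn => by rw [zero_pow hn, zero_smul], pow_zero, one_smul]

variable [CompleteSpace V]

theorem ConvOn.hasSum (h : ConvOn r p) (hζ : ‖ζ‖ < r) :
    HasSum (fun n => ζ ^ n • p n) (seriesSum p ζ) :=
  (h.summable_norm hζ).of_norm.hasSum

theorem ConvOn.smul_seriesSum_succ (h : ConvOn r p) (hζ : ‖ζ‖ < r) :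
    ζ • seriesSum (fun n => p (n + 1)) ζ = seriesSum p ζ - p 0 := by
  have h1 := (h.succ.hasSum hζ).const_smul ζ
  have h2 := (hasSum_nat_add_iff' 1).2 (h.hasSum hζ)
  rw [Finset.sum_range_one, pow_zero, one_smul] at h2
  refine h1.unique (h2.congr_fun fun n => ?_)
  rw [smul_smul, pow_succ']

theorem ConvOn.differentiableOn (h : ConvOn r p) :
    DifferentiableOn ℂ (seriesSum p) (Metric.ball 0 r) := by
  intro ζ hζ
  rw [mem_ball_zero_iff] at hζ
  obtain ⟨σ, hσ, hσr⟩ := exists_between hζ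
  refine ((Complex.differentiableOn_tsum_of_summable_norm
    (h σ ((norm_nonneg _).trans hσ.le) hσr) (F := fun i z => z ^ i • p i) (U := Metric.ball 0 σ)
    (fun i => ((differentiable_id.pow i).smul_const _).differentiableOn)
    Metric.isOpen_ball ?_).differentiableAt (Metric.isOpen_ball.mem_nhds
      (mem_ball_zero_iff.2 hσ))).differentiableWithinAt
  intro i w hw
  rw [norm_smul, norm_pow, mul_comm]
  rw [mem_ball_zero_iff] at hw
  gcongr

theorem ConvOn.hasSum_deriv (h : ConvOn r p) (hζ : ‖ζ‖ < r) :
    HasSum (fun n : ℕ => ζ ^ n • (((n : ℂ) + 1) • p (n + 1))) (deriv (seriesSum p) ζ) := by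
  obtain ⟨σ, hσ, hσr⟩ := exists_between hζ
  have hs := h σ ((norm_nonneg _).trans hσ.le) hσr
  have hf : ∀ i : ℕ, DifferentiableOn ℂ (fun z : ℂ => z ^ i • p i) (Metric.ball 0 σ) := fun i =>
    ((differentiable_id.pow i).smul_const _).differentiableOn
  have hle : ∀ (i : ℕ) (w : ℂ), w ∈ Metric.ball (0 : ℂ) σ → ‖w ^ i • p i‖ ≤ ‖p i‖ * σ ^ i := by
    intro i w hw
    rw [norm_smul, norm_pow, mul_comm]
    rw [mem_ball_zero_iff] at hw
    gcongr
  have h3 := (hasSum_nat_add_iff' 1).2 (Complex.hasSum_deriv_of_summable_norm hs hf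
    Metric.isOpen_ball hle (mem_ball_zero_iff.2 hσ))
  rw [Finset.sum_range_one] at h3
  simp only [pow_zero, deriv_const, sub_zero] at h3
  refine h3.congr_fun fun n => ?_
  rw [deriv_smul_const (by fun_prop)]
  simp [smul_smul, mul_comm]

theorem ConvOn.hasDerivAt (h : ConvOn r p) (hζ : ‖ζ‖ < r) {d : V}
    (hd : HasSum (fun n : ℕ => ζ ^ n • (((n : ℂ) + 1) • p (n + 1))) d) :
    HasDerivAt (seriesSum p) d ζ := by
  rw [hd.unique (h.hasSum_deriv hζ)]
  exact (h.differentiableOn.differentiableAt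
    (Metric.isOpen_ball.mem_nhds (mem_ball_zero_iff.2 hζ))).hasDerivAt

end Series

/-! ### Sums of the gauge transformations -/

section Gauge

variable {A : Type*} [NormedRing A] [NormedAlgebra ℂ A]
  {r : ℝ} {R : A} {N : ℕ → A} {ζ : ℂ} {E : Finset ℂ} {m : ℕ}

/-- With `e = exp(-R ln ζ)` and `z = ζ⁻¹`, this is the derivative of `e Q`; it cancels against the
contribution of `u'` in that of `e Q u`. -/
theorem neg_smul_mul_add_eq {e Q n : A} (h : R * e = e * R) (z : ℂ) :
    (-z • (R * e)) * Q + e * (z • (R * Q - Q * R) - Q * n) = -(e * Q * (z • R + n)) := by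
  rw [h]
  simp only [mul_sub, mul_add, smul_mul_assoc, mul_smul_comm, neg_smul, smul_sub, mul_assoc, neg_mul]
  abel

theorem NonResonant.convOn_gauge (h : NonResonant E m R) (hN : ConvOn r N) :
    ConvOn r (gauge R N) :=
  h.convOn_fuchsSeq norm_mul_le hN

theorem NonResonant.convOn_gaugeInv (h : NonResonant E m R) (hN : ConvOn r N) :
    ConvOn r (gaugeInv R N) :=
  h.convOn_fuchsSeq (fun x y => by rw [norm_neg, mul_comm ‖x‖]; exact norm_mul_le y x) hN

variable [CompleteSpace A]

theorem ConvOn.hasSum_cauchy {p q : ℕ → A} (hp : ConvOn r p) (hq : ConvOn r q) (hζ : ‖ζ‖ < r) :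
    HasSum (fun n => ζ ^ n • cauchy p q n) (seriesSum p ζ * seriesSum q ζ) := by
  refine (hasSum_sum_range_mul_of_summable_norm (hp.summable_norm hζ)
    (hq.summable_norm hζ)).congr_fun fun n => ?_
  rw [cauchy, Finset.smul_sum]
  refine Finset.sum_congr rfl fun k hk => ?_
  rw [smul_mul_smul_comm, ← pow_add]
  congr 2
  have := Finset.mem_range.1 hk
  omega

theorem NonResonant.hasDerivAt_gauge (h : NonResonant E m R) (hN : ConvOn r N) (hζ : ‖ζ‖ < r) :
    HasDerivAt (seriesSum (gauge R N))
      (R * seriesSum (fun n => gauge R N (n + 1)) ζ - seriesSum (fun n => gauge R N (n + 1)) ζ * R +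
        seriesSum N ζ * seriesSum (gauge R N) ζ) ζ := by
  have hP := h.convOn_gauge hN
  refine hP.hasDerivAt hζ ?_
  refine ((((hP.succ.hasSum hζ).mul_left R).sub ((hP.succ.hasSum hζ).mul_right R)).add
    (hN.hasSum_cauchy hP hζ)).congr_fun fun n => ?_
  rw [h.gauge_succ, smul_add, smul_sub, mul_smul_comm, smul_mul_assoc]

theorem NonResonant.hasDerivAt_gaugeInv (h : NonResonant E m R) (hN : ConvOn r N) (hζ : ‖ζ‖ < r) :
    HasDerivAt (seriesSum (gaugeInv R N))
      (R * seriesSum (fun n => gaugeInv R N (n + 1)) ζ -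
        seriesSum (fun n => gaugeInv R N (n + 1)) ζ * R -
        seriesSum (gaugeInv R N) ζ * seriesSum N ζ) ζ := by
  have hQ := h.convOn_gaugeInv hN
  refine hQ.hasDerivAt hζ ?_
  refine ((((hQ.succ.hasSum hζ).mul_left R).sub ((hQ.succ.hasSum hζ).mul_right R)).sub
    (hQ.hasSum_cauchy hN hζ)).congr_fun fun n => ?_
  rw [h.gaugeInv_succ, smul_sub, smul_sub, mul_smul_comm, smul_mul_assoc]

/-- The constant term `1` commutes with `R`, so the commutator of the shifted series is that of the
series itself divided by `ζ`. -/
theorem NonResonant.hasDerivAt_gaugeInv' (h : NonResonant E m R) (hN : ConvOn r N) (hζ : ‖ζ‖ < r)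
    (h0 : ζ ≠ 0) : HasDerivAt (seriesSum (gaugeInv R N))
      (ζ⁻¹ • (R * seriesSum (gaugeInv R N) ζ - seriesSum (gaugeInv R N) ζ * R) -
        seriesSum (gaugeInv R N) ζ * seriesSum N ζ) ζ := by
  have h1 := (h.convOn_gaugeInv hN).smul_seriesSum_succ hζ
  have h2 : seriesSum (gaugeInv R N) ζ = ζ • seriesSum (fun n => gaugeInv R N (n + 1)) ζ + 1 := by
    rw [h1, gaugeInv, fuchsSeq, sub_add_cancel]
  have h3 : ζ⁻¹ • (R * seriesSum (gaugeInv R N) ζ - seriesSum (gaugeInv R N) ζ * R) =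
      R * seriesSum (fun n => gaugeInv R N (n + 1)) ζ -
        seriesSum (fun n => gaugeInv R N (n + 1)) ζ * R := by
    rw [h2, mul_add, add_mul, mul_one, one_mul, add_sub_add_right_eq_sub, mul_smul_comm,
      smul_mul_assoc, ← smul_sub, inv_smul_smul₀ h0]
  rw [h3]
  exact h.hasDerivAt_gaugeInv hN hζ

theorem NonResonant.gauge_mul_gaugeInv_apply (h : NonResonant E m R) (hN : ConvOn r N)
    (hζ : ‖ζ‖ < r) : seriesSum (gauge R N) ζ * seriesSum (gaugeInv R N) ζ = 1 := by
  refine ((h.convOn_gauge hN).hasSum_cauchy (h.convOn_gaugeInv hN) hζ).unique ?_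
  have h1 : ∀ n, cauchy (gauge R N) (gaugeInv R N) n = if n = 0 then 1 else 0 := fun n => by
    rw [cauchy_eq_coeff, h.gauge_mul_gaugeInv, PowerSeries.coeff_one]
  have h2 := hasSum_single (f := fun n => ζ ^ n • cauchy (gauge R N) (gaugeInv R N) n) 0
    fun n hn => by rw [h1, if_neg hn, smul_zero]
  rwa [h1, if_pos rfl, pow_zero, one_smul] at h2

theorem hasDerivAt_exp_comp_smul {f : ℂ → ℂ} {f' : ℂ} (hf : HasDerivAt f f' ζ) (R : A) :
    HasDerivAt (fun z => NormedSpace.exp (f z • R)) (f' • (R * NormedSpace.exp (f ζ • R))) ζ :=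
  HasDerivAt.scomp ζ (hasDerivAt_exp_smul_const' (𝕂 := ℂ) R (f ζ)) hf

theorem differentiableOn_smul_deriv {H : ℂ → A} {U : Set ℂ} (hH : DifferentiableOn ℂ H U)
    (hU : IsOpen U) (k : ℂ) (R : A) :
    DifferentiableOn ℂ (fun ζ => ζ • deriv H ζ - k • H ζ + H ζ * R) U :=
  ((differentiableOn_id.smul (hH.deriv hU)).sub (hH.const_smul k)).add (hH.mul_const R)

end Gauge

theorem eventually_eq_of_hasDerivAt_zero {V : Type*} [NormedAddCommGroup V] [NormedSpace ℂ V]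
    {w : ℂ → V} {x : ℂ} (h : ∀ᶠ z in 𝓝 x, HasDerivAt w 0 z) : ∀ᶠ z in 𝓝 x, w z = w x := by
  obtain ⟨ε, hε, hb⟩ := Metric.eventually_nhds_iff_ball.1 h
  filter_upwards [Metric.ball_mem_nhds x hε] with z hz
  exact Metric.isOpen_ball.is_const_of_deriv_eq_zero (convex_ball x ε).isPreconnected
    (fun y hy => (hb y hy).differentiableAt.differentiableWithinAt) (fun y hy => (hb y hy).deriv)
    hz (Metric.mem_ball_self hε)

/-! ## Linear differential equations in a Banach space -/

section Local

variable {X : Type*} [NormedAddCommGroup X] [NormedSpace ℂ X]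

/-- The germ of `u` at `ξ` solves `u' = M u`. -/
def IsSol (M : ℂ → X →L[ℂ] X) (u : ℂ → X) (ξ : ℂ) : Prop :=
  ∀ᶠ z in 𝓝 ξ, HasDerivAt u (M z (u z)) z

variable [CompleteSpace X] {M : ℂ → X →L[ℂ] X} {R : X →L[ℂ] X} {N : ℕ → X →L[ℂ] X} {ω : ℂ}
  {r : ℝ} {E : Finset ℂ} {m : ℕ}

theorem IsSol.analyticAt {u : ℂ → X} {ξ : ℂ} (h : IsSol M u ξ) : AnalyticAt ℂ u ξ := by
  obtain ⟨ε, hε, hb⟩ := Metric.eventually_nhds_iff_ball.1 h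
  exact DifferentiableOn.analyticAt (s := Metric.ball ξ ε)
    (fun y hy => (hb y hy).differentiableAt.differentiableWithinAt) (Metric.ball_mem_nhds ξ hε)

/-- If `R c = 0`, then `exp(R ln ζ) c = c`: such vectors give the solutions that are holomorphic at
the singular point. -/
theorem hasDerivAt_gauge_apply (h : NonResonant E m R) (hN : ConvOn r N) {c : X} (hc : R c = 0)
    {ζ : ℂ} (hζ : ‖ζ‖ < r) : HasDerivAt (fun z => seriesSum (gauge R N) z c)
      (R (seriesSum (fun n => gauge R N (n + 1)) ζ c) +
        seriesSum N ζ (seriesSum (gauge R N) ζ c)) ζ := by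
  have := (h.hasDerivAt_gauge hN hζ).clm_apply (hasDerivAt_const ζ c)
  simpa [hc] using this

theorem hasDerivAt_gauge_apply' (h : NonResonant E m R) (hN : ConvOn r N) {c : X} (hc : R c = 0)
    {ζ : ℂ} (hζ : ‖ζ‖ < r) (h0 : ζ ≠ 0) : HasDerivAt (fun z => seriesSum (gauge R N) z c)
      ((ζ⁻¹ • R + seriesSum N ζ) (seriesSum (gauge R N) ζ c)) ζ := by
  have h1 := (h.convOn_gauge hN).smul_seriesSum_succ hζ
  have h2 : seriesSum (gauge R N) ζ = ζ • seriesSum (fun n => gauge R N (n + 1)) ζ + 1 := by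
    rw [h1, gauge, fuchsSeq, sub_add_cancel]
  have h3 : (ζ⁻¹ • R) (seriesSum (gauge R N) ζ c) =
      R (seriesSum (fun n => gauge R N (n + 1)) ζ c) := by
    rw [h2]
    simp [hc, h0]
  rw [add_apply, h3]
  exact hasDerivAt_gauge_apply h hN hc hζ

/-- Germs of solutions extend to the largest disc where the equation is regular. -/
theorem exists_isSol_ball (hN : ConvOn r N)
    (hM : ∀ ζ, ‖ζ‖ < r → M (ω + ζ) = seriesSum N ζ) {ξ₀ : ℂ} (hξ : ξ₀ ∈ Metric.ball ω r)
    {u : ℂ → X} (hu : IsSol M u ξ₀) :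
    ∃ U : ℂ → X, (∀ ξ ∈ Metric.ball ω r, IsSol M U ξ) ∧ U =ᶠ[𝓝 ξ₀] u := by
  -- A regular point is the case `R = 0` of the gauge transformation, which converges on the whole
  -- disc.
  have h0 : NonResonant {0} 1 (0 : X →L[ℂ] X) := NonResonant.zero
  have hM' : ∀ ξ ∈ Metric.ball ω r, M ξ = seriesSum N (ξ - ω) := fun ξ hξ => by
    rw [← hM _ (by simpa [dist_eq_norm] using hξ), add_sub_cancel]
  have hball : ∀ᶠ z in 𝓝 ξ₀, z ∈ Metric.ball ω r := Metric.isOpen_ball.mem_nhds hξ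
  have hw : ∀ᶠ z in 𝓝 ξ₀,
      HasDerivAt (fun z => seriesSum (gaugeInv (0 : X →L[ℂ] X) N) (z - ω) (u z)) 0 z := by
    filter_upwards [hu, hball] with z hz hzb
    have hzr : ‖z - ω‖ < r := by simpa [dist_eq_norm] using hzb
    have h1 := (h0.hasDerivAt_gaugeInv hN hzr).comp_sub_const z ω
    have h2 := h1.clm_apply hz
    rw [hM' z hzb] at h2
    simpa using h2
  have hc := eventually_eq_of_hasDerivAt_zero hw
  set c := seriesSum (gaugeInv (0 : X →L[ℂ] X) N) (ξ₀ - ω) (u ξ₀)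
  refine ⟨fun z => seriesSum (gauge (0 : X →L[ℂ] X) N) (z - ω) c, fun ξ hξ => ?_, ?_⟩
  · filter_upwards [Metric.isOpen_ball.mem_nhds hξ] with z hz
    have hzr : ‖z - ω‖ < r := by simpa [dist_eq_norm] using hz
    rw [hM' z hz]
    have := (hasDerivAt_gauge_apply h0 hN (c := c) rfl hzr).comp_sub_const z ω
    simpa using this
  · filter_upwards [hc, hball] with z hz hzb
    have hzr : ‖z - ω‖ < r := by simpa [dist_eq_norm] using hzb
    have := congrArg (fun f => f (u z)) (h0.gauge_mul_gaugeInv_apply hN hzr)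
    simp only [mul_apply_eq_comp, one_apply_eq_self] at this
    rw [← hz, this]

theorem hasDerivAt_log_of_exp_eq {ln : ℂ → ℂ} {ζ₀ : ℂ} (h : AnalyticAt ℂ ln ζ₀)
    (h' : ∀ᶠ ζ in 𝓝 ζ₀, Complex.exp (ln ζ) = ζ) : ∀ᶠ ζ in 𝓝 ζ₀, HasDerivAt ln ζ⁻¹ ζ := by
  filter_upwards [h.eventually_analyticAt, h'.eventually_nhds] with ζ ha he
  have h1 := ha.differentiableAt.hasDerivAt
  have h2 : HasDerivAt (fun ζ => Complex.exp (ln ζ)) 1 ζ :=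
    (hasDerivAt_id ζ).congr_of_eventuallyEq he
  have h3 := h1.cexp.unique h2
  rw [he.self_of_nhds] at h3
  rwa [← eq_inv_of_mul_eq_one_right h3]

/-- Near a nonresonant regular singular point every solution has the form `P(ζ) exp(R ln ζ) c`. -/
theorem exists_eq_gauge_exp (h : NonResonant E m R) (hN : ConvOn r N)
    (hM : ∀ ζ, ‖ζ‖ < r → ζ ≠ 0 → M (ω + ζ) = ζ⁻¹ • R + seriesSum N ζ) {ζ₀ : ℂ}
    (hζ : ‖ζ₀‖ < r) (h0 : ζ₀ ≠ 0) {u : ℂ → X} (hu : IsSol M u (ω + ζ₀)) {ln : ℂ → ℂ}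
    (hln : ∀ᶠ ζ in 𝓝 ζ₀, HasDerivAt ln ζ⁻¹ ζ) :
    ∃ c, ∀ᶠ ζ in 𝓝 ζ₀,
      u (ω + ζ) = (seriesSum (gauge R N) ζ * NormedSpace.exp (ln ζ • R)) c := by
  have hball : ∀ᶠ ζ in 𝓝 ζ₀, ‖ζ‖ < r := by
    filter_upwards [Metric.isOpen_ball.mem_nhds (mem_ball_zero_iff.2 hζ)] with ζ h
    exact mem_ball_zero_iff.1 h
  have hu' : ∀ᶠ ζ in 𝓝 ζ₀, HasDerivAt u (M (ω + ζ) (u (ω + ζ))) (ω + ζ) :=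
    (continuous_const.add continuous_id).continuousAt.eventually hu
  -- Variation of constants: the inverse transformation makes the solution locally constant, with
  -- value the required `c`.
  have hw : ∀ᶠ ζ in 𝓝 ζ₀, HasDerivAt (fun ζ => (NormedSpace.exp ((-ln ζ) • R) *
      seriesSum (gaugeInv R N) ζ) (u (ω + ζ))) 0 ζ := by
    filter_upwards [hu', hball, hln, eventually_ne_nhds h0] with ζ hz hzr hl hne
    have h1 := h.hasDerivAt_gaugeInv' hN hzr hne
    have h2 := hasDerivAt_exp_comp_smul hl.neg R
    have h3 := (h2.mul h1).clm_apply (hz.comp_const_add ω ζ)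
    refine h3.congr_deriv ?_
    rw [hM ζ hzr hne]
    have hcomm : R * NormedSpace.exp (-ln ζ • R) = NormedSpace.exp (-ln ζ • R) * R :=
      (((Commute.refl R).smul_right (-ln ζ)).exp_right).eq
    have h4 := congrArg (fun f => f (u (ω + ζ))) (neg_smul_mul_add_eq
      (Q := seriesSum (gaugeInv R N) ζ) (n := seriesSum N ζ) hcomm ζ⁻¹)
    refine (congrArg (fun x => x + _) h4).trans ?_
    rw [neg_apply]
    exact neg_add_cancel _
  have hc := eventually_eq_of_hasDerivAt_zero hw
  refine ⟨(NormedSpace.exp (-ln ζ₀ • R) * seriesSum (gaugeInv R N) ζ₀) (u (ω + ζ₀)), ?_⟩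
  · filter_upwards [hc, hball] with ζ hz hzr
    rw [← hz]
    have h1 : NormedSpace.exp (ln ζ • R) * NormedSpace.exp (-ln ζ • R) = 1 := by
      let +nondep : NormedAlgebra ℚ (X →L[ℂ] X) := .restrictScalars ℚ ℂ _
      rw [← NormedSpace.exp_add_of_commute (((Commute.refl R).smul_right _).smul_left _),
        ← add_smul, add_neg_cancel, zero_smul, NormedSpace.exp_zero]
    have h2 : seriesSum (gauge R N) ζ * NormedSpace.exp (ln ζ • R) *
        (NormedSpace.exp (-ln ζ • R) * seriesSum (gaugeInv R N) ζ) = 1 := by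
      rw [mul_assoc, ← mul_assoc (NormedSpace.exp (ln ζ • R)), h1, one_mul,
        h.gauge_mul_gaugeInv_apply hN hzr]
    have := congrArg (fun f => f (u (ω + ζ))) h2
    simp only [one_apply_eq_self] at this
    exact this.symm

/-- Differentiating `exp(R ln ζ)` brings out `ζ⁻¹ R`, so each derivative costs one factor `ζ⁻¹` and
replaces `H` by `ζ H' - k H + H R`. -/
theorem exists_iterate_deriv_eq {P : ℂ → X →L[ℂ] X} (hP : DifferentiableOn ℂ P (Metric.ball 0 r))
    {ζ₀ : ℂ} (hζ : ‖ζ₀‖ < r) (h0 : ζ₀ ≠ 0) {ln : ℂ → ℂ}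
    (hln : ∀ᶠ ζ in 𝓝 ζ₀, HasDerivAt ln ζ⁻¹ ζ) (ℓ : X →L[ℂ] ℂ) {f : ℂ → ℂ} {c : X}
    (hf : ∀ᶠ ζ in 𝓝 ζ₀, f (ω + ζ) = ℓ ((P ζ * NormedSpace.exp (ln ζ • R)) c)) (k : ℕ) :
    ∃ H : ℂ → X →L[ℂ] X, DifferentiableOn ℂ H (Metric.ball 0 r) ∧
      ∀ᶠ ζ in 𝓝 ζ₀, deriv^[k] f (ω + ζ) =
        (ζ ^ k)⁻¹ * ℓ ((H ζ * NormedSpace.exp (ln ζ • R)) c) := by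
  induction k with
  | zero => exact ⟨P, hP, by simpa using hf⟩
  | succ k ih =>
    obtain ⟨H, hH, he⟩ := ih
    refine ⟨fun ζ => ζ • deriv H ζ - (k : ℂ) • H ζ + H ζ * R, ?_, ?_⟩
    · exact differentiableOn_smul_deriv hH Metric.isOpen_ball k R
    · have hball : ∀ᶠ ζ in 𝓝 ζ₀, ζ ∈ Metric.ball (0 : ℂ) r :=
        Metric.isOpen_ball.mem_nhds (mem_ball_zero_iff.2 hζ)
      filter_upwards [he.eventually_nhds, hball, hln, eventually_ne_nhds h0] with ζ hz hzr hl hne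
      rw [Function.iterate_succ_apply', ← deriv_comp_const_add, EventuallyEq.deriv_eq hz]
      have h1 : HasDerivAt H (deriv H ζ) ζ :=
        (hH.differentiableAt (Metric.isOpen_ball.mem_nhds hzr)).hasDerivAt
      have h2 := (h1.mul (hasDerivAt_exp_comp_smul hl R)).clm_apply (hasDerivAt_const ζ c)
      have h3 := ℓ.hasFDerivAt.comp_hasDerivAt ζ h2
      have h4 := ((hasDerivAt_pow k ζ).inv (pow_ne_zero k hne)).mul h3
      refine h4.deriv.trans ?_
      simp only [Function.comp_apply, Pi.inv_apply, Pi.mul_apply, mul_apply_eq_comp, add_apply,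
        smul_apply, sub_apply, map_add, map_sub, map_smul,
        smul_eq_mul, map_zero, add_zero]
      rcases k with _ | k
      · simp
        field_simp
      · simp only [Nat.add_sub_cancel, pow_succ]
        field_simp
        push_cast
        ring

/-- Dividing by `ζ₀` moves the point to `1`, away from the cut of the principal logarithm. -/
theorem exists_log_branch {ζ₀ : ℂ} (h : ζ₀ ≠ 0) :
    ∃ ln : ℂ → ℂ, AnalyticAt ℂ ln ζ₀ ∧ ∀ᶠ ζ in 𝓝 ζ₀, Complex.exp (ln ζ) = ζ := by
  refine ⟨fun ζ => Complex.log (ζ / ζ₀) + Complex.log ζ₀, ?_, ?_⟩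
  · refine AnalyticAt.add (AnalyticAt.clog (by fun_prop) ?_) analyticAt_const
    rw [div_self h]
    exact Complex.one_mem_slitPlane
  · filter_upwards [eventually_ne_nhds h] with ζ hζ
    rw [Complex.exp_add, Complex.exp_log (div_ne_zero hζ h), Complex.exp_log h, div_mul_cancel₀ _ h]

/-- At a nonresonant regular singular point, the derivatives of solutions have the moderate form. -/
theorem hasModerateForm_of_isSol (h : NonResonant E m R) (hE : ∀ μ ∈ E, 0 ≤ μ.re ∧ μ.re < 1)
    (hN : ConvOn r N) (hM : ∀ ζ, ‖ζ‖ < r → ζ ≠ 0 → M (ω + ζ) = ζ⁻¹ • R + seriesSum N ζ) {ξ₀ : ℂ}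
    (hξ : ξ₀ ∈ Metric.ball ω r) (h0 : ξ₀ ≠ ω) {u : ℂ → X} (hu : IsSol M u ξ₀) (ℓ : X →L[ℂ] ℂ)
    (k : ℕ) : HasModerateForm k ω r ξ₀ (deriv^[k] fun z => ℓ (u z)) := by
  have h0' : ξ₀ - ω ≠ 0 := sub_ne_zero.2 h0
  have hζ : ‖ξ₀ - ω‖ < r := by simpa [dist_eq_norm] using hξ
  obtain ⟨ln, hln, hexp⟩ := exists_log_branch h0'
  have hl := hasDerivAt_log_of_exp_eq hln hexp
  obtain ⟨c, hc⟩ := exists_eq_gauge_exp h hN hM hζ h0' (by rwa [add_sub_cancel]) hl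
  obtain ⟨H, hH, he⟩ := exists_iterate_deriv_eq (R := R) (ω := ω) (f := fun z => ℓ (u z))
    (h.convOn_gauge hN).differentiableOn hζ h0' hl ℓ (c := c)
    (by filter_upwards [hc] with ζ hz; rw [hz]) k
  obtain ⟨a, ha⟩ := exp_smul_eq_sum h.aeval_eq_zero
  refine ⟨E, m, fun μ p ζ => ℓ (H ζ (a μ p c)), ln, hE, fun μ _ p _ => ?_, hln, hexp, ?_⟩
  · exact ℓ.differentiable.comp_differentiableOn
      (hH.clm_apply (differentiableOn_const (a μ p c)))
  · filter_upwards [he, hexp] with ζ hz hx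
    rw [hz, ha, Finset.mul_sum]
    simp only [Finset.mul_sum, sum_apply, map_sum, mul_smul_comm,
      smul_apply, map_smul, smul_eq_mul, mul_apply_eq_comp]
    refine Finset.sum_congr rfl fun μ _ => Finset.sum_congr rfl fun p _ => ?_
    -- The `k` factors `ζ⁻¹` due to the derivatives become the shift of exponents from `μ` to `μ -
    -- k`.
    have h1 : (ζ ^ k)⁻¹ = Complex.exp (-(k : ℂ) * ln ζ) := by
      rw [neg_mul, Complex.exp_neg, Complex.exp_nat_mul, hx]
    rw [h1, sub_mul, sub_eq_add_neg, Complex.exp_add, neg_mul]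
    ring

end Local

/-! ## Analytic continuation along paths -/

/-- The path is subdivided so that each piece lies in the initial disc or in a disc where every
solution germ extends; the germ at the left end of a piece is then extended over it. The equation
may be singular at `0`, so time `0` is treated apart. -/
theorem exists_continuation {X : Type*} [NormedAddCommGroup X] [NormedSpace ℂ X]
    {M : ℂ → X →L[ℂ] X} {S : Finset ℂ} (h0S : (0 : ℂ) ∈ S)
    (hext : ∀ ω ∉ S, ∃ r > 0, ∀ ξ₀ ∈ Metric.ball ω r, ∀ u : ℂ → X, IsSol M u ξ₀ →
      ∃ U : ℂ → X, (∀ ξ ∈ Metric.ball ω r, IsSol M U ξ) ∧ U =ᶠ[𝓝 ξ₀] u)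
    {U₀ : ℂ → X} {δ : ℝ} (hδ : 0 < δ) (hU₀ : ∀ ξ ∈ Metric.ball 0 δ, ξ ≠ 0 → IsSol M U₀ ξ)
    {γ : C(unitInterval, ℂ)} (hγ : Admissible S γ) :
    ∃ g : unitInterval → ℂ → X, g 0 = U₀ ∧ (∀ t, t ≠ 0 → IsSol M (g t) (γ t)) ∧
      ∀ t, ∀ᶠ s in 𝓝 t, g s =ᶠ[𝓝 (γ s)] g t := by
  classical
  have hne : ∀ t, t ≠ 0 → γ t ≠ 0 := fun t ht h => hγ.2 t ht (h ▸ h0S)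
  obtain ⟨ε, hε, hεb⟩ : ∃ ε > 0, ∀ s : unitInterval, (s : ℝ) < ε → γ s ∈ Metric.ball (0 : ℂ) δ := by
    have : ∀ᶠ s in 𝓝 (0 : unitInterval), γ s ∈ Metric.ball (0 : ℂ) δ :=
      γ.continuous.continuousAt.eventually_mem (Metric.isOpen_ball.mem_nhds (by simp [hγ.1, hδ]))
    obtain ⟨ε, hε, h⟩ := Metric.eventually_nhds_iff.1 this
    refine ⟨ε, hε, fun s hs => h ?_⟩
    rw [Subtype.dist_eq, Real.dist_eq]
    simpa [abs_of_nonneg s.2.1] using hs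
  choose r hr hrU using fun t : {t : unitInterval // t ≠ 0} => hext (γ t) (hγ.2 t t.2)
  -- Time `0` is removed from the later pieces, so that at their left end the germ already solves
  -- the equation.
  let c : Option {t : unitInterval // t ≠ 0} → Set unitInterval := fun i => match i with
    | none => {s | (s : ℝ) < ε}
    | some t => γ ⁻¹' Metric.ball (γ t) (r t) ∩ {0}ᶜ
  have hc1 : ∀ i, IsOpen (c i) := by
    rintro (_ | t)
    · exact isOpen_lt continuous_subtype_val continuous_const
    · exact (Metric.isOpen_ball.preimage γ.continuous).inter isOpen_compl_singleton
  have hc2 : Set.univ ⊆ ⋃ i, c i := by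
    intro t _
    rw [Set.mem_iUnion]
    by_cases ht : t = 0
    · exact ⟨none, by simp [c, ht, hε]⟩
    · exact ⟨some ⟨t, ht⟩, Metric.mem_ball_self (hr _), ht⟩
  obtain ⟨t, ht0, htm, ⟨n₁, hn₁⟩, htc⟩ :=
    exists_monotone_Icc_subset_open_cover_unitInterval hc1 hc2
  have key : ∀ n, ∃ g : unitInterval → ℂ → X, g 0 = U₀ ∧
      (∀ s ≤ t n, s ≠ 0 → IsSol M (g s) (γ s)) ∧
      ∀ s ≤ t n, ∀ᶠ s' in 𝓝 s, s' ≤ t n → g s' =ᶠ[𝓝 (γ s')] g s := by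
    -- As long as the subdivision stays in the initial disc, the constant family `U₀` serves.
    have hstart : ∀ n, (t n : ℝ) < ε → ∃ g : unitInterval → ℂ → X, g 0 = U₀ ∧
      (∀ s ≤ t n, s ≠ 0 → IsSol M (g s) (γ s)) ∧
      ∀ s ≤ t n, ∀ᶠ s' in 𝓝 s, s' ≤ t n → g s' =ᶠ[𝓝 (γ s')] g s := fun n hn =>
      ⟨fun _ => U₀, rfl, fun s hs h0 => hU₀ _ (hεb s (lt_of_le_of_lt hs hn)) (hne s h0),
        fun s _ => Eventually.of_forall fun s' _ => EventuallyEq.rfl⟩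
    intro n
    induction n with
    | zero => exact hstart 0 (by simpa [ht0] using hε)
    | succ n ih =>
      obtain ⟨g, hg0, hgs, hgc⟩ := ih
      obtain ⟨i, hi⟩ := htc n
      have hle : t n ≤ t (n + 1) := htm n.le_succ
      rcases i with _ | τ
      · exact hstart (n + 1) (hi ⟨hle, le_rfl⟩)
      obtain ⟨hnb, hn0⟩ := hi (Set.left_mem_Icc.2 hle)
      obtain ⟨U, hU, hUe⟩ := hrU τ _ hnb _ (hgs (t n) le_rfl hn0)
      refine ⟨fun s => if s ≤ t n then g s else U, by simp [hg0], ?_, ?_⟩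
      · intro s hs hs0
        by_cases hsn : s ≤ t n
        · simpa only [if_pos hsn] using hgs s hsn hs0
        · simpa only [if_neg hsn] using hU _ (hi ⟨(not_le.1 hsn).le, hs⟩).1
      · intro s hs
        rcases lt_trichotomy s (t n) with hsn | rfl | hsn
        · filter_upwards [hgc s hsn.le, eventually_lt_nhds hsn] with s' h1 h2 _
          simpa only [if_pos hsn.le, if_pos h2.le] using h1 h2.le
        · have h1 : ∀ᶠ s' in 𝓝 (t n), U =ᶠ[𝓝 (γ s')] g (t n) :=
            γ.continuous.continuousAt.eventually hUe.eventually_nhds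
          filter_upwards [hgc (t n) le_rfl, h1] with s' h2 h3 _
          by_cases hs' : s' ≤ t n
          · simpa only [if_pos hs', if_pos le_rfl] using h2 hs'
          · simpa only [if_neg hs', if_pos le_rfl] using h3
        · filter_upwards [eventually_gt_nhds hsn] with s' h1 _
          simp only [if_neg (not_le.2 hsn), if_neg (not_le.2 h1)]
          exact EventuallyEq.rfl
  obtain ⟨g, hg0, hgs, hgc⟩ := key n₁
  have h1 : ∀ s, s ≤ t n₁ := fun s => by rw [hn₁ n₁ le_rfl]; exact unitInterval.le_one'
  exact ⟨g, hg0, fun s => hgs s (h1 s), fun s => (hgc s (h1 s)).mono fun s' h => h (h1 s')⟩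

/-- By the identity theorem on a small ball, agreement of the two germs is locally constant along
the path, so the set of times of agreement is open and closed. -/
theorem IsContinuation.eventuallyEq {γ : C(unitInterval, ℂ)} {g g' : unitInterval → ℂ → ℂ}
    (hg : IsContinuation γ g) (hg' : IsContinuation γ g') (h0 : g 0 =ᶠ[𝓝 (γ 0)] g' 0)
    (t : unitInterval) : g t =ᶠ[𝓝 (γ t)] g' t := by
  set s : Set unitInterval := {t | g t =ᶠ[𝓝 (γ t)] g' t}
  have hev : ∀ t, ∀ᶠ t' in 𝓝 t, (t' ∈ s ↔ t ∈ s) := by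
    intro t
    obtain ⟨ε, hε, hb⟩ := Metric.eventually_nhds_iff_ball.1
      ((hg.1 t).eventually_analyticAt.and (hg'.1 t).eventually_analyticAt)
    filter_upwards [hg.2 t, hg'.2 t, γ.continuous.continuousAt.eventually_mem
      (Metric.ball_mem_nhds (γ t) hε)] with t' h1 h2 h3
    have hid : ∀ x ∈ Metric.ball (γ t) ε, g t =ᶠ[𝓝 x] g' t → ∀ y ∈ Metric.ball (γ t) ε,
        g t =ᶠ[𝓝 y] g' t := fun x hx hxe y hy => by
      have := AnalyticOnNhd.eqOn_of_preconnected_of_eventuallyEq (fun z hz => (hb z hz).1)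
        (fun z hz => (hb z hz).2) (convex_ball (γ t) ε).isPreconnected hx hxe
      exact this.eventuallyEq_of_mem (Metric.isOpen_ball.mem_nhds hy)
    constructor
    · intro h
      exact hid _ h3 (h1.symm.trans (h.trans h2)) _ (Metric.mem_ball_self hε)
    · intro h
      exact h1.trans ((hid _ (Metric.mem_ball_self hε) h _ h3).trans h2.symm)
  have hclopen : IsClopen s := by
    refine ⟨⟨isOpen_iff_mem_nhds.2 fun t ht => ?_⟩, isOpen_iff_mem_nhds.2 fun t ht => ?_⟩
    · filter_upwards [hev t] with t' h h' using ht (h.1 h')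
    · filter_upwards [hev t] with t' h using h.2 ht
  have := hclopen.eq_univ ⟨0, h0⟩
  exact this.ge (Set.mem_univ t)

theorem IsSum.eventuallyEq {φ : PowerSeries ℂ} {F G : ℂ → ℂ} (hF : IsSum φ F) (hG : IsSum φ G) :
    F =ᶠ[𝓝 0] G := by
  obtain ⟨r, hr⟩ := hF
  obtain ⟨s, hs⟩ := hG
  have h := hr.mono (lt_min hr.r_pos hs.r_pos) (min_le_left r s)
  have h' := hs.mono (lt_min hr.r_pos hs.r_pos) (min_le_right r s)
  filter_upwards [Metric.eball_mem_nhds (0 : ℂ) (lt_min hr.r_pos hs.r_pos)] with z hz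
  exact h.unique h' hz

theorem HasModerateForm.congr {m : ℕ} {ω : ℂ} {R : ℝ} {ξ₀ : ℂ} {F G : ℂ → ℂ}
    (h : HasModerateForm m ω R ξ₀ F) (hFG : G =ᶠ[𝓝 ξ₀] F) : HasModerateForm m ω R ξ₀ G := by
  obtain ⟨E, M, a, ln, h1, h2, h3, h4, h5⟩ := h
  refine ⟨E, M, a, ln, h1, h2, h3, h4, ?_⟩
  have : Tendsto (fun ζ => ω + ζ) (𝓝 (ξ₀ - ω)) (𝓝 ξ₀) := by
    have : Continuous fun ζ : ℂ => ω + ζ := by fun_prop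
    simpa using this.tendsto (ξ₀ - ω)
  filter_upwards [h5, this.eventually hFG] with ζ ha hb
  rw [hb, ha]

theorem isSum_iff {φ : PowerSeries ℂ} {F : ℂ → ℂ} :
    IsSum φ F ↔ ∀ᶠ z in 𝓝 0, HasSum (fun n => z ^ n • PowerSeries.coeff n φ) (F z) := by
  rw [IsSum, hasFPowerSeriesAt_iff]
  simp only [FormalMultilinearSeries.coeff_ofScalars, zero_add]

theorem isSum_seriesSum {φ : PowerSeries ℂ} {r : ℝ} (hr : 0 < r)
    (h : ConvOn r fun n => PowerSeries.coeff n φ) :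
    IsSum φ (seriesSum fun n => PowerSeries.coeff n φ) := by
  rw [isSum_iff]
  filter_upwards [Metric.ball_mem_nhds (0 : ℂ) hr] with z hz
  exact h.hasSum (mem_ball_zero_iff.1 hz)

theorem IsSum.deriv {φ : PowerSeries ℂ} {F : ℂ → ℂ} (h : IsSum φ F) :
    IsSum (PowerSeries.derivative ℂ φ) (deriv F) := by
  obtain ⟨ε, hε, hb⟩ := Metric.eventually_nhds_iff_ball.1 (isSum_iff.1 h)
  have hc : ConvOn ε fun n => PowerSeries.coeff n φ := by
    intro σ h0 hσ
    have := (hb (σ : ℂ) (by simp [abs_of_nonneg h0, hσ])).summable.norm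
    refine this.congr fun n => ?_
    simp [abs_of_nonneg h0, mul_comm]
  have he : F =ᶠ[𝓝 0] seriesSum fun n => PowerSeries.coeff n φ :=
    h.eventuallyEq (isSum_seriesSum hε hc)
  rw [isSum_iff]
  filter_upwards [Metric.ball_mem_nhds (0 : ℂ) hε, he.eventuallyEq_nhds] with z hz hez
  rw [hez.deriv_eq]
  refine (hc.hasSum_deriv (mem_ball_zero_iff.1 hz)).congr_fun fun n => ?_
  rw [PowerSeries.coeff_derivative, smul_eq_mul, smul_eq_mul, smul_eq_mul,
    mul_comm ((n : ℂ) + 1)]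

theorem IsSum.iterate_deriv {φ : PowerSeries ℂ} {F : ℂ → ℂ} (h : IsSum φ F) (k : ℕ) :
    IsSum ((PowerSeries.derivative ℂ)^[k] φ) (_root_.deriv^[k] F) := by
  induction k with
  | zero => exact h
  | succ k ih =>
    rw [Function.iterate_succ_apply', Function.iterate_succ_apply']
    exact ih.deriv

theorem EventuallyEq.iterate_deriv {F G : ℂ → ℂ} {x : ℂ} (h : F =ᶠ[𝓝 x] G) (k : ℕ) :
    deriv^[k] F =ᶠ[𝓝 x] deriv^[k] G := by
  induction k with
  | zero => exact h
  | succ k ih =>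
    rw [Function.iterate_succ_apply', Function.iterate_succ_apply']
    exact ih.deriv

/-! ## Singularities of solutions of Fuchsian equations in a Banach space -/

/-- The equation `u' = M u` has at `ω` a nonresonant singularity of the first kind, or is regular,
on every punctured disc around `ω` avoiding `S`. -/
def IsFuchsAt {X : Type*} [NormedAddCommGroup X] [NormedSpace ℂ X] (M : ℂ → X →L[ℂ] X)
    (S E : Finset ℂ) (m : ℕ) (ω : ℂ) (R : X →L[ℂ] X) (N : ℕ → X →L[ℂ] X) : Prop :=
  NonResonant E m R ∧ ∀ r : ℝ, (∀ ω' ∈ S, ω' ∈ Metric.ball ω r → ω' = ω) →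
    ConvOn r N ∧ ∀ ζ, ‖ζ‖ < r → ζ ≠ 0 → M (ω + ζ) = ζ⁻¹ • R + seriesSum N ζ

theorem exists_ball_inter_subset (S : Finset ℂ) (ω : ℂ) :
    ∃ r > 0, ∀ ω' ∈ S, ω' ∈ Metric.ball ω r → ω' = ω := by
  have h : IsClosed ((S.erase ω : Finset ℂ) : Set ℂ) := (S.erase ω).finite_toSet.isClosed
  obtain ⟨r, hr, hb⟩ := Metric.isOpen_iff.1 h.isOpen_compl ω (by simp)
  exact ⟨r, hr, fun ω' h1 h2 => by_contra fun h3 => hb h2 (Finset.mem_coe.2 (Finset.mem_erase.2 ⟨h3, h1⟩))⟩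

/-- A formal solution at the singular point `0` is given by the gauge transformation. -/
theorem gauge_apply_eq {X : Type*} [NormedAddCommGroup X] [NormedSpace ℂ X]
    {R : X →L[ℂ] X} {N : ℕ → X →L[ℂ] X} {E : Finset ℂ} {m : ℕ} (h : NonResonant E m R)
    {u : ℕ → X} (h0 : R (u 0) = 0)
    (hu : ∀ n : ℕ, ((n : ℂ) + 1) • u (n + 1) = R (u (n + 1)) +
      ∑ k ∈ Finset.range (n + 1), N k (u (n - k))) (n : ℕ) :
    gauge R N n (u 0) = u n := by
  induction n using Nat.strong_induction_on with
  | _ n ih =>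
    rcases n with _ | n
    · simp [gauge, fuchsSeq]
    -- The term ending in `R` vanishes on `u 0`, so both sequences obey the same recursion, in which
    -- `n + 1 - R` is invertible.
    have h1 := congrArg (fun f => f (u 0)) (h.gauge_succ N n)
    have h2 : cauchy N (gauge R N) n (u 0) = ∑ k ∈ Finset.range (n + 1), N k (u (n - k)) := by
      rw [cauchy, sum_apply]
      refine Finset.sum_congr rfl fun k hk => ?_
      rw [mul_apply_eq_comp, ih _ (by have := Finset.mem_range.1 hk; omega)]
    simp only [add_apply, sub_apply, smul_apply, mul_apply_eq_comp, h0, map_zero, sub_zero] at h1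
    rw [h2] at h1
    have h3 := hu n
    obtain ⟨v, hv⟩ := h.isUnit_sub n
    have h4 : (algebraMap ℂ (X →L[ℂ] X) (n + 1) - R) (gauge R N (n + 1) (u 0) - u (n + 1)) = 0 := by
      rw [Algebra.algebraMap_eq_smul_one, sub_apply, smul_apply, one_apply_eq_self, smul_sub, h1,
        h3, map_sub]
      abel
    have h5 := congrArg (fun f => (↑v⁻¹ : X →L[ℂ] X) f) h4
    rw [← hv] at h5
    simp only [map_zero] at h5
    rw [← mul_apply_eq_comp, Units.inv_mul, one_apply_eq_self] at h5
    exact sub_eq_zero.1 h5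

/-- The formal solution converges because it is the gauge transformation at `0` applied to a vector
killed by the residue. Its continuations remain solutions, whose local form at each pole is known.
-/
theorem hasModerateSingularities_of_formal_solution {X : Type*} [NormedAddCommGroup X]
    [NormedSpace ℂ X] [CompleteSpace X] {M : ℂ → X →L[ℂ] X} {S E : Finset ℂ} {m : ℕ}
    {R : ℂ → X →L[ℂ] X} {N : ℂ → ℕ → X →L[ℂ] X} (h0S : (0 : ℂ) ∈ S)
    (hE : ∀ μ ∈ E, 0 ≤ μ.re ∧ μ.re < 1)
    (hF : ∀ ω, IsFuchsAt M S E m ω (R ω) (N ω)) (hR : ∀ ω ∉ S, R ω = 0)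
    (hM : ∀ ω ∉ S, M ω = N ω 0)
    {u : ℕ → X} (hu0 : R 0 (u 0) = 0)
    (hu : ∀ n : ℕ, ((n : ℂ) + 1) • u (n + 1) = R 0 (u (n + 1)) +
      ∑ k ∈ Finset.range (n + 1), N 0 k (u (n - k))) (ℓ : X →L[ℂ] ℂ) (k : ℕ) :
    HasModerateSingularities k S
      ((PowerSeries.derivative ℂ)^[k] (PowerSeries.mk fun n => ℓ (u n))) := by
  obtain ⟨δ, hδ, hδS⟩ := exists_ball_inter_subset S 0
  obtain ⟨hnr, hN⟩ := hF 0
  obtain ⟨hN0, hM0⟩ := hN δ hδS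
  set U₀ : ℂ → X := fun z => seriesSum (gauge (R 0) (N 0)) z (u 0) with hU₀
  have hU₀s : ∀ ξ ∈ Metric.ball (0 : ℂ) δ, ξ ≠ 0 → IsSol M U₀ ξ := by
    intro ξ hξ hne
    filter_upwards [Metric.isOpen_ball.mem_nhds hξ, eventually_ne_nhds hne] with z hz hz0
    have hzr := mem_ball_zero_iff.1 hz
    have h1 := hasDerivAt_gauge_apply' hnr hN0 hu0 hzr hz0
    rwa [← hM0 z hzr hz0, zero_add] at h1
  have hsum : IsSum (PowerSeries.mk fun n => ℓ (u n)) fun z => ℓ (U₀ z) := by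
    rw [isSum_iff]
    filter_upwards [Metric.ball_mem_nhds (0 : ℂ) hδ] with z hz
    have h1 := (hnr.convOn_gauge hN0).hasSum (mem_ball_zero_iff.1 hz)
    have h2 := (h1.mapL ((ContinuousLinearMap.apply ℂ X (u 0)))).mapL ℓ
    refine h2.congr_fun fun n => ?_
    rw [PowerSeries.coeff_mk, ← gauge_apply_eq hnr hu0 hu n]
    simp
  have hext : ∀ ω ∉ S, ∃ r > 0, ∀ ξ₀ ∈ Metric.ball ω r, ∀ u : ℂ → X, IsSol M u ξ₀ →
      ∃ U : ℂ → X, (∀ ξ ∈ Metric.ball ω r, IsSol M U ξ) ∧ U =ᶠ[𝓝 ξ₀] u := by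
    intro ω hω
    obtain ⟨r, hr, hrS⟩ := exists_ball_inter_subset S ω
    obtain ⟨hN', hM'⟩ := (hF ω).2 r hrS
    refine ⟨r, hr, fun ξ₀ hξ u hu => exists_isSol_ball hN' (fun ζ hζ => ?_) hξ hu⟩
    by_cases h0 : ζ = 0
    · rw [h0, add_zero, seriesSum_zero_arg, hM ω hω]
    · rw [hM' ζ hζ h0, hR ω hω, smul_zero, zero_add]
  have hmain : ∀ γ, Admissible S γ → ∃ g : unitInterval → ℂ → X, g 0 = U₀ ∧
      (∀ t, t ≠ 0 → IsSol M (g t) (γ t)) ∧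
      IsContinuation γ (fun t => deriv^[k] fun z => ℓ (g t z)) := by
    intro γ hγ
    obtain ⟨g, hg0, hgs, hgc⟩ := exists_continuation h0S hext hδ hU₀s hγ
    refine ⟨g, hg0, hgs, fun t => ?_, fun t => ?_⟩
    · have h1 : AnalyticAt ℂ (fun z => ℓ (g t z)) (γ t) := by
        by_cases ht : t = 0
        · rw [ht, hg0, hγ.1]
          exact hsum.analyticAt
        · exact (ℓ.analyticAt _).comp (hgs t ht).analyticAt
      exact h1.iterated_deriv k
    · filter_upwards [hgc t] with s hs
      exact EventuallyEq.iterate_deriv (hs.fun_comp ℓ) k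
  refine ⟨⟨⟨_, hsum.iterate_deriv k⟩, fun γ hγ => ?_⟩, ?_⟩
  · obtain ⟨g, hg0, -, hgc⟩ := hmain γ hγ
    refine ⟨_, hgc, ?_⟩
    simp only [hg0]
    exact hsum.iterate_deriv k
  · intro γ g' hγ hg' hsum' ω hω r hr hmem
    obtain ⟨g, hg0, hgs, hgc⟩ := hmain γ hγ
    -- Any continuation of the germ agrees with the one built from the equation, so its form at `ω`
    -- may be read there.
    have h1 := hg'.eventuallyEq hgc (by
      rw [hγ.1]
      simp only [hg0]
      exact hsum'.eventuallyEq (hsum.iterate_deriv k)) 1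
    refine HasModerateForm.congr ?_ h1
    obtain ⟨hN', hM'⟩ := (hF ω).2 r hr
    exact hasModerateForm_of_isSol (hF ω).1 hE hN' hM' hmem
      (fun h => hγ.2 1 one_ne_zero (h ▸ hω)) (hgs 1 one_ne_zero) ℓ k

/-! ## The Borel transform of a prepared system as an equation in a Banach space -/

open scoped BoundedContinuousFunction

section ConvOn

variable {V : Type*} [SeminormedAddCommGroup V] {r : ℝ}

theorem ConvOn.add {p q : ℕ → V} (hp : ConvOn r p) (hq : ConvOn r q) :
    ConvOn r fun n => p n + q n := fun σ h0 hσ =>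
  ((hp σ h0 hσ).add (hq σ h0 hσ)).of_nonneg_of_le (fun n => by positivity) fun n => by
    rw [← add_mul]
    exact mul_le_mul_of_nonneg_right (norm_add_le _ _) (by positivity)

theorem ConvOn.neg {p : ℕ → V} (hp : ConvOn r p) : ConvOn r fun n => - p n := fun σ h0 hσ => by
  simpa only [norm_neg] using hp σ h0 hσ

theorem ConvOn.sum {β : Type*} {s : Finset β} {p : β → ℕ → V} (hp : ∀ b ∈ s, ConvOn r (p b)) :
    ConvOn r fun n => ∑ b ∈ s, p b n := fun σ h0 hσ => by
  refine (summable_sum fun b hb => hp b hb σ h0 hσ).of_nonneg_of_le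
    (fun n => by positivity) fun n => ?_
  rw [← Finset.sum_mul]
  exact mul_le_mul_of_nonneg_right (norm_sum_le _ _) (by positivity)

theorem convOn_single (v : V) : ConvOn r fun n => if n = 0 then v else 0 := fun σ _ _ => by
  refine summable_of_ne_finset_zero (s := {0}) fun n hn => ?_
  simp [Finset.mem_singleton.not.1 hn]

theorem convOn_geometric [NormedSpace ℂ V] {d : ℂ} (hd : r ≤ ‖d‖) (v : V) :
    ConvOn r fun n => (d ^ (n + 1))⁻¹ • v := fun σ h0 hσ => by
  have h1 : 0 < ‖d‖ := h0.trans_lt (hσ.trans_le hd)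
  have h2 : Summable fun n : ℕ => (‖d‖⁻¹ * ‖v‖) * (σ / ‖d‖) ^ n :=
    (summable_geometric_of_lt_one (by positivity)
      ((div_lt_one h1).2 (hσ.trans_le hd))).mul_left _
  refine h2.congr fun n => ?_
  rw [norm_smul, norm_inv, norm_pow, div_pow, pow_succ]
  field_simp

theorem hasSum_geometric_smul {V : Type*} [NormedAddCommGroup V] [NormedSpace ℂ V] {d ζ : ℂ}
    (hd : ‖ζ‖ < ‖d‖) (v : V) :
    HasSum (fun n : ℕ => ζ ^ n • (d ^ (n + 1))⁻¹ • v) (-((ζ - d)⁻¹ • v)) := by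
  have hd0 : d ≠ 0 := norm_pos_iff.1 ((norm_nonneg ζ).trans_lt hd)
  have h0 : ‖ζ / d‖ < 1 := by
    rw [norm_div]
    exact (div_lt_one (norm_pos_iff.2 hd0)).2 hd
  have h1 := ((hasSum_geometric_of_norm_lt_one h0).mul_left d⁻¹).smul_const v
  have h2 : d⁻¹ * (1 - ζ / d)⁻¹ = -(ζ - d)⁻¹ := by
    rw [← mul_inv, mul_sub, mul_one, mul_div_cancel₀ _ hd0, ← inv_neg, neg_sub]
  rw [h2, neg_smul] at h1
  refine h1.congr_fun fun n => ?_
  rw [smul_smul, div_pow, pow_succ, mul_inv]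
  congr 1
  ring

end ConvOn

/-- The coefficients at `ω` of the regular part of `N₀ + ∑_{ω' ∈ S} (ξ - ω')⁻¹ R ω'`. -/
def fuchsCoeff {A : Type*} [AddCommGroup A] [Module ℂ A] (S : Finset ℂ) (N₀ : A) (R : ℂ → A) (ω : ℂ)
    (k : ℕ) : A :=
  (if k = 0 then N₀ else 0) + -∑ ω' ∈ S.erase ω, ((ω' - ω) ^ (k + 1))⁻¹ • R ω'

/-- The simple fractions with poles other than `ω` expand in geometric series, convergent up to the
nearest of these poles. Outside `S` the residue is zero, so regular points need no separate
treatment. -/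
theorem isFuchsAt_of_sum {X : Type*} [NormedAddCommGroup X] [NormedSpace ℂ X] [CompleteSpace X]
    {S E : Finset ℂ} {m : ℕ} (N₀ : X →L[ℂ] X) {R : ℂ → X →L[ℂ] X} (hR : ∀ ω ∉ S, R ω = 0) {ω : ℂ}
    (h : NonResonant E m (R ω)) :
    IsFuchsAt (fun ξ => N₀ + ∑ ω' ∈ S, (ξ - ω')⁻¹ • R ω') S E m ω (R ω) (fuchsCoeff S N₀ R ω) := by
  refine ⟨h, fun r hr => ?_⟩
  have hd : ∀ ω' ∈ S.erase ω, r ≤ ‖ω' - ω‖ := fun ω' hω' => by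
    by_contra hlt
    exact (Finset.mem_erase.1 hω').1 (hr ω' (Finset.mem_erase.1 hω').2
      (by simpa [dist_eq_norm] using hlt))
  have hc : ConvOn r (fuchsCoeff S N₀ R ω) :=
    (convOn_single N₀).add (ConvOn.sum fun ω' hω' => convOn_geometric (hd ω' hω') (R ω')).neg
  refine ⟨hc, fun ζ hζ h0 => ?_⟩
  have h1 : HasSum (fun n => ζ ^ n • fuchsCoeff S N₀ R ω n)
      (N₀ + -∑ ω' ∈ S.erase ω, -((ζ - (ω' - ω))⁻¹ • R ω')) := by
    have h2 : HasSum (fun n : ℕ => ζ ^ n • if n = 0 then N₀ else 0) N₀ := by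
      have := hasSum_single (f := fun n : ℕ => ζ ^ n • if n = 0 then N₀ else 0) 0
        fun n hn => by rw [if_neg hn, smul_zero]
      simpa using this
    refine (h2.add (hasSum_sum fun ω' hω' =>
      hasSum_geometric_smul (hζ.trans_le (hd ω' hω')) (R ω')).neg).congr_fun fun n => ?_
    rw [fuchsCoeff, smul_add, smul_neg, Finset.smul_sum]
  rw [seriesSum, h1.tsum_eq, Finset.sum_neg_distrib, neg_neg]
  have h3 : ∀ ω' ∈ S.erase ω, (ω + ζ - ω')⁻¹ • R ω' = (ζ - (ω' - ω))⁻¹ • R ω' := fun ω' _ => by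
    congr 2
    ring
  rw [← Finset.sum_congr rfl h3]
  change N₀ + ∑ ω' ∈ S, (ω + ζ - ω')⁻¹ • R ω' = _
  by_cases hω : ω ∈ S
  · rw [← Finset.add_sum_erase S _ hω, add_sub_cancel_left]
    abel
  · rw [hR ω hω, smul_zero, zero_add, Finset.erase_eq_of_notMem hω]

/-- The recursion at the origin for formal solutions of `(ξ - a) D = s`. -/
theorem eq_neg_sum_of_recursion {a : ℂ} (ha : a ≠ 0) {D s : ℕ → ℂ} (h0 : D 0 = 0)
    (h : ∀ n, D n - a * D (n + 1) = s n) (n : ℕ) :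
    D (n + 1) = -∑ k ∈ Finset.range (n + 1), (a ^ (k + 1))⁻¹ * s (n - k) := by
  induction n with
  | zero =>
    rw [Finset.sum_range_one, ← h 0, h0]
    field_simp
    simp
  | succ n ih =>
    rw [Finset.sum_range_succ']
    have h1 : ∑ k ∈ Finset.range (n + 1), (a ^ (k + 1 + 1))⁻¹ * s (n + 1 - (k + 1)) =
        a⁻¹ * ∑ k ∈ Finset.range (n + 1), (a ^ (k + 1))⁻¹ * s (n - k) := by
      rw [Finset.mul_sum]
      refine Finset.sum_congr rfl fun k _ => ?_
      rw [Nat.add_sub_add_right, pow_succ _ (k + 1), mul_inv]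
      ring
    rw [h1, ← neg_neg (∑ k ∈ Finset.range (n + 1), (a ^ (k + 1))⁻¹ * s (n - k)), ← ih,
      Nat.sub_zero, ← h (n + 1)]
    field_simp
    ring

/-! ### State space and residues of the Borel transformed system -/

section Prepared

variable {J : ℕ} {n : Fin J → ℕ}

/-- The matrix `⊕_j (lam_j I + J_{n_j})`. -/
def jordanMatrix (n : Fin J → ℕ) (lam : Fin J → ℂ) :
    Matrix (Σ j, Fin (n j)) (Σ j, Fin (n j)) ℂ :=
  Matrix.of fun i k => (if k = i then lam i.1 else 0) +
    if k.1 = i.1 ∧ (k.2 : ℕ) = i.2 + 1 then 1 else 0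

/-- The Banach space in which the Borel transform of a system is a differential equation. -/
abbrev BorelState (n : Fin J → ℕ) : Type :=
  ((Σ j, Fin (n j)) → ℂ) × (ℕ →ᵇ (((Σ j, Fin (n j)) → ℂ) × ℂ))

/-- The shift of bounded sequences. -/
def shiftCLM (W : Type*) [NormedAddCommGroup W] [NormedSpace ℂ W] : (ℕ →ᵇ W) →L[ℂ] (ℕ →ᵇ W) :=
  LinearMap.mkContinuous
    { toFun := fun b => b.compContinuous ⟨Nat.succ, continuous_of_discreteTopology⟩
      map_add' := fun _ _ => rfl
      map_smul' := fun _ _ => rfl } 1 fun b => by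
    rw [one_mul]
    exact (BoundedContinuousFunction.norm_le (norm_nonneg b)).2 fun i => b.norm_coe_le_norm _

/-- The bounded sequence of values of a bounded sequence of linear maps. -/
def seqCLM {V W : Type*} [NormedAddCommGroup V] [NormedSpace ℂ V] [NormedAddCommGroup W]
    [NormedSpace ℂ W] (c : ℕ → V →L[ℂ] W) (K : ℝ) (hc : ∀ i, ‖c i‖ ≤ K) : V →L[ℂ] (ℕ →ᵇ W) :=
  LinearMap.mkContinuous
    { toFun := fun v => BoundedContinuousFunction.ofNormedAddCommGroup (fun i => c i v)
        continuous_of_discreteTopology (K * ‖v‖) fun i => (c i).le_of_opNorm_le (hc i) v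
      map_add' := fun _ _ => by ext i; simp
      map_smul' := fun _ _ => by ext i; simp } K fun v => by
    refine (BoundedContinuousFunction.norm_le ?_).2 fun i => (c i).le_of_opNorm_le (hc i) v
    exact mul_nonneg ((norm_nonneg _).trans (hc 0)) (norm_nonneg v)

/-- The right hand side `(L - 1) φ + b₀` of the Borel transformed system. -/
def borelRhs (n : Fin J → ℕ) (lam : Fin J → ℂ) : BorelState n →L[ℂ] ((Σ j, Fin (n j)) → ℂ) :=
  (LinearMap.toContinuousLinearMap (jordanMatrix n lam - 1).mulVecLin) ∘L
      ContinuousLinearMap.fst ℂ _ _ +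
    ContinuousLinearMap.fst ℂ _ ℂ ∘L BoundedContinuousFunction.evalCLM ℂ 0 ∘L
      ContinuousLinearMap.snd ℂ _ _

/-- The residue at `ω` of the Borel transformed system. -/
def borelResidue (n : Fin J → ℕ) (lam a : Fin J → ℂ) (ω : ℂ) : BorelState n →L[ℂ] BorelState n :=
  ContinuousLinearMap.inl ℂ _ _ ∘L
    (ContinuousLinearMap.pi fun i => if a i.1 = ω then ContinuousLinearMap.proj i else 0) ∘L
      borelRhs n lam

theorem borelResidue_apply (lam a : Fin J → ℂ) (ω : ℂ) (x : BorelState n) :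
    borelResidue n lam a ω x =
      ((fun i => if a i.1 = ω then borelRhs n lam x i else 0), 0) := by
  refine Prod.ext ?_ rfl
  funext i
  by_cases h : a i.1 = ω <;> simp [borelResidue, h]

theorem borelRhs_apply (lam : Fin J → ℂ) (x : BorelState n) :
    borelRhs n lam x = (jordanMatrix n lam).mulVec x.1 - x.1 + (x.2 0).1 := by
  simp [borelRhs]

/-- The vectors of the Jordan basis. -/
def jordanVec (n : Fin J → ℕ) (j : Fin J) (s : ℕ) : (Σ j, Fin (n j)) → ℂ :=
  fun i => if i.1 = j ∧ (i.2 : ℕ) = s then 1 else 0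

theorem jordanVec_eq_single {j : Fin J} {s : ℕ} (hs : s < n j) :
    jordanVec n j s = Pi.single ⟨j, ⟨s, hs⟩⟩ 1 := by
  funext i
  rw [Pi.single_apply, jordanVec]
  refine if_congr ?_ rfl rfl
  rw [Sigma.ext_iff]
  constructor
  · rintro ⟨rfl, h⟩
    exact ⟨rfl, heq_of_eq (Fin.ext h)⟩
  · obtain ⟨i₁, i₂⟩ := i
    rintro ⟨rfl, h⟩
    exact ⟨rfl, congrArg Fin.val (eq_of_heq h)⟩

/-- On vectors of zero tail the right hand side is `L - 1`, and at `ω = a j` all rows of block `j`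
are kept: the eigenvalue is `lam j - 1`. -/
theorem borelResidue_jordanVec (lam a : Fin J → ℂ) {j : Fin J} {s : ℕ} (hs : s < n j) :
    borelResidue n lam a (a j) (jordanVec n j s, 0) =
      (lam j - 1) • ((jordanVec n j s, 0) : BorelState n) +
        (if s = 0 then 0 else (jordanVec n j (s - 1), 0)) := by
  rw [borelResidue_apply, borelRhs_apply]
  have h0 : (if s = 0 then (0 : BorelState n) else (jordanVec n j (s - 1), 0)) =
      (fun i => if i.1 = j ∧ s = (i.2 : ℕ) + 1 then 1 else 0, 0) := by
    rcases s with _ | s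
    · simp
      rfl
    · rw [if_neg s.succ_ne_zero]
      refine Prod.ext (funext fun i => ?_) rfl
      simp only [jordanVec]
      refine if_congr ?_ rfl rfl
      omega
  rw [h0]
  refine Prod.ext (funext fun i => ?_) ?_
  swap
  · refine BoundedContinuousFunction.ext fun k => ?_
    simp
  have h1 : (jordanMatrix n lam).mulVec (jordanVec n j s) i =
      (if i.1 = j ∧ (i.2 : ℕ) = s then lam j else 0) +
        if i.1 = j ∧ s = (i.2 : ℕ) + 1 then 1 else 0 := by
    have h2 := congrFun (jordanVec_eq_single hs) i
    rw [Pi.single_apply, jordanVec] at h2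
    rw [jordanVec_eq_single hs, Matrix.mulVec_single_one]
    change (if _ = i then lam i.1 else 0) + _ = _
    congr 1
    · by_cases h3 : i = ⟨j, ⟨s, hs⟩⟩
      · subst h3
        simp
      · rw [if_neg (Ne.symm h3), if_neg]
        intro h4
        rw [if_pos h4, if_neg h3] at h2
        exact one_ne_zero h2
    · refine if_congr ?_ rfl rfl
      rw [eq_comm (a := j)]
  simp only [Pi.add_apply, Pi.sub_apply, Prod.fst_add, Prod.smul_fst, Pi.smul_apply, smul_eq_mul,
    BoundedContinuousFunction.coe_zero, Pi.zero_apply, Prod.fst_zero, add_zero, h1]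
  by_cases h3 : i.1 = j
  · simp only [h3, true_and, if_true, jordanVec]
    split_ifs <;> ring
  · simp [h3, jordanVec]

/-- `L` preserves block `j`, none of whose rows is selected at `ω`. -/
theorem borelResidue_jordanVec_of_ne (lam a : Fin J → ℂ) {j : Fin J} {s : ℕ} (hs : s < n j) {ω : ℂ}
    (h : a j ≠ ω) : borelResidue n lam a ω (jordanVec n j s, 0) = 0 := by
  rw [borelResidue_apply]
  refine Prod.ext (funext fun i => ?_) rfl
  by_cases hi : a i.1 = ω
  · have hij : i.1 ≠ j := fun h' => h (h' ▸ hi)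
    have h1 : borelRhs n lam (jordanVec n j s, 0) i = 0 := by
      rw [borelRhs_apply, jordanVec_eq_single hs]
      simp only [Pi.add_apply, Pi.sub_apply, Matrix.mulVec_single_one]
      have h2 : (⟨j, ⟨s, hs⟩⟩ : Σ j, Fin (n j)) ≠ i := fun h' => hij (h' ▸ rfl)
      simp [jordanMatrix, h2, hij.symm, h2.symm]
    simp [h1]
  · simp [hi]

theorem aeval_rootPoly_apply_eq_zero {X : Type*} [NormedAddCommGroup X] [NormedSpace ℂ X]
    {T : X →L[ℂ] X} {x : X} {E : Finset ℂ} {μ : ℂ} (hμ : μ ∈ E) {k m : ℕ} (hk : k ≤ m)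
    (h : ((T - algebraMap ℂ (X →L[ℂ] X) μ) ^ k) x = 0) :
    Polynomial.aeval T (rootPoly E m) x = 0 := by
  have h1 : (T - algebraMap ℂ (X →L[ℂ] X) μ) ^ k =
      Polynomial.aeval T ((Polynomial.X - Polynomial.C μ) ^ k) := by
    rw [map_pow, map_sub, Polynomial.aeval_X, Polynomial.aeval_C]
  have h2 : rootPoly E m = (∏ ν ∈ E.erase μ, (Polynomial.X - Polynomial.C ν) ^ m) *
      (Polynomial.X - Polynomial.C μ) ^ (m - k) * (Polynomial.X - Polynomial.C μ) ^ k := by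
    rw [rootPoly, ← Finset.prod_erase_mul _ _ hμ, mul_assoc, ← pow_add, Nat.sub_add_cancel hk]
  rw [h2, map_mul, ← h1, mul_apply_eq_comp, h, map_zero]

/-- The exponents of the Borel transformed system. -/
def borelExponents (lam : Fin J → ℂ) : Finset ℂ :=
  insert 0 (Finset.univ.image fun j => lam j - 1)

theorem pow_borelResidue_jordanVec (lam a : Fin J → ℂ) {j : Fin J} (s : ℕ) (hs : s < n j) :
    ((borelResidue n lam a (a j) - algebraMap ℂ _ (lam j - 1)) ^ (s + 1))
      (jordanVec n j s, 0) = 0 := by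
  have h1 : ∀ s, s < n j → (borelResidue n lam a (a j) - algebraMap ℂ _ (lam j - 1))
      (jordanVec n j s, 0) = if s = 0 then 0 else (jordanVec n j (s - 1), 0) := fun s hs => by
    rw [sub_apply, borelResidue_jordanVec lam a hs, Algebra.algebraMap_eq_smul_one, smul_apply,
      one_apply_eq_self, add_sub_cancel_left]
  induction s with
  | zero => rw [zero_add, pow_one, h1 0 hs, if_pos rfl]
  | succ s ih =>
    rw [pow_succ, mul_apply_eq_comp, h1 _ hs, if_neg s.succ_ne_zero, Nat.add_sub_cancel]
    exact ih (by omega)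

/-- Checked on the Jordan basis: blocks with Stokes value `ω` are killed by the factor of root `lam
j - 1`, the others by the factor of root `0`. The multiplicity `∑ n j` exceeds no block. -/
theorem aeval_borelResidue_apply (lam a : Fin J → ℂ) (ω : ℂ) (w : (Σ j, Fin (n j)) → ℂ) :
    Polynomial.aeval (borelResidue n lam a ω) (rootPoly (borelExponents lam) (∑ j, n j))
      (w, 0) = 0 := by
  set q := Polynomial.aeval (borelResidue n lam a ω) (rootPoly (borelExponents lam) (∑ j, n j))
  have h : q.toLinearMap ∘ₗ LinearMap.inl ℂ _ _ = 0 := by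
    refine (Pi.basisFun ℂ _).ext fun i => ?_
    obtain ⟨j, ⟨s, hs⟩⟩ := i
    rw [Pi.basisFun_apply, ← jordanVec_eq_single hs]
    change q (jordanVec n j s, 0) = 0
    have hle : s + 1 ≤ ∑ j, n j := (Nat.succ_le_of_lt hs).trans
      (Finset.single_le_sum (f := n) (fun _ _ => Nat.zero_le _) (Finset.mem_univ j))
    by_cases hj : a j = ω
    · subst hj
      exact aeval_rootPoly_apply_eq_zero (Finset.mem_insert_of_mem
        (Finset.mem_image_of_mem _ (Finset.mem_univ j))) hle (pow_borelResidue_jordanVec lam a s hs)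
    · refine aeval_rootPoly_apply_eq_zero (Finset.mem_insert_self _ _) (k := 1) (by omega) ?_
      rw [pow_one, map_zero, sub_zero, borelResidue_jordanVec_of_ne lam a hs hj]
  exact congrArg (fun f => f w) h

theorem borelExponents_re {lam : Fin J → ℂ} (hlam : ∀ j, 1 ≤ (lam j).re ∧ (lam j).re < 2) :
    ∀ μ ∈ borelExponents lam, 0 ≤ μ.re ∧ μ.re < 1 := by
  intro μ hμ
  rcases Finset.mem_insert.1 hμ with rfl | hμ
  · simp
  · obtain ⟨j, -, rfl⟩ := Finset.mem_image.1 hμ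
    have := hlam j
    rw [Complex.sub_re, Complex.one_re]
    constructor <;> linarith

/-- Real parts in `[0, 1)` exclude positive integral differences. Although the state space is
infinite dimensional, the image of the residue lies in the finite dimensional factor. -/
theorem nonResonant_borelResidue (lam a : Fin J → ℂ) (hlam : ∀ j, 1 ≤ (lam j).re ∧ (lam j).re < 2)
    (ω : ℂ) : NonResonant (borelExponents lam) (∑ j, n j + 1) (borelResidue n lam a ω) := by
  have hE := borelExponents_re hlam
  refine ⟨?_, Finset.mem_insert_self _ _, fun μ hμ ν hν k h => ?_⟩
  -- The additional factor `X`, from the root `0`, maps every state to one of zero tail, where the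
  -- polynomial of multiplicity `∑ n j` vanishes.
  · have h1 : rootPoly (borelExponents lam) (∑ j, n j + 1) =
        (∏ ν ∈ (borelExponents lam).erase 0, (Polynomial.X - Polynomial.C ν)) *
        rootPoly (borelExponents lam) (∑ j, n j) * Polynomial.X := by
      have h2 := Finset.prod_erase_mul (borelExponents lam)
        (fun ν => Polynomial.X - Polynomial.C ν) (Finset.mem_insert_self 0 _)
      simp only [map_zero, sub_zero] at h2
      rw [mul_right_comm, h2, rootPoly, rootPoly, ← Finset.prod_mul_distrib]
      exact Finset.prod_congr rfl fun ν _ => pow_succ' _ _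
    refine ContinuousLinearMap.ext fun x => ?_
    rw [h1, map_mul, map_mul, Polynomial.aeval_X, mul_apply_eq_comp, mul_apply_eq_comp,
      borelResidue_apply, aeval_borelResidue_apply, map_zero]
    rfl
  · have h1 := congrArg Complex.re h
    have h2 := (hE μ hμ).2
    have h3 := (hE ν hν).1
    simp only [Complex.sub_re, Complex.add_re, Complex.natCast_re, Complex.one_re] at h1
    have : (0 : ℝ) ≤ k := k.cast_nonneg
    linarith

end Prepared

open scoped BoundedContinuousFunction

theorem fuchsCoeff_zero_of_notMem {A : Type*} [AddCommGroup A] [Module ℂ A] {S : Finset ℂ} {ω : ℂ}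
    (hω : ω ∉ S) (N₀ : A) (R : ℂ → A) :
    fuchsCoeff S N₀ R ω 0 = N₀ + ∑ ω' ∈ S, (ω - ω')⁻¹ • R ω' := by
  rw [fuchsCoeff, if_pos rfl, ← Finset.sum_neg_distrib, Finset.erase_eq_of_notMem hω]
  congr 1
  refine Finset.sum_congr rfl fun ω' _ => ?_
  rw [zero_add, pow_one, ← neg_sub ω ω', inv_neg, neg_smul, neg_neg]

/-! ### The formal solution of the Borel transformed system -/

section Prepared

variable {J : ℕ} {n : Fin J → ℕ}

/-- The regular part at infinity of the Borel transformed system. -/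
def borelConst (ρ : ℂ) (c : ((Σ j, Fin (n j)) → ℂ) →L[ℂ] (ℕ →ᵇ (((Σ j, Fin (n j)) → ℂ) × ℂ))) :
    BorelState n →L[ℂ] BorelState n :=
  ContinuousLinearMap.inr ℂ _ _ ∘L ((ρ • shiftCLM _) ∘L ContinuousLinearMap.snd ℂ _ _ +
    c ∘L ContinuousLinearMap.fst ℂ _ _)

theorem borelConst_apply (ρ : ℂ)
    (c : ((Σ j, Fin (n j)) → ℂ) →L[ℂ] (ℕ →ᵇ (((Σ j, Fin (n j)) → ℂ) × ℂ))) (x : BorelState n) :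
    borelConst ρ c x = (0, ρ • shiftCLM _ x.2 + c x.1) := rfl

/-- The bounded sequences of iterated integrals. -/
def borelTail (ρ : ℂ) (c : ((Σ j, Fin (n j)) → ℂ) →L[ℂ] (ℕ →ᵇ (((Σ j, Fin (n j)) → ℂ) × ℂ)))
    (φ : ℕ → (Σ j, Fin (n j)) → ℂ) : ℕ → (ℕ →ᵇ (((Σ j, Fin (n j)) → ℂ) × ℂ))
  | 0 => 0
  | l + 1 => ((l : ℂ) + 1)⁻¹ • (ρ • shiftCLM _ (borelTail ρ c φ l) + c (φ l))

/-- The entry of index `i` is `ρ^(-i) ∑_j c'_(i+j) ∂^(-j-1) φ`. Its derivative releases the term `j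
= 0`, and the rest is `ρ` times the next entry; the recursion of `borelTail` says this on Taylor
coefficients. -/
theorem borelTail_apply {ρ : ℂ} (hρ : ρ ≠ 0)
    {c : ((Σ j, Fin (n j)) → ℂ) →L[ℂ] (ℕ →ᵇ (((Σ j, Fin (n j)) → ℂ) × ℂ))}
    {c' : ℕ → ((Σ j, Fin (n j)) → ℂ) →ₗ[ℂ] (((Σ j, Fin (n j)) → ℂ) × ℂ)}
    (hc : ∀ v i, c v i = (ρ ^ i)⁻¹ • c' i v) (y : ℕ → (Σ j, Fin (n j)) → ℂ) (l i : ℕ) :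
    borelTail ρ c (fun l => (l.factorial : ℂ)⁻¹ • y l) l i =
      ((ρ ^ i)⁻¹ * (l.factorial : ℂ)⁻¹) • ∑ j ∈ Finset.range l, c' (i + j) (y (l - 1 - j)) := by
  induction l generalizing i with
  | zero => simp [borelTail]
  | succ l ih =>
    have h1 : ∑ j ∈ Finset.range (l + 1), c' (i + j) (y (l + 1 - 1 - j)) =
        ∑ j ∈ Finset.range l, c' (i + 1 + j) (y (l - 1 - j)) + c' i (y l) := by
      rw [Finset.sum_range_succ']
      congr 1
      refine Finset.sum_congr rfl fun j _ => ?_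
      have h2 : i + (j + 1) = i + 1 + j := by omega
      have h3 : l + 1 - 1 - (j + 1) = l - 1 - j := by omega
      rw [h2, h3]
    have h4 : borelTail ρ c (fun l => (l.factorial : ℂ)⁻¹ • y l) (l + 1) i =
        ((l : ℂ) + 1)⁻¹ • (ρ • borelTail ρ c (fun l => (l.factorial : ℂ)⁻¹ • y l) l (i + 1) +
          c ((l.factorial : ℂ)⁻¹ • y l) i) := rfl
    rw [h4, h1, ih, hc, map_smul, smul_add, smul_add, smul_smul, smul_smul, smul_smul, smul_smul,
      Nat.factorial_succ]
    push_cast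
    congr 2 <;> rw [mul_inv] <;> field_simp
    rw [pow_succ']

theorem borelResidue_eq_zero (lam : Fin J → ℂ) {a : Fin J → ℂ} {ω : ℂ} (h : ∀ j, a j ≠ ω) :
    borelResidue n lam a ω = 0 := by
  refine ContinuousLinearMap.ext fun x => ?_
  rw [borelResidue_apply]
  exact Prod.ext (funext fun i => if_neg (h i.1)) rfl

/-- The formal solution of the Borel transformed system. -/
def borelFormal (ρ : ℂ) (c : ((Σ j, Fin (n j)) → ℂ) →L[ℂ] (ℕ →ᵇ (((Σ j, Fin (n j)) → ℂ) × ℂ)))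
    (φ : ℕ → (Σ j, Fin (n j)) → ℂ) (l : ℕ) : BorelState n :=
  (φ l, borelTail ρ c φ l)

section Formal

variable {lam a : Fin J → ℂ} {ρ : ℂ}
  {c : ((Σ j, Fin (n j)) → ℂ) →L[ℂ] (ℕ →ᵇ (((Σ j, Fin (n j)) → ℂ) × ℂ))}
  {φ : ℕ → (Σ j, Fin (n j)) → ℂ}

/-- `hrhs` is `(ξ - a_i) φ_i'` equal to the right hand side. Rows with `a_i = 0` give the residue at
`0`; in the others division by `ξ - a_i` gives the geometric sums of `fuchsCoeff`. The tail
component holds by the definition of `borelTail`. -/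
theorem borelFormal_recursion {S : Finset ℂ} (hmem : ∀ j, a j ∈ S)
    (hrhs : ∀ (l : ℕ) i, (l : ℂ) * φ l i - a i.1 * (((l : ℂ) + 1) * φ (l + 1) i) =
      borelRhs n lam (borelFormal ρ c φ l) i) (l : ℕ) :
    ((l : ℂ) + 1) • borelFormal ρ c φ (l + 1) = borelResidue n lam a 0 (borelFormal ρ c φ (l + 1)) +
      ∑ k ∈ Finset.range (l + 1), fuchsCoeff S (borelConst ρ c) (borelResidue n lam a) 0 k
        (borelFormal ρ c φ (l - k)) := by
  have h1 : ∑ k ∈ Finset.range (l + 1),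
      fuchsCoeff S (borelConst ρ c) (borelResidue n lam a) 0 k (borelFormal ρ c φ (l - k)) =
      borelConst ρ c (borelFormal ρ c φ l) + -∑ k ∈ Finset.range (l + 1), ∑ ω ∈ S.erase 0,
        (ω ^ (k + 1))⁻¹ • borelResidue n lam a ω (borelFormal ρ c φ (l - k)) := by
    rw [← Finset.sum_neg_distrib]
    have h2 : borelConst ρ c (borelFormal ρ c φ l) = ∑ k ∈ Finset.range (l + 1),
        (if k = 0 then borelConst ρ c else 0) (borelFormal ρ c φ (l - k)) := by
      rw [Finset.sum_eq_single 0]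
      · simp
      · intro k _ hk
        simp [hk]
      · simp
    rw [h2, ← Finset.sum_add_distrib]
    refine Finset.sum_congr rfl fun k _ => ?_
    rw [fuchsCoeff, add_apply, neg_apply, sum_apply]
    simp only [sub_zero, smul_apply]
  rw [h1]
  refine Prod.ext (funext fun i => ?_) ?_
  · have h3 : ∀ k, (∑ ω ∈ S.erase 0, (ω ^ (k + 1))⁻¹ • borelResidue n lam a ω (borelFormal ρ c φ (l - k))).1 i =
        if a i.1 = 0 then 0 else (a i.1 ^ (k + 1))⁻¹ * borelRhs n lam (borelFormal ρ c φ (l - k)) i := by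
      intro k
      simp only [Prod.fst_sum, Finset.sum_apply, borelResidue_apply, Prod.smul_fst, Pi.smul_apply,
        smul_eq_mul, mul_ite, mul_zero]
      rw [Finset.sum_ite_eq]
      by_cases h4 : a i.1 = 0
      · rw [if_pos h4, if_neg (by simp [h4])]
      · rw [if_neg h4, if_pos (Finset.mem_erase.2 ⟨h4, hmem _⟩)]
    rw [Prod.fst_add, Prod.fst_add, Prod.fst_neg, Prod.fst_sum, Pi.add_apply, Pi.add_apply,
      Pi.neg_apply, Finset.sum_apply, Finset.sum_congr rfl fun k _ => h3 k, borelConst_apply,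
      borelResidue_apply]
    simp only [Pi.zero_apply, zero_add]
    change ((l : ℂ) + 1) * φ (l + 1) i = _
    by_cases h4 : a i.1 = 0
    · have h5 := hrhs (l + 1) i
      rw [h4, zero_mul, sub_zero] at h5
      simp only [if_pos h4, Finset.sum_const_zero, neg_zero, add_zero]
      rw [← h5]
      push_cast
      rfl
    · simp only [if_neg h4, zero_add]
      have h5 := eq_neg_sum_of_recursion h4 (D := fun l => (l : ℂ) * φ l i)
        (s := fun l => borelRhs n lam (borelFormal ρ c φ l) i) (by simp)
        (fun l => by rw [← hrhs l i]; push_cast; rfl) l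
      rw [← h5]
      push_cast
      rfl
  · have h3 : (∑ k ∈ Finset.range (l + 1), ∑ ω ∈ S.erase 0,
        (ω ^ (k + 1))⁻¹ • borelResidue n lam a ω (borelFormal ρ c φ (l - k))).2 = 0 := by
      rw [Prod.snd_sum]
      refine Finset.sum_eq_zero fun k _ => ?_
      rw [Prod.snd_sum]
      refine Finset.sum_eq_zero fun ω _ => ?_
      rw [borelResidue_apply]
      refine BoundedContinuousFunction.ext fun i => ?_
      exact smul_zero ((ω ^ (k + 1))⁻¹)
    rw [Prod.snd_add, Prod.snd_add, Prod.snd_neg, h3, neg_zero, add_zero, borelConst_apply,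
      borelResidue_apply, zero_add, Prod.smul_snd]
    exact smul_inv_smul₀ (Nat.cast_add_one_ne_zero l) _

theorem borelResidue_borelFormal_zero
    (hrhs : ∀ (l : ℕ) i, (l : ℂ) * φ l i - a i.1 * (((l : ℂ) + 1) * φ (l + 1) i) =
      borelRhs n lam (borelFormal ρ c φ l) i) :
    borelResidue n lam a 0 (borelFormal ρ c φ 0) = 0 := by
  rw [borelResidue_apply]
  refine Prod.ext (funext fun i => ?_) rfl
  by_cases h4 : a i.1 = 0
  · have h5 := hrhs 0 i
    rw [h4, zero_mul, sub_zero, Nat.cast_zero, zero_mul] at h5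
    simp only [if_pos h4, ← h5]
    rfl
  · simp only [if_neg h4]
    rfl

end Formal

theorem norm_mulVec_le {ι κ : Type*} [Fintype ι] [Fintype κ] {A : Matrix κ ι ℂ} {K : ℝ}
    (hA : ∀ i j, ‖A i j‖ ≤ K) (hK : 0 ≤ K) (v : ι → ℂ) :
    ‖A.mulVec v‖ ≤ Fintype.card ι * K * ‖v‖ := by
  refine (pi_norm_le_iff_of_nonneg (by positivity)).2 fun i => ?_
  refine (norm_sum_le _ _).trans ?_
  have : ∀ j ∈ Finset.univ, ‖A i j * v j‖ ≤ K * ‖v‖ := fun j _ => by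
    rw [norm_mul]
    exact mul_le_mul (hA i j) (norm_le_pi_norm v j) (norm_nonneg _) hK
  refine (Finset.sum_le_sum this).trans ?_
  rw [Finset.sum_const, nsmul_eq_mul, Finset.card_univ, mul_assoc]

/-- The solution of the differential system satisfied by the Borel transforms of the solutions of
`x² h' = (a + x L + x² ∑ C_j x^j) h`, and of the linear form `∑ r_j x^(j+1)` in them. -/
theorem hasModerateSingularities_of_prepared (lam a : Fin J → ℂ)
    (hlam : ∀ j, 1 ≤ (lam j).re ∧ (lam j).re < 2)
    {C : ℕ → Matrix (Σ j, Fin (n j)) (Σ j, Fin (n j)) ℂ} {r : ℕ → (Σ j, Fin (n j)) → ℂ} {K ρ : ℝ}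
    (hK : 0 ≤ K) (hρ : 1 ≤ ρ) (hC : ∀ l i k, ‖C l i k‖ ≤ K * ρ ^ l) (hr : ∀ l i, ‖r l i‖ ≤ K * ρ ^ l)
    {y : ℕ → (Σ j, Fin (n j)) → ℂ}
    (hy : ∀ (l : ℕ) i, ((l : ℂ) + 1) * y l i = a i.1 * y (l + 1) i +
      (jordanMatrix n lam).mulVec (y l) i +
      ∑ j ∈ Finset.range l, (C j).mulVec (y (l - 1 - j)) i) (κ : ℕ) :
    HasModerateSingularities κ (insert 0 (Finset.univ.image a))
      ((PowerSeries.derivative ℂ)^[κ] (PowerSeries.mk fun l =>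
        (l.factorial : ℂ)⁻¹ * ∑ j ∈ Finset.range l, r j ⬝ᵥ y (l - 1 - j))) := by
  set S : Finset ℂ := insert 0 (Finset.univ.image a) with hS
  have hρ0 : (ρ : ℂ) ≠ 0 := by exact_mod_cast (zero_lt_one.trans_le hρ).ne'
  -- The linear form is carried along with the system as an additional scalar component.
  let c' : ℕ → ((Σ j, Fin (n j)) → ℂ) →ₗ[ℂ] (((Σ j, Fin (n j)) → ℂ) × ℂ) := fun i =>
    (C i).mulVecLin.prod (dotProductBilin ℂ ℂ (r i))
  -- The weight `ρ^(-i)` compensates the geometric growth of `C i` and `r i`: here the convergence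
  -- of the system becomes boundedness of an operator.
  let c'' : ℕ → ((Σ j, Fin (n j)) → ℂ) →L[ℂ] (((Σ j, Fin (n j)) → ℂ) × ℂ) := fun i =>
    LinearMap.toContinuousLinearMap (((ρ : ℂ) ^ i)⁻¹ • c' i)
  have hb : ∀ i, ‖c'' i‖ ≤ Fintype.card (Σ j, Fin (n j)) * K := by
    intro i
    have hpos : 0 < ρ ^ i := pow_pos (zero_lt_one.trans_le hρ) i
    refine ContinuousLinearMap.opNorm_le_bound _ (by positivity) fun v => ?_
    have h1 : ‖c' i v‖ ≤ Fintype.card (Σ j, Fin (n j)) * (K * ρ ^ i) * ‖v‖ := by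
      refine norm_prod_le_iff.2 ⟨norm_mulVec_le (hC i) (by positivity) v, ?_⟩
      have h2 := norm_mulVec_le (A := Matrix.of fun _ : Unit => r i) (fun _ j => hr i j)
        (by positivity) v
      exact (norm_le_pi_norm _ ()).trans h2
    change ‖((ρ : ℂ) ^ i)⁻¹ • c' i v‖ ≤ _
    rw [norm_smul, norm_inv, norm_pow, Complex.norm_of_nonneg (zero_le_one.trans hρ)]
    rw [inv_mul_le_iff₀ hpos]
    exact h1.trans (le_of_eq (by ring))
  set c := seqCLM c'' _ hb with hcdef
  have hc : ∀ v i, c v i = ((ρ : ℂ) ^ i)⁻¹ • c' i v := fun v i => rfl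
  set φ : ℕ → (Σ j, Fin (n j)) → ℂ := fun l => (l.factorial : ℂ)⁻¹ • y l with hφ
  have htail : ∀ l, borelTail ρ c φ l 0 =
      (l.factorial : ℂ)⁻¹ • ∑ j ∈ Finset.range l, c' j (y (l - 1 - j)) := fun l => by
    have := borelTail_apply hρ0 hc y l 0
    simpa using this
  -- This is `hy` divided by `l!`, that is, the Borel transformed system differentiated once.
  have hrhs : ∀ (l : ℕ) i, (l : ℂ) * φ l i - a i.1 * (((l : ℂ) + 1) * φ (l + 1) i) =
      borelRhs n lam (borelFormal ρ c φ l) i := by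
    intro l i
    have h1 : borelRhs n lam (borelFormal ρ c φ l) i = (l.factorial : ℂ)⁻¹ * ((jordanMatrix n lam).mulVec (y l) i -
        y l i + ∑ j ∈ Finset.range l, (C j).mulVec (y (l - 1 - j)) i) := by
      rw [borelRhs_apply, show (borelFormal (ρ : ℂ) c φ l).2 0 = _ from htail l]
      simp only [borelFormal, hφ, Matrix.mulVec_smul, Pi.add_apply, Pi.sub_apply, Pi.smul_apply,
        smul_eq_mul, Prod.smul_fst, Prod.fst_sum, Finset.sum_apply]
      rw [mul_add, mul_sub]
      rfl
    have h2 : ((l : ℂ) + 1) * φ (l + 1) i = (l.factorial : ℂ)⁻¹ * y (l + 1) i := by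
      simp only [hφ, Pi.smul_apply, smul_eq_mul, Nat.factorial_succ]
      have : (l : ℂ) + 1 ≠ 0 := Nat.cast_add_one_ne_zero l
      push_cast
      rw [mul_inv]
      field_simp
    rw [h1, h2]
    simp only [hφ, Pi.smul_apply, smul_eq_mul]
    have := hy l i
    linear_combination (l.factorial : ℂ)⁻¹ * this
  have hmem : ∀ j, a j ∈ S := fun j =>
    Finset.mem_insert_of_mem (Finset.mem_image_of_mem a (Finset.mem_univ j))
  have hR : ∀ ω ∉ S, borelResidue n lam a ω = 0 := fun ω hω =>
    borelResidue_eq_zero lam fun j h => hω (by rw [← h]; exact hmem j)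
  have hmain := hasModerateSingularities_of_formal_solution
    (M := fun ξ => borelConst ρ c + ∑ ω' ∈ S, (ξ - ω')⁻¹ • borelResidue n lam a ω')
    (Finset.mem_insert_self 0 _) (borelExponents_re hlam)
    (fun ω => isFuchsAt_of_sum (borelConst ρ c) hR (nonResonant_borelResidue lam a hlam ω)) hR
    (fun ω hω => (fuchsCoeff_zero_of_notMem hω _ _).symm)
    (borelResidue_borelFormal_zero hrhs) (borelFormal_recursion hmem hrhs)
    -- The scalar component of the entry of index `0` is `∑ r_j ∂^(-j-1) φ`, the Borel transform of
    -- the linear form.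
    (ContinuousLinearMap.snd ℂ _ ℂ ∘L BoundedContinuousFunction.evalCLM ℂ 0 ∘L
      ContinuousLinearMap.snd ℂ _ _) κ
  convert hmain using 4 with l
  change _ = (borelTail ρ c φ l 0).2
  rw [htail, Prod.smul_snd, Prod.snd_sum, smul_eq_mul]
  rfl

end Prepared

/-! ## Preparation of a system with a formal fundamental solution -/

/-- The series `f` has no term of degree less than `k`. -/
def VanishBelow (k : ℤ) (f : LaurentSeries ℂ) : Prop := ∀ m < k, f.coeff m = 0

namespace VanishBelow

variable {k l : ℤ} {f g : LaurentSeries ℂ}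

theorem mono (h : VanishBelow k f) (hl : l ≤ k) : VanishBelow l f := fun m hm => h m (hm.trans_le hl)

theorem add (hf : VanishBelow k f) (hg : VanishBelow k g) : VanishBelow k (f + g) := fun m hm => by
  rw [HahnSeries.coeff_add, hf m hm, hg m hm, add_zero]

theorem neg (hf : VanishBelow k f) : VanishBelow k (-f) := fun m hm => by
  rw [HahnSeries.coeff_neg, hf m hm, neg_zero]

theorem sub (hf : VanishBelow k f) (hg : VanishBelow k g) : VanishBelow k (f - g) := by
  rw [sub_eq_add_neg]
  exact hf.add hg.neg

theorem zero : VanishBelow k 0 := fun _ _ => rfl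

theorem sum {β : Type*} {s : Finset β} {f : β → LaurentSeries ℂ} (h : ∀ b ∈ s, VanishBelow k (f b)) :
    VanishBelow k (∑ b ∈ s, f b) :=
  Finset.sum_induction f (VanishBelow k) (fun _ _ => add) zero h

theorem ofPowerSeries (p : PowerSeries ℂ) : VanishBelow 0 (HahnSeries.ofPowerSeries ℤ ℂ p) :=
  fun m hm => (PowerSeries.coeff_coe p m).trans (if_pos hm)

theorem mono_mul (l : ℤ) (a : ℂ) (h : VanishBelow k f) : VanishBelow (l + k) (LevelOne.mono l a * f) :=
  fun m hm => by rw [coeff_mono_mul, h _ (by omega), mul_zero]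

theorem exists_eq_ofPowerSeries (h : VanishBelow 0 f) :
    f = HahnSeries.ofPowerSeries ℤ ℂ (PowerSeries.mk fun n => f.coeff n) := by
  ext m
  refine Eq.trans ?_ (PowerSeries.coeff_coe _ m).symm
  split_ifs with hm
  · exact h m hm
  · rw [PowerSeries.coeff_mk, Int.natAbs_of_nonneg (not_lt.1 hm)]

theorem exists_eq_mono_mul (h : VanishBelow k f) :
    ∃ p, f = LevelOne.mono k 1 * HahnSeries.ofPowerSeries ℤ ℂ p := by
  have h1 : VanishBelow 0 (LevelOne.mono (-k) 1 * f) := by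
    have := h.mono_mul (-k) 1
    rwa [neg_add_cancel] at this
  refine ⟨PowerSeries.mk fun n => (LevelOne.mono (-k) 1 * f).coeff n, ?_⟩
  · rw [← h1.exists_eq_ofPowerSeries, ← mul_assoc, HahnSeries.single_mul_single, add_neg_cancel,
      one_mul, HahnSeries.single_zero_one, one_mul]

theorem mul (hf : VanishBelow k f) (hg : VanishBelow l g) : VanishBelow (k + l) (f * g) := by
  obtain ⟨p, rfl⟩ := hf.exists_eq_mono_mul
  obtain ⟨q, rfl⟩ := hg.exists_eq_mono_mul
  have h := ((VanishBelow.ofPowerSeries (p * q)).mono_mul l 1).mono_mul k 1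
  rw [map_mul, add_zero] at h
  convert h using 1
  ring

theorem exists_nat (f : LaurentSeries ℂ) : ∃ K : ℕ, VanishBelow (-K) f := by
  obtain ⟨k, p, h, -⟩ := exists_mono_mul_ofPowerSeries f
  refine ⟨(-k).toNat, ?_⟩
  rw [h]
  exact ((VanishBelow.ofPowerSeries p).mono_mul k 1).mono (by omega)

theorem exists_common {β : Type*} [Finite β] (f : β → LaurentSeries ℂ) :
    ∃ K : ℕ, ∀ b, VanishBelow (-K) (f b) := by
  choose K hK using fun b => exists_nat (f b)
  obtain ⟨L, hL⟩ := (Set.finite_range K).bddAbove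
  exact ⟨L, fun b => (hK b).mono (by have := hL ⟨b, rfl⟩; omega)⟩

end VanishBelow

theorem exists_convergent_truncation (f : LaurentSeries ℂ) (L : ℕ) :
    ∃ t, IsConvergent t ∧ VanishBelow L (f - t) := by
  refine ⟨HahnSeries.truncLT (L : ℤ) f, ?_, fun m hm => ?_⟩
  · rw [isConvergent_iff]
    refine ⟨∑ k ∈ Finset.range L, ‖f.coeff k‖, 1, Finset.sum_nonneg fun _ _ => norm_nonneg _, le_rfl,
      fun n => ?_⟩
    simp only [one_pow, mul_one, HahnSeries.coeff_truncLT]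
    split_ifs with h
    · exact Finset.single_le_sum (f := fun k : ℕ => ‖f.coeff k‖) (fun _ _ => norm_nonneg _)
        (Finset.mem_range.2 (by exact_mod_cast h))
    · rw [norm_zero]
      exact Finset.sum_nonneg fun _ _ => norm_nonneg _
  · rw [HahnSeries.coeff_sub, HahnSeries.coeff_truncLT, if_pos hm, sub_self]

/-- The derivation `x² d/dx`. -/
def delta : LaurentSeries ℂ →+ LaurentSeries ℂ :=
  (AddMonoidHom.mulLeft (mono 2 1)).comp (ddx : LaurentSeries ℂ →ₗ[ℂ] LaurentSeries ℂ).toAddMonoidHom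

theorem delta_apply (f : LaurentSeries ℂ) : delta f = mono 2 1 * ddx f := rfl

theorem delta_mul (f g : LaurentSeries ℂ) : delta (f * g) = delta f * g + f * delta g := by
  rw [delta_apply, delta_apply, delta_apply, ddx_mul]
  ring

theorem coeff_delta (f : LaurentSeries ℂ) (m : ℤ) :
    (delta f).coeff m = (m - 1) * f.coeff (m - 1) := by
  rw [delta_apply, coeff_mono_mul, coeff_ddx, one_mul]
  have : m - 2 + 1 = m - 1 := by ring
  rw [this]
  congr 1
  push_cast
  ring

theorem IsConvergent.delta {f : LaurentSeries ℂ} (hf : IsConvergent f) : IsConvergent (delta f) :=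
  isConvergent_mono_mul hf.ddx 2

theorem VanishBelow.delta {k : ℤ} {f : LaurentSeries ℂ} (hf : VanishBelow k f) :
    VanishBelow k (delta f) := fun m hm => by
  rw [coeff_delta, hf _ (by omega), mul_zero]

theorem delta_one : delta 1 = 0 := by
  rw [delta_apply, ddx_one, mul_zero]

/-! ### Gauge transformations of matrix systems -/

section Matrix

variable {α : Type*} [CommRing α] {ι κ τ : Type*} [Fintype ι] [Fintype κ]

theorem map_mul_of_derivation (δ : α →+ α) (hδ : ∀ a b, δ (a * b) = δ a * b + a * δ b)
    (M : Matrix τ κ α) {σ : Type*} (M' : Matrix κ σ α) :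
    (M * M').map δ = M.map δ * M' + M * M'.map δ := by
  ext i j
  simp only [Matrix.map_apply, Matrix.mul_apply, Matrix.add_apply, map_sum, hδ,
    Finset.sum_add_distrib]

/-- A diagonal gauge transformation that commutes with the normal form. -/
theorem shear_equation [DecidableEq ι] (δ : α →+ α) (hδ : ∀ a b, δ (a * b) = δ a * b + a * δ b)
    {F : Matrix τ ι α} {C : Matrix τ τ α} [Fintype τ] {A D E : Matrix ι ι α}
    (hF : F.map δ = C * F - F * A) (hD : D.map δ = D * E) (hA : A * D = D * A) :
    (F * D).map δ = C * (F * D) - F * D * (A - E) := by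
  rw [map_mul_of_derivation δ hδ, hF, hD, Matrix.sub_mul, Matrix.mul_assoc F A, hA, Matrix.mul_sub]
  simp only [Matrix.mul_assoc]
  abel

/-- The gauge transformation `T = F U` where `F` is a formal fundamental solution. -/
theorem truncated_gauge [DecidableEq ι] [DecidableEq κ] (δ : α →+ α)
    (hδ : ∀ a b, δ (a * b) = δ a * b + a * δ b)
    {F T : Matrix κ ι α} {G : Matrix ι κ α} {C : Matrix κ κ α} {A V : Matrix ι ι α}
    (hFG : F * G = 1) (hF : F.map δ = C * F - F * A) (hV : V * (G * T) = 1) (hV' : G * T * V = 1)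
    {y : Matrix κ Unit α} (hy : y.map δ = C * y) :
    T * (V * G) = 1 ∧ V * G * T = 1 ∧
      V * G * (C * T - T.map δ) = V * (A * (G * T) - (G * T).map δ) ∧
      (V * G * y).map δ = V * G * (C * T - T.map δ) * (V * G * y) := by
  have hT : T = F * (G * T) := by rw [← Matrix.mul_assoc, hFG, Matrix.one_mul]
  have h1 : T * (V * G) = 1 := by
    rw [← Matrix.mul_assoc, hT, Matrix.mul_assoc F, hV', Matrix.mul_one, hFG]
  have h2 : V * G * T = 1 := by rw [Matrix.mul_assoc, hV]
  refine ⟨h1, h2, ?_, ?_⟩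
  · have h3 : G * F * (G * T) = G * T := by rw [Matrix.mul_assoc, ← hT]
    -- The other inverse relation follows from the invertibility of `G T`, which `G F` leaves
    -- unchanged.
    have h5 : G * F = 1 := by
      calc G * F = G * F * (G * T * V) := by rw [hV', Matrix.mul_one]
        _ = G * T * V := by rw [← Matrix.mul_assoc, h3]
        _ = 1 := hV'
    have h4 : C * T - T.map δ = F * (A * (G * T) - (G * T).map δ) := by
      conv_lhs => rw [hT, map_mul_of_derivation δ hδ, hF]
      rw [Matrix.sub_mul, Matrix.mul_sub]
      simp only [Matrix.mul_assoc]
      abel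
    rw [h4, Matrix.mul_assoc V, ← Matrix.mul_assoc G, h5, Matrix.one_mul]
  · have h3 : y = T * (V * G * y) := by rw [← Matrix.mul_assoc, h1, Matrix.one_mul]
    have h4 := map_mul_of_derivation δ hδ T (V * G * y)
    rw [← h3, hy] at h4
    have h5 : T * (V * G * y).map δ = C * y - T.map δ * (V * G * y) := by rw [h4]; abel
    calc (V * G * y).map δ = V * G * T * (V * G * y).map δ := by rw [h2, Matrix.one_mul]
      _ = V * G * (C * y - T.map δ * (V * G * y)) := by rw [Matrix.mul_assoc (V * G), h5]
      _ = V * G * ((C * T - T.map δ) * (V * G * y)) := by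
        rw [Matrix.sub_mul, Matrix.mul_assoc C, ← h3]
      _ = _ := by rw [← Matrix.mul_assoc]

end Matrix

section VanishBelow

variable {ι κ τ : Type*} [Fintype κ]

theorem VanishBelow.matrix_mul {k l : ℤ} {M : Matrix ι κ (LaurentSeries ℂ)}
    {M' : Matrix κ τ (LaurentSeries ℂ)} (h : ∀ i j, VanishBelow k (M i j))
    (h' : ∀ i j, VanishBelow l (M' i j)) (i : ι) (j : τ) : VanishBelow (k + l) ((M * M') i j) :=
  VanishBelow.sum fun s _ => (h i s).mul (h' s j)

theorem IsConvergent.matrix_mul {M : Matrix ι κ (LaurentSeries ℂ)}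
    {M' : Matrix κ τ (LaurentSeries ℂ)} (h : ∀ i j, IsConvergent (M i j))
    (h' : ∀ i j, IsConvergent (M' i j)) (i : ι) (j : τ) : IsConvergent ((M * M') i j) :=
  IsConvergent.sum _ fun s _ => (h i s).mul (h' s j)

/-- The entries are power series and the matrix of constant terms is the identity, so the
determinant is a unit of `ℂ[[x]]`. -/
theorem exists_inverse_of_vanishBelow [DecidableEq κ] {U : Matrix κ κ (LaurentSeries ℂ)}
    (hU : ∀ i j, VanishBelow 2 ((U - 1) i j)) :
    ∃ V : Matrix κ κ (LaurentSeries ℂ), V * U = 1 ∧ U * V = 1 ∧ ∀ i j, VanishBelow 0 (V i j) := by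
  have h1 : ∀ i j, VanishBelow 0 ((1 : Matrix κ κ (LaurentSeries ℂ)) i j) := by
    intro i j m hm
    rw [Matrix.one_apply]
    split_ifs
    · rw [HahnSeries.coeff_one, if_neg hm.ne]
    · rfl
  have h0 : ∀ i j, VanishBelow 0 (U i j) := by
    intro i j
    have := ((hU i j).mono (by norm_num : (0 : ℤ) ≤ 2)).add (h1 i j)
    rwa [Matrix.sub_apply, sub_add_cancel] at this
  let u : Matrix κ κ (PowerSeries ℂ) := Matrix.of fun i j => PowerSeries.mk fun n => (U i j).coeff n
  have hu : U = u.map (HahnSeries.ofPowerSeries ℤ ℂ) := by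
    ext1 i j
    exact (h0 i j).exists_eq_ofPowerSeries
  have hc : u.map (PowerSeries.constantCoeff (R := ℂ)) = 1 := by
    ext1 i j
    have h2 := hU i j 0 (by norm_num)
    rw [Matrix.sub_apply, HahnSeries.coeff_sub, sub_eq_zero] at h2
    simp only [u, Matrix.map_apply, Matrix.of_apply, PowerSeries.constantCoeff_mk]
    rw [show (U i j).coeff ((0 : ℕ) : ℤ) = _ from h2, Matrix.one_apply, Matrix.one_apply]
    split_ifs
    · simp
    · rfl
  have hdet : IsUnit u.det := by
    rw [PowerSeries.isUnit_iff_constantCoeff, RingHom.map_det]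
    have : (PowerSeries.constantCoeff (R := ℂ)).mapMatrix u = 1 := hc
    rw [this, Matrix.det_one]
    exact isUnit_one
  have hmap : ∀ M M' : Matrix κ κ (PowerSeries ℂ), M * M' = 1 →
      M.map (HahnSeries.ofPowerSeries ℤ ℂ) * M'.map (HahnSeries.ofPowerSeries ℤ ℂ) = 1 := by
    intro M M' h
    rw [← Matrix.map_mul, h, Matrix.map_one _ (map_zero _) (map_one _)]
  refine ⟨u⁻¹.map (HahnSeries.ofPowerSeries ℤ ℂ), ?_, ?_, fun i j => VanishBelow.ofPowerSeries _⟩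
  · rw [hu]
    exact hmap _ _ (Matrix.nonsing_inv_mul _ hdet)
  · rw [hu]
    exact hmap _ _ (Matrix.mul_nonsing_inv _ hdet)

/-- Rows independent over `ℂ((x))` are independent over the subfield of convergent series, where a
right inverse therefore exists; inverses being unique, it is `S`. -/
theorem isConvergent_of_mul_eq_one [Fintype ι] [DecidableEq ι] [DecidableEq κ]
    {T : Matrix ι κ (LaurentSeries ℂ)} {S : Matrix κ ι (LaurentSeries ℂ)}
    (hT : ∀ i j, IsConvergent (T i j)) (hTS : T * S = 1) (hST : S * T = 1) (i : κ) (j : ι) :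
    IsConvergent (S i j) := by
  let T₀ : Matrix ι κ convergentField := Matrix.of fun i j => ⟨T i j, hT i j⟩
  have hT₀ : T₀.map convergentField.subtype = T := rfl
  have hli : LinearIndependent convergentField T₀.row := by
    rw [Fintype.linearIndependent_iff]
    intro g hg
    have h1 : Matrix.vecMul (fun i => (g i : LaurentSeries ℂ)) T = 0 := by
      funext k
      have := congrArg Subtype.val (congrFun hg k)
      simpa [Matrix.vecMul, dotProduct, T₀] using this
    have h2 := congrArg (fun v => Matrix.vecMul v S) h1
    simp only [Matrix.vecMul_vecMul, hTS, Matrix.vecMul_one, Matrix.zero_vecMul] at h2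
    exact fun i => Subtype.ext (congrFun h2 i)
  obtain ⟨R, hR⟩ := exists_right_inverse hli
  have h1 : T * R.map convergentField.subtype = 1 := by
    have := congrArg (fun M => M.map convergentField.subtype) hR
    simp only [Matrix.map_mul] at this
    rwa [Matrix.map_one _ (map_zero _) (map_one _)] at this
  have h2 : S = R.map convergentField.subtype := by
    rw [← Matrix.mul_one S, ← h1, ← Matrix.mul_assoc, hST, Matrix.one_mul]
  rw [h2]
  exact (R i j).2

end VanishBelow

theorem normalForm_apply {J : ℕ} (n : Fin J → ℕ) (lam a : Fin J → ℂ) (i k : Σ j, Fin (n j)) :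
    normalForm n lam a i k = (if k = i then HahnSeries.C (a i.1) else 0) +
      mono 1 1 * HahnSeries.C (jordanMatrix n lam i k) := by
  obtain ⟨j, s⟩ := i
  obtain ⟨j', s'⟩ := k
  rw [normalForm, Matrix.blockDiagonal'_apply]
  by_cases h : j = j'
  · subst h
    simp only [dif_pos, cast_eq, Matrix.add_apply, Matrix.smul_apply, smul_eq_mul, nilJordan,
      Matrix.of_apply, Matrix.one_apply, jordanMatrix, Sigma.mk.injEq, heq_eq_eq, true_and]
    by_cases h1 : s = s'
    · subst h1
      simp [HahnSeries.C_apply]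
    · have h2 : ¬ s' = s := fun h => h1 h.symm
      by_cases h3 : (s' : ℕ) = s + 1 <;> simp [h1, h2, h3]
  · have h1 : ¬ j' = j := fun h' => h h'.symm
    simp [h, h1, jordanMatrix]

theorem delta_mono (k : ℤ) : delta (mono k 1) = mono k 1 * (HahnSeries.C (k : ℂ) * mono 1 1) := by
  ext m
  rw [coeff_delta, HahnSeries.C_apply, HahnSeries.single_mul_single, HahnSeries.single_mul_single,
    HahnSeries.coeff_single, HahnSeries.coeff_single]
  by_cases h : m = k + 1
  · subst h
    rw [if_pos (by ring), if_pos (by ring)]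
    push_cast
    ring
  · rw [if_neg (by omega), if_neg (by omega), mul_zero]

section Reduction

variable {J : ℕ} {n : Fin J → ℕ}

/-- The exponents can be normalised by an integral shift. -/
theorem exists_normalised_fundamental {N : ℕ} {lam a : Fin J → ℂ}
    {C : Matrix (Fin N) (Fin N) (LaurentSeries ℂ)}
    {F : Matrix (Fin N) (Σ j, Fin (n j)) (LaurentSeries ℂ)}
    {G : Matrix (Σ j, Fin (n j)) (Fin N) (LaurentSeries ℂ)} (hFG : F * G = 1) (hGF : G * F = 1)
    (hF : F.map delta = C * F - F * normalForm n lam a) :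
    ∃ (F' : Matrix (Fin N) (Σ j, Fin (n j)) (LaurentSeries ℂ))
      (G' : Matrix (Σ j, Fin (n j)) (Fin N) (LaurentSeries ℂ)) (lam' : Fin J → ℂ),
      F' * G' = 1 ∧ G' * F' = 1 ∧ (∀ j, 1 ≤ (lam' j).re ∧ (lam' j).re < 2) ∧
      F'.map delta = C * F' - F' * normalForm n lam' a := by
  -- Subtracting this integer places the real part in `[1, 2)`. The lower bound makes solutions
  -- vanish at the origin; the width `1` excludes resonance.
  let k : Fin J → ℤ := fun j => ⌊(lam j).re⌋ - 1
  let D : Matrix (Σ j, Fin (n j)) (Σ j, Fin (n j)) (LaurentSeries ℂ) :=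
    Matrix.diagonal fun i => mono (k i.1) 1
  let D' : Matrix (Σ j, Fin (n j)) (Σ j, Fin (n j)) (LaurentSeries ℂ) :=
    Matrix.diagonal fun i => mono (-k i.1) 1
  let E : Matrix (Σ j, Fin (n j)) (Σ j, Fin (n j)) (LaurentSeries ℂ) :=
    Matrix.diagonal fun i => HahnSeries.C (k i.1 : ℂ) * mono 1 1
  have hDD : D * D' = 1 := by
    rw [Matrix.diagonal_mul_diagonal, ← Matrix.diagonal_one]
    congr 1
    funext i
    rw [HahnSeries.single_mul_single, add_neg_cancel, one_mul, HahnSeries.single_zero_one]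
  have hDD' : D' * D = 1 := by
    rw [Matrix.diagonal_mul_diagonal, ← Matrix.diagonal_one]
    congr 1
    funext i
    rw [HahnSeries.single_mul_single, neg_add_cancel, one_mul, HahnSeries.single_zero_one]
  have hD : D.map delta = D * E := by
    rw [Matrix.diagonal_map (map_zero delta), Matrix.diagonal_mul_diagonal]
    congr 1
    funext i
    exact delta_mono _
  -- The shift depends only on the block, so the diagonal matrix is scalar on each block.
  have hA : normalForm n lam a * D = D * normalForm n lam a := by
    ext1 i j
    rw [Matrix.mul_diagonal, Matrix.diagonal_mul]
    obtain ⟨i₁, i₂⟩ := i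
    obtain ⟨j₁, j₂⟩ := j
    by_cases h : i₁ = j₁
    · subst h
      exact mul_comm _ _
    · rw [normalForm, Matrix.blockDiagonal'_apply_ne _ _ _ h, zero_mul, mul_zero]
  have hAE : normalForm n lam a - E = normalForm n (fun j => lam j - k j) a := by
    ext1 i j
    rw [Matrix.sub_apply, normalForm_apply, normalForm_apply]
    simp only [E, jordanMatrix, Matrix.of_apply, Matrix.diagonal_apply]
    by_cases h : j = i
    · subst h
      simp only [if_true, map_add, map_sub]
      ring
    · rw [if_neg (Ne.symm h), if_neg h, if_neg h, sub_zero, if_neg h]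
  refine ⟨F * D, D' * G, fun j => lam j - k j, ?_, ?_, fun j => ?_, ?_⟩
  · rw [Matrix.mul_assoc, ← Matrix.mul_assoc D, hDD, Matrix.one_mul, hFG]
  · rw [Matrix.mul_assoc, ← Matrix.mul_assoc G, hGF, Matrix.one_mul, hDD']
  · have h1 := Int.floor_le (lam j).re
    have h2 := Int.lt_floor_add_one (lam j).re
    simp only [k, Complex.sub_re, Complex.intCast_re]
    push_cast
    constructor <;> linarith
  · rw [← hAE]
    exact shear_equation delta delta_mul hF hD hA

theorem coeff_ofPowerSeries_mul (p : PowerSeries ℂ) {h : LaurentSeries ℂ} (hh : VanishBelow 1 h)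
    (l : ℕ) : (HahnSeries.ofPowerSeries ℤ ℂ p * h).coeff l =
      ∑ j ∈ Finset.range l, PowerSeries.coeff j p * h.coeff (((l - 1 - j : ℕ) : ℤ) + 1) := by
  obtain ⟨q, rfl⟩ := hh.exists_eq_mono_mul
  have h1 : HahnSeries.ofPowerSeries ℤ ℂ p * (mono 1 1 * HahnSeries.ofPowerSeries ℤ ℂ q) =
      mono 1 1 * HahnSeries.ofPowerSeries ℤ ℂ (p * q) := by
    rw [map_mul]
    ring
  rw [h1, coeff_mono_mul, one_mul]
  rcases l with _ | l
  · rw [VanishBelow.ofPowerSeries (p * q) _ (by norm_num)]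
    simp
  · have h2 : ((l + 1 : ℕ) : ℤ) - 1 = (l : ℤ) := by push_cast; ring
    rw [h2, HahnSeries.ofPowerSeries_apply_coeff, PowerSeries.coeff_mul,
      Finset.Nat.sum_antidiagonal_eq_sum_range_succ_mk]
    refine Finset.sum_congr rfl fun j _ => ?_
    rw [coeff_mono_mul, one_mul, add_sub_cancel_right, HahnSeries.ofPowerSeries_apply_coeff,
      Nat.add_sub_cancel]

theorem sum_jordanMatrix_mul (lam : Fin J → ℂ) (x : (Σ j, Fin (n j)) → ℂ) (i : Σ j, Fin (n j)) :
    ∑ k, jordanMatrix n lam i k * x k = lam i.1 * x i +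
      ∑ k : Σ j, Fin (n j), if k.1 = i.1 ∧ (k.2 : ℕ) = i.2 + 1 then x k else 0 := by
  simp only [jordanMatrix, Matrix.of_apply, add_mul, Finset.sum_add_distrib, ite_mul, zero_mul,
    one_mul, Finset.sum_ite_eq', Finset.mem_univ, if_true]

/-- The formal meromorphic solutions of a prepared system vanish at the origin. -/
theorem vanishBelow_one_of_prepared {lam a : Fin J → ℂ} (hlam : ∀ j, 1 ≤ (lam j).re)
    {g : (Σ j, Fin (n j)) → (Σ j, Fin (n j)) → LaurentSeries ℂ} (hg : ∀ i k, VanishBelow 0 (g i k))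
    {h : (Σ j, Fin (n j)) → LaurentSeries ℂ}
    (hE : ∀ i (m : ℤ), m * (h i).coeff m = a i.1 * (h i).coeff (m + 1) +
      ∑ k, jordanMatrix n lam i k * (h k).coeff m + (∑ k, g i k * h k).coeff (m - 1)) :
    ∀ i, VanishBelow 1 (h i) := by
  obtain ⟨K, hK⟩ := VanishBelow.exists_common h
  -- The order is raised one degree `v ≤ 0` at a time. If `a ≠ 0`, the equation in degree `v - 1`
  -- kills the coefficient; if `a = 0`, it is killed by the factor `v - λ`, nonzero since `Re λ ≥
  -- 1`.
  have key : ∀ p : ℕ, p ≤ K + 1 → ∀ i, VanishBelow (-K + p) (h i) := by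
    intro p
    induction p with
    | zero => intro _ i; simpa using hK i
    | succ p ih =>
      intro hp
      have ihp := ih (by omega)
      set v : ℤ := -K + p with hv
      have hv0 : v ≤ 0 := by omega
      have hsum : ∀ i, VanishBelow v (∑ k, g i k * h k) := fun i => VanishBelow.sum fun k _ => by
        have := (hg i k).mul (ihp k)
        rwa [zero_add] at this
      have h1 : ∀ i, a i.1 * (h i).coeff v = 0 := by
        intro i
        have := hE i (v - 1)
        rw [ihp i _ (by omega), hsum i _ (by omega), mul_zero, Finset.sum_eq_zero, sub_add_cancel,
          add_zero, add_zero] at this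
        · exact this.symm
        · intro k _
          rw [ihp k _ (by omega), mul_zero]
      -- From the end of each Jordan block backwards, so that the off-diagonal term is already zero.
      have h2 : ∀ q : ℕ, ∀ i : Σ j, Fin (n j), n i.1 ≤ i.2 + q → (h i).coeff v = 0 := by
        intro q
        induction q with
        | zero => intro i hi; exact absurd i.2.2 (by omega)
        | succ q ihq =>
          intro i hi
          by_cases ha : a i.1 = 0
          · have h3 := hE i v
            rw [hsum i _ (by omega), ha, zero_mul, zero_add, add_zero, sum_jordanMatrix_mul,
              Finset.sum_eq_zero, add_zero] at h3
            · have h4 : ((v : ℂ) - lam i.1) * (h i).coeff v = 0 := by rw [sub_mul, h3, sub_self]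
              refine (mul_eq_zero.1 h4).resolve_left fun h5 => ?_
              have h6 := congrArg Complex.re h5
              have h7 := hlam i.1
              have h8 : (v : ℝ) ≤ 0 := by exact_mod_cast hv0
              simp only [Complex.sub_re, Complex.intCast_re, Complex.zero_re] at h6
              linarith
            · intro k _
              split_ifs with hk
              · have h9 : n k.1 = n i.1 := congrArg n hk.1
                have h10 := hk.2
                exact ihq k (by omega)
              · rfl
          · exact (mul_eq_zero.1 (h1 i)).resolve_left ha
      intro i m hm
      rcases lt_or_eq_of_le (show m ≤ v by push_cast at hm; omega) with hm' | rfl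
      · exact ihp i m hm'
      · exact h2 (n i.1) i (by omega)
  intro i
  exact (key (K + 1) le_rfl i).mono (by push_cast; omega)

/-- Derivation in `ξ` shifts the coefficients as division by `x` does, regardless of polar terms. -/
theorem iterate_derivative_mk (s : ℕ → ℂ) (k : ℕ) :
    (PowerSeries.derivative ℂ)^[k] (PowerSeries.mk fun l => (l.factorial : ℂ)⁻¹ * s l) =
      PowerSeries.mk fun l => (l.factorial : ℂ)⁻¹ * s (l + k) := by
  induction k with
  | zero => rfl
  | succ k ih =>
    rw [Function.iterate_succ_apply', ih]
    ext l
    rw [PowerSeries.coeff_derivative, PowerSeries.coeff_mk, PowerSeries.coeff_mk,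
      Nat.factorial_succ, show l + 1 + k = l + (k + 1) by omega]
    have : (l : ℂ) + 1 ≠ 0 := Nat.cast_add_one_ne_zero l
    push_cast
    field_simp

/-- The Borel transform of a linear combination of solutions of a prepared system. -/
theorem coeff_reg_borelTransform (f : LaurentSeries ℂ) (l : ℕ) :
    PowerSeries.coeff l (borelTransform f).reg = f.coeff ((l : ℤ) + 1) / (l.factorial : ℂ) := by
  change PowerSeries.coeff l
    (PowerSeries.mk fun n : ℕ => f.coeff ((n : ℤ) + 1) / (n.factorial : ℂ)) = _
  rw [PowerSeries.coeff_mk]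

theorem hasModerateSingularities_of_prepared_system {lam a : Fin J → ℂ}
    (hlam : ∀ j, 1 ≤ (lam j).re ∧ (lam j).re < 2)
    {B : Matrix (Σ j, Fin (n j)) (Σ j, Fin (n j)) (LaurentSeries ℂ)}
    (hB : ∀ i k, IsConvergent (B i k)) (hBA : ∀ i k, VanishBelow 2 ((B - normalForm n lam a) i k))
    {h r : (Σ j, Fin (n j)) → LaurentSeries ℂ} (hh : ∀ i, delta (h i) = ∑ k, B i k * h k)
    (hr : ∀ i, IsConvergent (r i)) :
    ∃ κ, HasModerateSingularities κ (insert 0 (Finset.univ.image a))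
      (borelTransform (∑ i, r i * h i)).reg := by
  choose c hc using fun i k => (hBA i k).exists_eq_mono_mul
  have hnc : ∀ i k, IsConvergent (normalForm n lam a i k) := fun i k => by
    rw [normalForm_apply]
    refine IsConvergent.add ?_ (isConvergent_mono_mul (isConvergent_C _) 1)
    split_ifs
    exacts [isConvergent_C _, IsConvergent.zero]
  have hcb : ∀ i k, GeomBounded fun l => PowerSeries.coeff l (c i k) := fun i k => by
    rw [← isConvergent_ofPowerSeries]
    refine IsConvergent.of_mono_mul (k := 2) ?_
    rw [← hc, Matrix.sub_apply, sub_eq_add_neg]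
    exact (hB i k).add (hnc i k).neg
  have hE : ∀ i (m : ℤ), m * (h i).coeff m = a i.1 * (h i).coeff (m + 1) +
      ∑ k, jordanMatrix n lam i k * (h k).coeff m +
        (∑ k, HahnSeries.ofPowerSeries ℤ ℂ (c i k) * h k).coeff (m - 1) := by
    intro i m
    have h1 : delta (h i) = mono 0 (a i.1) * h i +
        ∑ k, mono 1 (jordanMatrix n lam i k) * h k +
        mono 2 1 * ∑ k, HahnSeries.ofPowerSeries ℤ ℂ (c i k) * h k := by
      have h2 : ∀ k, B i k * h k = (if k = i then mono 0 (a i.1) * h k else 0) +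
          mono 1 (jordanMatrix n lam i k) * h k +
          mono 2 1 * (HahnSeries.ofPowerSeries ℤ ℂ (c i k) * h k) := by
        intro k
        have h3 : B i k = normalForm n lam a i k + mono 2 1 * HahnSeries.ofPowerSeries ℤ ℂ (c i k) := by
          rw [← hc, Matrix.sub_apply]
          ring
        have h4 : mono 1 (jordanMatrix n lam i k) =
            mono 1 1 * HahnSeries.C (jordanMatrix n lam i k) := by
          rw [HahnSeries.C_apply, HahnSeries.single_mul_single, one_mul, add_zero]
        rw [h3, normalForm_apply, h4]
        by_cases hk : k = i
        · simp only [hk, if_true, HahnSeries.C_apply]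
          ring
        · simp only [hk, if_false]
          ring
      rw [hh, Finset.sum_congr rfl fun k _ => h2 k, Finset.sum_add_distrib, Finset.sum_add_distrib,
        Finset.sum_ite_eq', if_pos (Finset.mem_univ i), Finset.mul_sum]
    have h2 := congrArg (fun f => f.coeff (m + 1)) h1
    simp only [coeff_delta, HahnSeries.coeff_add, coeff_mono_mul, HahnSeries.coeff_sum] at h2
    have h3 : m + 1 - 2 = m - 1 := by ring
    rw [h3] at h2
    simp only [HahnSeries.coeff_sum]
    simpa using h2
  have hv := vanishBelow_one_of_prepared (fun j => (hlam j).1)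
    (fun i k => VanishBelow.ofPowerSeries (c i k)) hE
  -- The row `r` may have poles of order `K`. Multiplication by `x^(K+1)` gives a form divisible by
  -- `x`, as required by the Banach space equation; `K + 1` derivations in `ξ` undo it and account
  -- for the multiple poles.
  obtain ⟨K, hK⟩ := VanishBelow.exists_common r
  have hK' : ∀ i, VanishBelow 1 (mono (K + 1) 1 * r i) := fun i => by
    have := (hK i).mono_mul (K + 1) 1
    rwa [add_right_comm, add_neg_cancel, zero_add] at this
  choose ρ hρ using fun i => (hK' i).exists_eq_mono_mul
  have hρb : ∀ i, GeomBounded fun l => PowerSeries.coeff l (ρ i) := fun i => by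
    rw [← isConvergent_ofPowerSeries]
    refine IsConvergent.of_mono_mul (k := 1) ?_
    rw [← hρ]
    exact isConvergent_mono_mul (hr i) _
  obtain ⟨M, s, hM, hs, hMs⟩ := GeomBounded.exists_common
    (ι := ((Σ j, Fin (n j)) × (Σ j, Fin (n j))) ⊕ (Σ j, Fin (n j)))
    (a := Sum.elim (fun p l => PowerSeries.coeff l (c p.1 p.2)) fun i l => PowerSeries.coeff l (ρ i))
    (by rintro (⟨i, k⟩ | i); exacts [hcb i k, hρb i])
  have hmain := hasModerateSingularities_of_prepared lam a hlam
    (C := fun l => Matrix.of fun i k => PowerSeries.coeff l (c i k))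
    (r := fun l i => PowerSeries.coeff l (ρ i)) hM hs (fun l i k => hMs (Sum.inl (i, k)) l)
    (fun l i => hMs (Sum.inr i) l) (y := fun l i => (h i).coeff ((l : ℤ) + 1)) (fun l i => ?_) (K + 1)
  · refine ⟨K + 1, ?_⟩
    have h1 : ∀ l : ℕ, ∑ j ∈ Finset.range l, (fun i => PowerSeries.coeff j (ρ i)) ⬝ᵥ
        (fun i => (h i).coeff (((l - 1 - j : ℕ) : ℤ) + 1)) =
        (∑ i, r i * h i).coeff ((l : ℤ) + 1 - (K + 1)) := by
      intro l
      have h2 : (mono (K + 1) 1 * ∑ i, r i * h i).coeff ((l : ℤ) + 1) =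
          ∑ i, (HahnSeries.ofPowerSeries ℤ ℂ (ρ i) * h i).coeff (l : ℤ) := by
        rw [Finset.mul_sum, HahnSeries.coeff_sum]
        refine Finset.sum_congr rfl fun i _ => ?_
        rw [← mul_assoc, hρ, mul_assoc, coeff_mono_mul, one_mul, add_sub_cancel_right]
      rw [coeff_mono_mul, one_mul] at h2
      rw [h2]
      simp only [dotProduct]
      rw [Finset.sum_comm]
      exact Finset.sum_congr rfl fun i _ => (coeff_ofPowerSeries_mul (ρ i) (hv i) l).symm
    simp only [h1] at hmain
    rw [iterate_derivative_mk] at hmain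
    have h2 : (borelTransform (∑ i, r i * h i)).reg = PowerSeries.mk fun l : ℕ =>
        (l.factorial : ℂ)⁻¹ * (∑ i, r i * h i).coeff (((l + (K + 1) : ℕ) : ℤ) + 1 - (K + 1)) := by
      ext l
      rw [coeff_reg_borelTransform, PowerSeries.coeff_mk]
      have : ((l + (K + 1) : ℕ) : ℤ) + 1 - (K + 1) = (l : ℤ) + 1 := by push_cast; ring
      rw [this, inv_mul_eq_div]
    rw [h2]
    exact hmain
  · have h1 := hE i ((l : ℤ) + 1)
    rw [add_sub_cancel_right, HahnSeries.coeff_sum] at h1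
    simp only [coeff_ofPowerSeries_mul _ (hv _)] at h1
    rw [Finset.sum_comm] at h1
    push_cast at h1 ⊢
    exact h1

/-- A truncation `T` of the normalised formal solution is a convergent gauge transformation to a
prepared system. Normalisation changes the exponents but not the Stokes values, so `S` can be read
from the original ones. -/
theorem exists_hasModerateSingularities {Λ Ω : Finset ℂ} {f : LaurentSeries ℂ}
    (hf : f ∈ solutionSet Λ Ω) :
    ∃ S : Finset ℂ, 0 ∈ S ∧ (∀ ω ∈ S, ω ∈ Submodule.span ℤ (Ω : Set ℂ)) ∧
      ∃ m : ℕ, HasModerateSingularities m S (borelTransform f).reg := by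
  obtain ⟨N, c, J, n, lam₀, a, hc, -, ⟨F₀, G₀, hFG₀, hGF₀, hF₀⟩, -, ha, hD⟩ := hf
  obtain ⟨hC, y, r, hr, hy, rfl⟩ := exists_companion_solution hc hD
  refine ⟨insert 0 (Finset.univ.image a), Finset.mem_insert_self _ _, fun ω hω => ?_, ?_⟩
  · rcases Finset.mem_insert.1 hω with rfl | hω
    · exact zero_mem _
    · obtain ⟨j, -, rfl⟩ := Finset.mem_image.1 hω
      exact ha j
  let C : Matrix (Fin N) (Fin N) (LaurentSeries ℂ) := Matrix.of fun i j => mono 2 1 * companion c i j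
  have hmul : ∀ {τ : Type} (M : Matrix (Fin N) τ (LaurentSeries ℂ)) i j,
      (C * M) i j = mono 2 1 * (companion c * M) i j := fun M i j => by
    simp only [C, Matrix.mul_apply, Matrix.of_apply, Finset.mul_sum, mul_assoc]
  have hF₀' : F₀.map delta = C * F₀ - F₀ * normalForm n lam₀ a := by
    ext1 i j
    have := congrFun (congrFun hF₀ i) j
    rw [Matrix.sub_apply, hmul]
    exact this
  obtain ⟨F, G, lam, hFG, hGF, hlam, hF⟩ := exists_normalised_fundamental hFG₀ hGF₀ hF₀'
  obtain ⟨K, hK⟩ := VanishBelow.exists_common fun p : (Σ j, Fin (n j)) × Fin N => G p.1 p.2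
  -- `G` has poles of order at most `K`, so this precision gives `G T = 1 + O(x²)`.
  choose t htc htv using fun i j => exists_convergent_truncation (F i j) (K + 2)
  let T : Matrix (Fin N) (Σ j, Fin (n j)) (LaurentSeries ℂ) := Matrix.of t
  let U : Matrix (Σ j, Fin (n j)) (Σ j, Fin (n j)) (LaurentSeries ℂ) := G * T - 1
  have hU : ∀ i j, VanishBelow 2 (U i j) := by
    have h1 : U = G * (T - F) := by rw [Matrix.mul_sub, hGF]
    rw [h1]
    have h2 := VanishBelow.matrix_mul (M := G) (M' := T - F) (k := -K) (l := (K + 2 : ℕ))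
      (fun i j => hK (i, j)) (fun i j => by
        have := (htv i j).neg
        rwa [neg_sub] at this)
    refine fun i j => (h2 i j).mono ?_
    push_cast
    omega
  obtain ⟨V, hV, hV', hV0⟩ := exists_inverse_of_vanishBelow hU
  let Y : Matrix (Fin N) Unit (LaurentSeries ℂ) := Matrix.of fun i _ => y i
  have hY : Y.map delta = C * Y := by
    ext1 i j
    rw [hmul, Matrix.map_apply, delta_apply]
    exact congrArg _ (hy i)
  obtain ⟨hT1, hT2, hB, hH⟩ := truncated_gauge delta delta_mul hFG hF hV hV' hY
  set B := V * G * (C * T - T.map delta) with hBdef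
  -- Although `V` and `G` are only formal, their product is the inverse of the convergent matrix
  -- `T`, hence convergent.
  have hTi := isConvergent_of_mul_eq_one (T := T) (fun i j => htc i j) hT1 hT2
  have hBc : ∀ i k, IsConvergent (B i k) := by
    refine IsConvergent.matrix_mul hTi fun i k => ?_
    rw [Matrix.sub_apply, sub_eq_add_neg]
    exact (IsConvergent.matrix_mul (fun i j => isConvergent_mono_mul (hC i j) 2)
      (fun i j => htc i j) i k).add (htc i k).delta.neg
  have hA0 : ∀ i k, VanishBelow 0 (normalForm n lam a i k) := fun i k => by
    rw [normalForm_apply]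
    refine VanishBelow.add ?_ ?_
    · split_ifs
      · rw [← HahnSeries.ofPowerSeries_C]
        exact VanishBelow.ofPowerSeries _
      · exact VanishBelow.zero
    · rw [← HahnSeries.ofPowerSeries_C]
      exact ((VanishBelow.ofPowerSeries _).mono_mul 1 1).mono (by norm_num)
  have hBA : ∀ i k, VanishBelow 2 ((B - normalForm n lam a) i k) := by
    -- With `G T = 1 + U`, the transformed matrix differs from the normal form by `V` times a
    -- commutator with `U` and a derivative of `U`, all of order `x²`.
    have h1 : B - normalForm n lam a = V * ((normalForm n lam a * U -
        U * normalForm n lam a) - (G * T).map delta) := by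
      have h2 : V * (G * T * normalForm n lam a) = normalForm n lam a := by
        rw [← Matrix.mul_assoc V (G * T), hV, Matrix.one_mul]
      rw [hB]
      simp only [U, Matrix.mul_sub, Matrix.sub_mul, Matrix.mul_one, Matrix.one_mul, h2]
      abel
    rw [h1]
    have h2 : ∀ i k, VanishBelow 2 ((normalForm n lam a * U -
        U * normalForm n lam a - (G * T).map delta) i k) := by
      intro i k
      rw [Matrix.sub_apply, Matrix.sub_apply]
      refine VanishBelow.sub (VanishBelow.sub ?_ ?_) ?_
      · have := VanishBelow.matrix_mul hA0 hU i k
        rwa [zero_add] at this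
      · have := VanishBelow.matrix_mul hU hA0 i k
        rwa [add_zero] at this
      · have h3 : delta ((1 : Matrix (Σ j, Fin (n j)) (Σ j, Fin (n j)) (LaurentSeries ℂ)) i k) = 0 := by
          rw [Matrix.one_apply]
          split_ifs
          · exact delta_one
          · exact map_zero _
        have h4 := (hU i k).delta
        simp only [U] at h4
        rwa [Matrix.sub_apply, map_sub, h3, sub_zero] at h4
    have := VanishBelow.matrix_mul hV0 h2
    rwa [zero_add] at this
  have hyT : ∀ i, y i = ∑ k, T i k * (V * G * Y) k () := by
    intro i
    have h1 : T * (V * G * Y) = Y := by rw [← Matrix.mul_assoc, hT1, Matrix.one_mul]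
    exact (congrFun (congrFun h1 i) ()).symm
  have hsum : ∑ i, r i * y i = ∑ k, (∑ i, r i * T i k) * (V * G * Y) k () := by
    simp only [hyT, Finset.mul_sum, Finset.sum_mul]
    rw [Finset.sum_comm]
    simp only [mul_assoc]
  rw [hsum]
  exact hasModerateSingularities_of_prepared_system hlam hBc hBA
    (fun i => congrFun (congrFun hH i) ())
    (fun k => IsConvergent.sum _ fun i _ => (hr i).mul (htc i k))

end Reduction

end LevelOne

end

theorem mainTheorem10 (Λ Ω : Finset ℂ) :
    (∃ H : Subalgebra ℂ (LaurentSeries ℂ),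
      (H : Set (LaurentSeries ℂ)) = LevelOne.solutionSet Λ Ω ∧
      ∀ f ∈ H, LevelOne.ddx f ∈ H) ∧
    (∃ B : Subalgebra ℂ LevelOne.BorelSeries,
      (B : Set LevelOne.BorelSeries) = LevelOne.borelTransform '' LevelOne.solutionSet Λ Ω ∧
      Set.InjOn LevelOne.borelTransform (LevelOne.solutionSet Λ Ω) ∧
      (∀ f ∈ LevelOne.solutionSet Λ Ω, ∀ g ∈ LevelOne.solutionSet Λ Ω,
        LevelOne.borelTransform (f * g) = LevelOne.borelTransform f * LevelOne.borelTransform g) ∧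
      (∀ u ∈ B, LevelOne.BorelSeries.mulXi u ∈ B) ∧
      (∀ u ∈ B, ∀ v ∈ B, LevelOne.BorelSeries.mulXi (u * v) =
        LevelOne.BorelSeries.mulXi u * v + u * LevelOne.BorelSeries.mulXi v) ∧
      (∀ f ∈ LevelOne.solutionSet Λ Ω,
        LevelOne.borelTransform (LevelOne.mono 2 1 * LevelOne.ddx f) =
          LevelOne.BorelSeries.mulXi (LevelOne.borelTransform f) ∧
        LevelOne.borelTransform (LevelOne.ddx f) = LevelOne.BorelSeries.dxi
          (LevelOne.BorelSeries.dxi (LevelOne.BorelSeries.mulXi (LevelOne.borelTransform f)))) ∧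
      (∀ u ∈ B, ∃ S : Finset ℂ, 0 ∈ S ∧
        (∀ ω ∈ S, ω ∈ Submodule.span ℤ (Ω : Set ℂ)) ∧
        ∃ m : ℕ, LevelOne.HasModerateSingularities m S u.reg)) := by
  refine ⟨⟨LevelOne.solutionAlgebra Λ Ω, rfl, fun f hf => LevelOne.ddx_mem_solutionSet hf⟩,
    ⟨LevelOne.borelAlgebra Λ Ω, rfl, LevelOne.borelTransform_injective.injOn,
      fun f _ g _ => LevelOne.borelTransform_mul f g, fun u hu => LevelOne.mulXi_mem_borelAlgebra hu,
      fun u _ v _ => LevelOne.mulXi_mul u v,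
      fun f _ => ⟨LevelOne.borelTransform_mono_mul_ddx f, LevelOne.borelTransform_ddx f⟩, ?_⟩⟩
  rintro u ⟨f, hf, rfl⟩
  exact LevelOne.exists_hasModerateSingularities hf
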